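/- **Setting.** Let $d\ge 1$, let $\Omega\subseteq\mathbb R^d$ be a bounded Lipschitz domain, and let $\Gamma_D\subseteq\partial\Omega$ be closed with positive surface measure. Let $p\in C^0(\overline\Omega)$ with $p^-=\min p>1$ and $p^+=\max p$, let $\delta\ge 0$, and write $p'=\frac{p}{p-1}$. Let $W^{1,q(\cdot)}_D(\Omega)$ be the space of $v\in L^{q(\cdot)}(\Omega)$ with weak gradient in $L^{q(\cdot)}(\Omega;\mathbb R^d)$ and zero trace on $\Gamma_D$. Put $$\mathcal A(x,a)=(\delta+|a|)^{p(x)-2}a,\qquad F(x,a)=(\delta+|a|)^{\frac{p(x)-2}{2}}a,\qquad \varphi'(x,t)=(\delta+t)^{p(x)-2}t,$$ $$\varphi_a(x,t)=\int_0^t\varphi'(x,a+r)\,\frac{r}{a+r}\,\mathrm dr,\qquad (\varphi_a)^*(x,t)=\sup_{r\ge0}\,(rt-\varphi_a(x,r)).$$ Let $\mathcal T_h$ be a conforming simplicial triangulation of $\Omega$ (so that $\overline\Omega$ is the union of its elements) with $h_T/\rho_T\le\omega_0$ for all $T\in\mathcal T_h$, where $h_T=\operatorname{diam}T$ and $\rho_T$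 is the supremum of the radii of balls contained in $T$ with centre in $T$. Let $\xi_T\in T$ be arbitrary quadrature points, and for $x\in T$ put $p_h(x)=p(\xi_T)$, $\varphi_h(x,\cdot)=\varphi(\xi_T,\cdot)$, $F_h(x,\cdot)=F(\xi_T,\cdot)$. Let $f\in L^{p'(\cdot)}(\Omega)\cap L^{p_h'(\cdot)}(\Omega)$ and let $f_h$ be the element-wise mean of $f$. Let $u\in W^{1,p(\cdot)}_D(\Omega)$ be the weak solution of the $p(\cdot)$-Dirichlet problem, i.e. $\int_\Omega\mathcal A(\cdot,\nabla u)\cdot\nabla w\,\mathrm dx=\int_\Omega fw\,\mathrm dx$ for all $w\in W^{1,p(\cdot)}_D(\Omega)$. Let $\mathcal S^1_D(\mathcal T_h)$ be the space of continuous element-wise affine functions in $W^{1,p(\cdot)}_D(\Omega)$. For $v_h\in\mathcal S^1_D(\mathcal T_h)$ and $g$ on $T$ put $\rho_{((\varphi_h)_{|\nabla v_h|})^*,T}(g)=\int_T(\varphi_{|\nabla v_h|})^*(\xi_T,|g|)\,\mathrm dx$ and $\mathrm{osc}_h^2(f,v_h,T)=\rho_{((\varphi_h)_{|\nabla v_h|})^*,T}(h_T(f-f_h))$.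 For $M\subseteq\overline\Omega$ let $\omega_{p,M}(r)=\sup\{|p(x)-p(y)|: x,y\in M,\ |x-y|\le r\}$. For an interior side $S$ (a common facet of two elements $T_+,T_-$) let $h_S=\operatorname{diam}S$, $\omega_S=T_+\cup T_-$, $\mathrm{osc}_h^2(f,v_h,\omega_S)=\sum_{T\in\{T_+,T_-\}}\mathrm{osc}_h^2(f,v_h,T)$, let $\omega_{p,\omega_S}(r)$ be the element-wise constant function on $\omega_S$ equal to $\omega_{p,T}(r)$ on $T\in\{T_+,T_-\}$, and let $[\![F_h(\cdot,\nabla v_h)]\!]_S=F(\xi_{T_+},\nabla v_h|_{T_+})-F(\xi_{T_-},\nabla v_h|_{T_-})$. **Claim.** There exist constants $c(s)>0$, depending only on $d$, $p^-$, $p^+$, $\delta$, $\omega_0$ and $s$, and thresholds $\eta(s)\in(0,\infty]$ for $s>1$, depending only on these quantities and on $\Omega,\Gamma_D,p$, with $\eta(s)=\infty$ for at least one $s>1$, such that the following holds for all $\mathcal T_h$, $(\xi_T)_T$, $f$, $u$ as above. If $s>1$ and $u\in W^{1,p(\cdot)s}_D(\Omega)$, then for every $v_h\in\mathcal S^1_D(\mathcal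 T_h)$: 1. for every $T\in\mathcal T_h$ with $h_T\le\eta(s)$, $$\rho_{((\varphi_h)_{|\nabla v_h|})^*,T}(h_Tf_h)\le c(s)\Big(\|F_h(\cdot,\nabla v_h)-F_h(\cdot,\nabla u)\|_{2,T}^2+\big\|\omega_{p,T}(h_T)^2(1+|\nabla u|^{p(\cdot)s})\big\|_{1,T}+\mathrm{osc}_h^2(f,v_h,T)\Big);$$ 2. for every interior side $S$ with adjacent elements $T_\pm$ satisfying $h_{T_\pm}\le\eta(s)$, $$h_S\big\|[\![F_h(\cdot,\nabla v_h)]\!]_S\big\|_{2,S}^2\le c(s)\Big(\|F_h(\cdot,\nabla v_h)-F_h(\cdot,\nabla u)\|_{2,\omega_S}^2+\big\|\omega_{p,\omega_S}(h_S)^2(1+|\nabla u|^{p(\cdot)s}+|\nabla v_h|^{p_h(\cdot)s})\big\|_{1,\omega_S}+\mathrm{osc}_h^2(f,v_h,\omega_S)\Big).$$ In particular, both estimates hold for some $s>1$ without restriction on the mesh, and $s$ can be chosen arbitrarily close to $1$ if the local mesh-size is small enough. -/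

import Mathlib

open MeasureTheory Set Filter Topology
open scoped ENNReal

noncomputable section

/-- Euclidean space `ℝ^d`. -/
abbrev Rd (d : ℕ) : Type := EuclideanSpace ℝ (Fin d)

/-! ### Domains, variable Lebesgue and Sobolev spaces -/

/-- Bounded Lipschitz domain: bounded, open, connected, and near each boundary point the region
below the graph of a Lipschitz function, in the direction of a unit vector `ν`. -/
structure IsBoundedLipschitzDomain {d : ℕ} (Ω : Set (Rd d)) : Prop where
  isOpen : IsOpen Ω
  isConnected : IsConnected Ω
  isBounded : Bornology.IsBounded Ω
  graph : ∀ x ∈ frontier Ω, ∃ (ν : Rd d) (U : Set (Rd d)) (g : Rd d → ℝ) (K : NNReal),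
    ‖ν‖ = 1 ∧ IsOpen U ∧ x ∈ U ∧ LipschitzWith K g ∧
      ∀ y ∈ U, y ∈ Ω ↔ inner ℝ ν y < g (y - inner ℝ ν y • ν)

/-- `f ∈ L^{q(·)}(M)`: `f` is measurable and the modular `∫_M |f|^{q(x)} dx` is finite. -/
def MemLpVar {d : ℕ} {F : Type*} [NormedAddCommGroup F] (M : Set (Rd d)) (q : Rd d → ℝ)
    (f : Rd d → F) : Prop :=
  AEStronglyMeasurable f (volume.restrict M) ∧
    ∫⁻ x in M, ENNReal.ofReal (‖f x‖ ^ q x) < ∞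

/-- `G` is the weak gradient of `v` in `Ω`. -/
def IsWeakGradient {d : ℕ} (Ω : Set (Rd d)) (v : Rd d → ℝ) (G : Rd d → Rd d) : Prop :=
  ∀ ψ : Rd d → ℝ, ContDiff ℝ (⊤ : ℕ∞) ψ → HasCompactSupport ψ → tsupport ψ ⊆ Ω →
    ∀ e : Rd d, ∫ x in Ω, v x * fderiv ℝ ψ x e = -∫ x in Ω, inner ℝ (G x) e * ψ x

/-- `τ` is the boundary trace of `v ∈ W^{1,1}(Ω)` with weak gradient `G`: smooth functions
converge to `v` in `W^{1,1}(Ω)` while their boundary values converge to `τ` in `L^1(∂Ω)`. -/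
def IsTrace {d : ℕ} (Ω : Set (Rd d)) (v : Rd d → ℝ) (G : Rd d → Rd d) (τ : Rd d → ℝ) : Prop :=
  AEStronglyMeasurable τ ((μHE[d - 1] : Measure (Rd d)).restrict (frontier Ω)) ∧
  ∃ ψ : ℕ → Rd d → ℝ, (∀ n, ContDiff ℝ (⊤ : ℕ∞) (ψ n)) ∧
    Tendsto (fun n => ∫⁻ x in Ω, (‖ψ n x - v x‖ₑ + ‖gradient (ψ n) x - G x‖ₑ)) atTop (𝓝 0) ∧
    Tendsto (fun n => ∫⁻ x in frontier Ω, ‖ψ n x - τ x‖ₑ ∂(μHE[d - 1] : Measure (Rd d)))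
      atTop (𝓝 0)

/-- `v ∈ W^{1,q(·)}_D(Ω)`, with weak gradient `G` (which is unique almost everywhere). -/
structure MemW1D {d : ℕ} (Ω ΓD : Set (Rd d)) (q : Rd d → ℝ) (v : Rd d → ℝ)
    (G : Rd d → Rd d) : Prop where
  memLp : MemLpVar Ω q v
  memLp_gradient : MemLpVar Ω q G
  isWeakGradient : IsWeakGradient Ω v G
  trace_zero : ∃ τ : Rd d → ℝ, IsTrace Ω v G τ ∧
    ∀ᵐ x ∂((μHE[d - 1] : Measure (Rd d)).restrict ΓD), τ x = 0

/-! ### The non-linear operators, for a frozen exponent `q = p(x)` -/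

/-- `A(x,a) = (δ + |a|)^{p(x)-2} a`, with `q = p(x)`. -/
def opA {d : ℕ} (δ q : ℝ) (a : Rd d) : Rd d := (δ + ‖a‖) ^ (q - 2) • a

/-- `F(x,a) = (δ + |a|)^{(p(x)-2)/2} a`, with `q = p(x)`. -/
def opF {d : ℕ} (δ q : ℝ) (a : Rd d) : Rd d := (δ + ‖a‖) ^ ((q - 2) / 2) • a

/-- `φ'(x,t) = (δ + t)^{p(x)-2} t`, with `q = p(x)`. -/
def phiDeriv (δ q t : ℝ) : ℝ := (δ + t) ^ (q - 2) * t

/-- The shifted `N`-function `φ_a(x,t) = ∫_0^t φ'(x,a+s) s/(a+s) ds`, with `q = p(x)`. -/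
def phiShift (δ q a t : ℝ) : ℝ := ∫ s in (0 : ℝ)..t, phiDeriv δ q (a + s) * (s / (a + s))

/-- Fenchel conjugate `ψ^*(t) = sup_{s ≥ 0} (s t - ψ(s))`. -/
def fenchelConj (ψ : ℝ → ℝ) (t : ℝ) : ℝ := sSup ((fun s => s * t - ψ s) '' Ici 0)

/-! ### Triangulations and finite elements -/

/-- The closed simplex with vertex set `t`. -/
def simplex {d : ℕ} (t : Finset (Rd d)) : Set (Rd d) := convexHull ℝ (t : Set (Rd d))

/-- A (conforming, simplicial) triangulation of `Ω`. -/
structure Triangulation {d : ℕ} (Ω : Set (Rd d)) where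
  complex : Geometry.SimplicialComplex ℝ (Rd d)
  finite : complex.faces.Finite
  pure : ∀ s ∈ complex.faces, ∃ t ∈ complex.faces, s ⊆ t ∧ t.card = d + 1
  space_eq : complex.space = closure Ω

namespace Triangulation

variable {d : ℕ} {Ω : Set (Rd d)}

/-- The elements `T ∈ 𝒯_h`, given by their vertex sets. -/
def elements (𝒯 : Triangulation Ω) : Set (Finset (Rd d)) :=
  {t | t ∈ 𝒯.complex.faces ∧ t.card = d + 1}

/-- `S` is (the vertex set of) an interior side, with adjacent elements `t₁` and `t₂`. -/
def IsInteriorSide (𝒯 : Triangulation Ω) (S t₁ t₂ : Finset (Rd d)) : Prop :=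
  t₁ ∈ 𝒯.elements ∧ t₂ ∈ 𝒯.elements ∧ t₁ ≠ t₂ ∧ S ⊆ t₁ ∧ S ⊆ t₂ ∧ S.card = d

end Triangulation

/-- `ρ_T`, the supremum of the radii of balls contained in `T` and centred in `T`. -/
def inradius {d : ℕ} (T : Set (Rd d)) : ℝ := sSup {r | 0 < r ∧ ∃ x ∈ T, Metric.ball x r ⊆ T}

/-- `h_T / ρ_T ≤ ω₀` for all elements `T`. -/
def ChunkinessLE {d : ℕ} {Ω : Set (Rd d)} (𝒯 : Triangulation Ω) (ω₀ : ℝ) : Prop :=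
  ∀ t ∈ 𝒯.elements, Metric.diam (simplex t) / inradius (simplex t) ≤ ω₀

/-- `v ∈ 𝒮¹(𝒯_h)`: continuous on `closure Ω` and affine on each element. -/
def IsP1 {d : ℕ} {Ω : Set (Rd d)} (𝒯 : Triangulation Ω) (v : Rd d → ℝ) : Prop :=
  ContinuousOn v (closure Ω) ∧
    ∀ t ∈ 𝒯.elements, ∃ (g : Rd d) (b : ℝ), ∀ x ∈ simplex t, v x = inner ℝ g x + b

/-- `v ∈ 𝒮¹_D(𝒯_h) = 𝒮¹(𝒯_h) ∩ W^{1,p(·)}_D(Ω)`. -/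
def IsP1D {d : ℕ} {Ω : Set (Rd d)} (𝒯 : Triangulation Ω) (ΓD : Set (Rd d)) (p : Rd d → ℝ)
    (v : Rd d → ℝ) : Prop :=
  IsP1 𝒯 v ∧ ∃ G, MemW1D Ω ΓD p v G

/-- The barycentre of the simplex with vertex set `t`. -/
def barycentre {d : ℕ} (t : Finset (Rd d)) : Rd d := (t.card : ℝ)⁻¹ • ∑ ν ∈ t, ν

/-- The constant value `∇v(T)` of the gradient of a function that is affine on the element `T`;
it is taken at the barycentre, which is an interior point of `T`. -/
def gradOn {d : ℕ} (v : Rd d → ℝ) (t : Finset (Rd d)) : Rd d := gradient v (barycentre t)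

/-! ### The `p(·)`-Dirichlet problem -/

/-- `u ∈ W^{1,p(·)}_D(Ω)`, with weak gradient `G`, satisfies `(A(·,∇u),∇w)_Ω = (f,w)_Ω` for all
`w ∈ W^{1,p(·)}_D(Ω)`. -/
def IsWeakSolution {d : ℕ} (Ω ΓD : Set (Rd d)) (δ : ℝ) (p f u : Rd d → ℝ)
    (G : Rd d → Rd d) : Prop :=
  MemW1D Ω ΓD p u G ∧
    ∀ (w : Rd d → ℝ) (H : Rd d → Rd d), MemW1D Ω ΓD p w H →
      ∫ x in Ω, inner ℝ (opA δ (p x) (G x)) (H x) = ∫ x in Ω, f x * w x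

/-! ### The local quantities; `ξ t ∈ T` is the quadrature point of the element -/

/-- The local modulus of continuity
`ω_{p,M}(r) = sup {|p(x) - p(y)| : x, y ∈ M, |x - y| ≤ r}`. -/
def modulus {d : ℕ} (p : Rd d → ℝ) (M : Set (Rd d)) (r : ℝ) : ℝ :=
  sSup {m | ∃ x ∈ M, ∃ y ∈ M, dist x y ≤ r ∧ m = |p x - p y|}

/-- `ρ_{((φ_h)_{|∇v|})^*, T}(g) = ∫_T ((φ_{|∇v(T)|})^*)(ξ_T, |g|) dx`. -/
def conjModular {d : ℕ} (δ : ℝ) (p : Rd d → ℝ) (ξ : Finset (Rd d) → Rd d) (v : Rd d → ℝ)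
    (t : Finset (Rd d)) (g : Rd d → ℝ) : ℝ≥0∞ :=
  ∫⁻ x in simplex t, ENNReal.ofReal (fenchelConj (phiShift δ (p (ξ t)) ‖gradOn v t‖) |g x|)

/-- The element residual `ρ_{((φ_h)_{|∇v|})^*, T}(h_T f_h)`, where `f_h` is the mean of `f`
over `T`. -/
def elementResidual {d : ℕ} (δ : ℝ) (p : Rd d → ℝ) (ξ : Finset (Rd d) → Rd d) (f v : Rd d → ℝ)
    (t : Finset (Rd d)) : ℝ≥0∞ :=
  conjModular δ p ξ v t fun _ => Metric.diam (simplex t) * ⨍ y in simplex t, f y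

/-- The oscillation `osc_h²(f,v,T) = ρ_{((φ_h)_{|∇v|})^*, T}(h_T (f - f_h))`. -/
def dataOscillation {d : ℕ} (δ : ℝ) (p : Rd d → ℝ) (ξ : Finset (Rd d) → Rd d) (f v : Rd d → ℝ)
    (t : Finset (Rd d)) : ℝ≥0∞ :=
  conjModular δ p ξ v t fun x => Metric.diam (simplex t) * (f x - ⨍ y in simplex t, f y)

/-- The local natural distance `‖F_h(·,∇v) - F_h(·,∇u)‖²_{2,T}`, where `G = ∇u`. -/
def naturalDistance {d : ℕ} (δ : ℝ) (p : Rd d → ℝ) (ξ : Finset (Rd d) → Rd d)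
    (v : Rd d → ℝ) (G : Rd d → Rd d) (t : Finset (Rd d)) : ℝ≥0∞ :=
  ∫⁻ x in simplex t,
    ENNReal.ofReal (‖opF δ (p (ξ t)) (gradOn v t) - opF δ (p (ξ t)) (G x)‖ ^ 2)

/-- `h_S ‖⟦F_h(·,∇v)⟧_S‖²_{2,S}` for the side `S` between the elements `t₁` and `t₂`. -/
def sideJump {d : ℕ} (δ : ℝ) (p : Rd d → ℝ) (ξ : Finset (Rd d) → Rd d) (v : Rd d → ℝ)
    (S t₁ t₂ : Finset (Rd d)) : ℝ≥0∞ :=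
  ENNReal.ofReal (Metric.diam (simplex S)) *
    ∫⁻ _ in simplex S,
      ENNReal.ofReal
        (‖opF δ (p (ξ t₁)) (gradOn v t₁) - opF δ (p (ξ t₂)) (gradOn v t₂)‖ ^ 2)
      ∂(μHE[d - 1] : Measure (Rd d))

/-- `‖ω_{p,T}(h_T)² (1 + |∇u|^{p(·)s})‖_{1,T}`, where `G = ∇u`. -/
def elementExponentTerm {d : ℕ} (p : Rd d → ℝ) (G : Rd d → Rd d) (s : ℝ)
    (t : Finset (Rd d)) : ℝ≥0∞ :=
  ∫⁻ x in simplex t,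
    ENNReal.ofReal (modulus p (simplex t) (Metric.diam (simplex t)) ^ 2 *
      (1 + ‖G x‖ ^ (p x * s)))

/-- The part on the element `T ⊆ ω_S` of
`‖ω_{p,ω_S}(h_S)² (1 + |∇u|^{p(·)s} + |∇v|^{p_h(·)s})‖_{1,ω_S}`, where
`ω_{p,ω_S}(h_S)` is equal to `ω_{p,T}(h_S)` on `T`, and `G = ∇u`. -/
def sideExponentTerm {d : ℕ} (p : Rd d → ℝ) (ξ : Finset (Rd d) → Rd d) (v : Rd d → ℝ)
    (G : Rd d → Rd d) (s : ℝ) (S t : Finset (Rd d)) : ℝ≥0∞ :=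
  ∫⁻ x in simplex t,
    ENNReal.ofReal (modulus p (simplex t) (Metric.diam (simplex S)) ^ 2 *
      (1 + ‖G x‖ ^ (p x * s) + ‖gradOn v t‖ ^ (p (ξ t) * s)))

end

/-! Write z = √s, so that s = z². Both estimates come from testing the equation with one smooth
compactly supported bump whose gradient has a known mean value, followed by Young's inequality in
which a parameter r ≥ 0 is kept free.

Algebra. For a frozen exponent q, the flux A, the map F and the shifted N-function are all governed
by (δ+|a|+|b|)^{q-2}, and `shiftPow` replaces the N-function up to constants. Changing the exponent
from q to P costs |P-q| |log D| with D = δ+|b|. When |P-q| |log D| ≤ 1 the powers of D with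
exponents P and q are comparable; otherwise 1 ≤ (P-q)² log² D may be inserted for free. The
integrability gain is spent twice: one factor z covers exponents that are slightly too large (this
is what `IsSmallOscillation` guarantees), the other absorbs the logarithm, as in
`exists_log_sq_mul_rpow_le`. The outcome is `exists_flux_young`.

Element residual (`exists_residual_le`). For a bump w inside T the mean of ∇w vanishes, so the
constant flux of v_h may be subtracted from the flux of u. This bounds |h_T f_h| r by the errors
plus `shiftPow` at r, for every r, and `exists_fenchelConj_le` turns such a family of inequalities
into a bound of the conjugate.

Jump. A bump across the side has gradient integrals ±κR^{d-1}ν over the two half balls, so the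
equation controls the normal component of the jump of the discrete fluxes. Since v_h is continuous,
the jump a₁-a₂ of its gradient is a multiple of ν, and strong monotonicity gives |F(a₁)-F(a₂)|² as
long as the exponents q₁, q₂ are comparable with the exponent q₀ at the barycentre of the side
(`exists_jump_le_of_comparable`).

The obstacle is that the right-hand side is weighted element by element: the oscillation of p on T₁
multiplies only powers of |a₁| and of |∇u| on T₁, never powers of |a₂|. If p oscillates on T₁ while
|a₂| is huge and |a₁| is not, nothing on the right sees this directly. In that case the bump is cut
off on T₁ inside a strip of width proportional to 1/m. The part of the flux of u that is small on
the strip contributes little because the strip is thin; where the flux is large, |∇u| itself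
dominates a power of M = δ+|a₁|+|a₂|, and the error term on T₁ pays (`exists_strip_pointwise`,
`exists_jump_le_of_strip`). The remaining cases are elementary (`exists_jump_le_of_log`).

Constants. The only smallness needed is that of the oscillation of p on a single element, measured
by `admissibleOscillation`. It is positive for each s > 1, which uniform continuity converts into a
mesh-size, and it is unbounded in s, so that for large s no restriction on the mesh remains. -/

open MeasureTheory Set Filter Topology
open scoped ENNReal

/-! ### Shifted N-functions and their conjugates. -/

noncomputable section

/-- `(c + t)^{q-2} t`, the derivative of an `N`-function shifted by `c`. -/
def shiftDeriv (c q t : ℝ) : ℝ := (c + t) ^ (q - 2) * t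

/-- `(c + t)^{q-2} t²`, which is equivalent to the `N`-function shifted by `c`. -/
def shiftPow (c q t : ℝ) : ℝ := (c + t) ^ (q - 2) * t ^ 2

theorem shiftPow_eq (c q t : ℝ) : shiftPow c q t = t * shiftDeriv c q t := by
  unfold shiftPow shiftDeriv; ring

theorem shiftDeriv_nonneg {c t : ℝ} (q : ℝ) (hc : 0 ≤ c) (ht : 0 ≤ t) : 0 ≤ shiftDeriv c q t := by
  unfold shiftDeriv; positivity

theorem shiftPow_nonneg {c t : ℝ} (q : ℝ) (hc : 0 ≤ c) (ht : 0 ≤ t) : 0 ≤ shiftPow c q t := by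
  unfold shiftPow; positivity

/-- For q < 2 the weight (c+t)^{q-2} decreases in t; in this form both factors are nondecreasing for
every q ≥ 1. -/
theorem shiftDeriv_eq_mul_div {c q t : ℝ} (hc : 0 ≤ c) (ht : 0 ≤ t) :
    shiftDeriv c q t = (c + t) ^ (q - 1) * (t / (c + t)) := by
  unfold shiftDeriv
  rcases eq_or_lt_of_le ht with h | h
  · simp [← h]
  · have : 0 < c + t := by linarith
    rw [show q - 1 = (q - 2) + 1 by ring, Real.rpow_add_one this.ne']
    field_simp

theorem shiftDeriv_mono {c q s t : ℝ} (hq : 1 ≤ q) (hc : 0 ≤ c) (hs : 0 ≤ s) (hst : s ≤ t) :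
    shiftDeriv c q s ≤ shiftDeriv c q t := by
  rcases eq_or_lt_of_le hs with h | h
  · rw [← h]; simpa [shiftDeriv] using shiftDeriv_nonneg q hc (hs.trans hst)
  rw [shiftDeriv_eq_mul_div hc hs, shiftDeriv_eq_mul_div hc (hs.trans hst)]
  have h1 : 0 < c + s := by linarith
  have h2 : 0 < c + t := by linarith
  refine mul_le_mul (Real.rpow_le_rpow h1.le (by linarith) (by linarith)) ?_ (by positivity)
    (by positivity)
  rw [div_le_div_iff₀ h1 h2]
  nlinarith

theorem shiftPow_mono {c q s t : ℝ} (hq : 1 ≤ q) (hc : 0 ≤ c) (hs : 0 ≤ s) (hst : s ≤ t) :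
    shiftPow c q s ≤ shiftPow c q t := by
  rw [shiftPow_eq, shiftPow_eq]
  exact mul_le_mul hst (shiftDeriv_mono hq hc hs hst) (shiftDeriv_nonneg q hc hs) (hs.trans hst)

theorem shiftDeriv_continuousOn {c q : ℝ} (hq : 1 < q) (hc : 0 ≤ c) :
    ContinuousOn (shiftDeriv c q) (Ici 0) := by
  rcases eq_or_lt_of_le hc with h | h
  · have : EqOn (shiftDeriv c q) (fun t => t ^ (q - 1)) (Ici 0) := by
      intro t ht
      rcases eq_or_lt_of_le (mem_Ici.1 ht) with h0 | h0
      · simp [shiftDeriv, ← h0, Real.zero_rpow (by linarith : q - 1 ≠ 0)]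
      · simp only [shiftDeriv, ← h, zero_add]
        rw [show q - 1 = (q - 2) + 1 by ring, Real.rpow_add_one h0.ne']
    exact ContinuousOn.congr (fun t _ => (Real.continuous_rpow_const
      (by linarith)).continuousAt.continuousWithinAt) this
  · intro t ht
    have ht := mem_Ici.1 ht
    refine ContinuousAt.continuousWithinAt (ContinuousAt.mul ?_ continuousAt_id)
    exact ContinuousAt.rpow_const (by fun_prop) (Or.inl (by positivity))

theorem shiftDeriv_intervalIntegrable {c q s t : ℝ} (hq : 1 < q) (hc : 0 ≤ c) (hs : 0 ≤ s)
    (ht : 0 ≤ t) : IntervalIntegrable (shiftDeriv c q) volume s t :=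
  ((shiftDeriv_continuousOn hq hc).mono fun _ hx => (le_min hs ht).trans hx.1).intervalIntegrable

/-- The factor a+s of φ'(a+s) cancels the denominator, so the shift enters only through δ+a. -/
theorem phiShift_eq_integral {δ q a t : ℝ} (ha : 0 ≤ a) (ht : 0 ≤ t) :
    phiShift δ q a t = ∫ s in (0 : ℝ)..t, shiftDeriv (δ + a) q s := by
  refine intervalIntegral.integral_congr fun s hs => ?_
  rw [uIcc_of_le ht] at hs
  simp only [phiDeriv, shiftDeriv]
  rcases eq_or_lt_of_le hs.1 with h | h
  · simp [← h]
  · have : a + s ≠ 0 := by linarith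
    rw [add_assoc δ a s]
    field_simp

theorem phiShift_le_shiftPow {δ q a t : ℝ} (hq : 1 < q) (hδ : 0 ≤ δ) (ha : 0 ≤ a) (ht : 0 ≤ t) :
    phiShift δ q a t ≤ shiftPow (δ + a) q t := by
  rw [phiShift_eq_integral ha ht]
  have hc : 0 ≤ δ + a := by positivity
  calc ∫ s in (0 : ℝ)..t, shiftDeriv (δ + a) q s
      ≤ ∫ _ in (0 : ℝ)..t, shiftDeriv (δ + a) q t :=
        intervalIntegral.integral_mono_on ht (shiftDeriv_intervalIntegrable hq hc le_rfl ht)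
          intervalIntegrable_const fun s hs => shiftDeriv_mono hq.le hc hs.1 hs.2
    _ = shiftPow (δ + a) q t := by
        rw [intervalIntegral.integral_const, shiftPow_eq]; simp

theorem phiShift_nonneg {δ q a t : ℝ} (hδ : 0 ≤ δ) (ha : 0 ≤ a) (ht : 0 ≤ t) :
    0 ≤ phiShift δ q a t := by
  rw [phiShift_eq_integral ha ht]
  exact intervalIntegral.integral_nonneg ht fun s hs =>
    shiftDeriv_nonneg q (by positivity) hs.1

/-- Comparability of powers of comparable numbers. -/
theorem rpow_le_of_le_two_mul {x y e E : ℝ} (hx : 0 < x) (hy : 0 < y) (hxy : x ≤ 2 * y)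
    (hyx : y ≤ 2 * x) (he : |e| ≤ E) : x ^ e ≤ 2 ^ E * y ^ e := by
  have h1 : (x / y) ^ e ≤ 2 ^ E := by
    rcases le_total 0 e with h | h
    · calc (x / y) ^ e ≤ 2 ^ e := Real.rpow_le_rpow (by positivity)
            ((div_le_iff₀ hy).2 hxy) h
        _ ≤ 2 ^ E := Real.rpow_le_rpow_of_exponent_le (by norm_num) ((le_abs_self e).trans he)
    · calc (x / y) ^ e = (y / x) ^ (-e) := by
            rw [← inv_div, Real.inv_rpow (by positivity), Real.rpow_neg (by positivity)]
        _ ≤ 2 ^ (-e) := Real.rpow_le_rpow (by positivity)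
            ((div_le_iff₀ hx).2 hyx) (by linarith)
        _ ≤ 2 ^ E := Real.rpow_le_rpow_of_exponent_le (by norm_num) ((neg_le_abs e).trans he)
  rw [Real.div_rpow hx.le hy.le, div_le_iff₀ (by positivity)] at h1
  exact h1

/-- Only the integral over [t/2, t] is kept, where the integrand is at least its value at t/2. The
factor 2^Q compares the weights at t/2 and t, and 4 comes from (t/2)². -/
theorem shiftPow_le_phiShift {δ q a t Q : ℝ} (hq : 1 < q) (hQ : q ≤ Q) (hδ : 0 ≤ δ) (ha : 0 ≤ a)
    (ht : 0 ≤ t) : shiftPow (δ + a) q t ≤ 4 * 2 ^ Q * phiShift δ q a t := by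
  have hc : 0 ≤ δ + a := by positivity
  set c := δ + a with hcdef
  rcases eq_or_lt_of_le ht with h0 | h0
  · have := phiShift_nonneg (q := q) hδ ha ht
    have h2 : shiftPow c q t = 0 := by simp [shiftPow, ← h0]
    rw [h2]; positivity
  rw [phiShift_eq_integral ha ht, ← hcdef, ← intervalIntegral.integral_add_adjacent_intervals
    (shiftDeriv_intervalIntegrable hq hc le_rfl (by positivity : 0 ≤ t / 2))
    (shiftDeriv_intervalIntegrable hq hc (by positivity : 0 ≤ t / 2) ht)]
  have h1 : 0 ≤ ∫ s in (0 : ℝ)..t / 2, shiftDeriv c q s :=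
    intervalIntegral.integral_nonneg (by positivity) fun s hs => shiftDeriv_nonneg q hc hs.1
  have h2 : shiftDeriv c q (t / 2) * (t / 2) ≤ ∫ s in t / 2..t, shiftDeriv c q s := by
    calc shiftDeriv c q (t / 2) * (t / 2) = ∫ _ in t / 2..t, shiftDeriv c q (t / 2) := by
          rw [intervalIntegral.integral_const, smul_eq_mul]; ring
      _ ≤ _ := intervalIntegral.integral_mono_on (by linarith) intervalIntegrable_const
          (shiftDeriv_intervalIntegrable hq hc (by positivity) ht)
          fun s hs => shiftDeriv_mono hq.le hc (by positivity) hs.1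
  have h3 : (c + t) ^ (q - 2) ≤ 2 ^ Q * (c + t / 2) ^ (q - 2) :=
    rpow_le_of_le_two_mul (by positivity) (by positivity) (by linarith) (by linarith)
      (abs_le.2 ⟨by linarith, by linarith⟩)
  calc shiftPow c q t ≤ (2 ^ Q * (c + t / 2) ^ (q - 2)) * t ^ 2 := by
        unfold shiftPow; gcongr
    _ = 4 * 2 ^ Q * (shiftDeriv c q (t / 2) * (t / 2)) := by unfold shiftDeriv; ring
    _ ≤ _ := by gcongr; linarith

/-- The lower growth index is min(q, 2): for q ≥ 2 the weight does not increase and l² remains, for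
q ≤ 2 it grows at most by l^{q-2}. With θ > 0 the gain l^{1+θ} beats l, which drives every
absorption argument below. -/
theorem shiftPow_scale {c q l θ t : ℝ} (hc : 0 ≤ c) (ht : 0 ≤ t) (hl : 0 < l) (hl1 : l ≤ 1)
    (hθ : θ ≤ 1) (hθq : 1 + θ ≤ q) : shiftPow c q (l * t) ≤ l ^ (1 + θ) * shiftPow c q t := by
  rcases eq_or_lt_of_le ht with h0 | h0
  · simp [shiftPow, ← h0]
  have hl2 : l ^ 2 = l ^ (2 : ℝ) := by norm_cast
  unfold shiftPow
  rcases le_total 2 q with h | h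
  · have h1 : (c + l * t) ^ (q - 2) ≤ (c + t) ^ (q - 2) :=
      Real.rpow_le_rpow (by positivity) (by nlinarith) (by linarith)
    have h2 : l ^ 2 ≤ l ^ (1 + θ) := by
      rw [hl2]; exact Real.rpow_le_rpow_of_exponent_ge hl hl1 (by linarith)
    calc (c + l * t) ^ (q - 2) * (l * t) ^ 2 = (c + l * t) ^ (q - 2) * l ^ 2 * t ^ 2 := by ring
      _ ≤ (c + t) ^ (q - 2) * l ^ (1 + θ) * t ^ 2 := by gcongr
      _ = _ := by ring
  · have h1 : (c + l * t) ^ (q - 2) ≤ (l * (c + t)) ^ (q - 2) :=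
      Real.rpow_le_rpow_of_nonpos (by positivity) (by nlinarith) (by linarith)
    rw [Real.mul_rpow hl.le (by positivity)] at h1
    have h2 : l ^ (q - 2) * l ^ 2 ≤ l ^ (1 + θ) := by
      rw [hl2, ← Real.rpow_add hl]
      exact Real.rpow_le_rpow_of_exponent_ge hl hl1 (by linarith)
    calc (c + l * t) ^ (q - 2) * (l * t) ^ 2 ≤ l ^ (q - 2) * (c + t) ^ (q - 2) * (l * t) ^ 2 := by
          gcongr
      _ = (l ^ (q - 2) * l ^ 2) * ((c + t) ^ (q - 2) * t ^ 2) := by ring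
      _ ≤ _ := by gcongr

theorem exists_le_shiftDeriv {c q : ℝ} (hq : 1 < q) (hc : 0 ≤ c) (B : ℝ) :
    ∃ s, 0 < s ∧ B ≤ shiftDeriv c q s := by
  obtain ⟨s, hs, hs1⟩ : ∃ s : ℝ, max c 1 ≤ s ∧ 2 ^ |q - 2| * B ≤ s ^ (q - 1) :=
    ((eventually_ge_atTop (max c 1)).and ((tendsto_rpow_atTop (by linarith :
      0 < q - 1)).eventually_ge_atTop (2 ^ |q - 2| * B))).exists
  have hs0 : 0 < s := lt_of_lt_of_le (by simp) hs
  have hcs : c ≤ s := (le_max_left _ _).trans hs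
  refine ⟨s, hs0, ?_⟩
  have h1 : s ^ (q - 2) ≤ 2 ^ |q - 2| * (c + s) ^ (q - 2) :=
    rpow_le_of_le_two_mul hs0 (by positivity) (by linarith) (by linarith) le_rfl
  have h2 : s ^ (q - 1) ≤ 2 ^ |q - 2| * shiftDeriv c q s := by
    rw [show q - 1 = (q - 2) + 1 by ring, Real.rpow_add_one hs0.ne', shiftDeriv, ← mul_assoc]
    gcongr
  exact le_of_mul_le_mul_left (hs1.trans h2) (by positivity)

/-- A real `sSup` is 0 on unbounded sets, so the conjugate is meaningful only because φ grows
superlinearly, that is, because q > 1. -/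
theorem bddAbove_fenchel {δ q a : ℝ} (hq : 1 < q) (hδ : 0 ≤ δ) (ha : 0 ≤ a) (α : ℝ) :
    BddAbove ((fun s => s * α - phiShift δ q a s) '' Ici 0) := by
  have hc : 0 ≤ δ + a := by positivity
  obtain ⟨s₁, hs₁, h1⟩ := exists_le_shiftDeriv hq hc (4 * 2 ^ q * |α|)
  refine ⟨s₁ * |α|, ?_⟩
  rintro _ ⟨s, hs, rfl⟩
  have hs : 0 ≤ s := hs
  have hpos := phiShift_nonneg (q := q) hδ ha hs
  have hsα : s * α ≤ s * |α| := by gcongr; exact le_abs_self α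
  dsimp only
  rcases le_total s s₁ with h | h
  · have : s * |α| ≤ s₁ * |α| := by gcongr
    linarith
  · have h2 := shiftDeriv_mono hq.le hc hs₁.le h
    have h3 := shiftPow_le_phiShift hq le_rfl hδ ha hs
    rw [shiftPow_eq] at h3
    have h4 : 4 * 2 ^ q * (s * |α|) ≤ 4 * 2 ^ q * phiShift δ q a s := by
      calc 4 * 2 ^ q * (s * |α|) = s * (4 * 2 ^ q * |α|) := by ring
        _ ≤ s * shiftDeriv (δ + a) q s := by gcongr; exact h1.trans h2
        _ ≤ _ := h3
    have h5 := le_of_mul_le_mul_left h4 (by positivity)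
    have : 0 ≤ s₁ * |α| := by positivity
    linarith

theorem fenchelConj_nonneg {δ q a : ℝ} (hq : 1 < q) (hδ : 0 ≤ δ) (ha : 0 ≤ a) (α : ℝ) :
    0 ≤ fenchelConj (phiShift δ q a) α :=
  le_csSup (bddAbove_fenchel hq hδ ha α) ⟨0, by simp, by simp [phiShift]⟩

theorem mul_le_fenchelConj_add {δ q a r : ℝ} (hq : 1 < q) (hδ : 0 ≤ δ) (ha : 0 ≤ a) (hr : 0 ≤ r)
    (α : ℝ) : α * r ≤ fenchelConj (phiShift δ q a) α + shiftPow (δ + a) q r := by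
  have h1 : r * α - phiShift δ q a r ≤ fenchelConj (phiShift δ q a) α :=
    le_csSup (bddAbove_fenchel hq hδ ha α) ⟨r, hr, rfl⟩
  have h2 := phiShift_le_shiftPow hq hδ ha hr
  linarith

/-- A Young type inequality for all `r` bounds the Fenchel conjugate. -/
theorem exists_fenchelConj_le (pm pp : ℝ) (hpm : 1 < pm) (C : ℝ) (hC : 0 < C) :
    ∃ C', 0 < C' ∧ ∀ δ q a α Y : ℝ, pm ≤ q → q ≤ pp → 0 ≤ δ → 0 ≤ a → 0 ≤ Y →
      (∀ r, 0 ≤ r → α * r ≤ C * (Y + shiftPow (δ + a) q r)) →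
      fenchelConj (phiShift δ q a) α ≤ C' * Y := by
  set θ := min pm 2 - 1 with hθ
  have hθ0 : 0 < θ := by rw [hθ, sub_pos]; exact lt_min hpm (by norm_num)
  have hθ1 : θ ≤ 1 := by have := min_le_right pm 2; linarith
  -- The hypothesis will be used at l r instead of r: the left side scales like l, the `shiftPow`
  -- term like l^{1+θ}. For this l the latter is at most l φ(r), and division by l leaves the
  -- constant C/l.
  obtain ⟨l, hl1, hl0, hl⟩ : ∃ l : ℝ, l ≤ 1 ∧ 0 < l ∧ C * (l ^ θ * (4 * 2 ^ pp)) ≤ 1 := by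
    set m := C * (4 * 2 ^ pp) with hm
    have hm0 : 0 < m := by positivity
    refine ⟨min 1 (m⁻¹ ^ (θ⁻¹)), min_le_left _ _, by positivity, ?_⟩
    have h1 : (min 1 (m⁻¹ ^ (θ⁻¹))) ^ θ ≤ m⁻¹ := by
      calc (min 1 (m⁻¹ ^ (θ⁻¹))) ^ θ ≤ (m⁻¹ ^ (θ⁻¹)) ^ θ :=
            Real.rpow_le_rpow (by positivity) (min_le_right _ _) hθ0.le
        _ = m⁻¹ := Real.rpow_inv_rpow (by positivity) hθ0.ne'
    calc _ = m * (min 1 (m⁻¹ ^ (θ⁻¹))) ^ θ := by rw [hm]; ring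
      _ ≤ m * m⁻¹ := by gcongr
      _ = 1 := mul_inv_cancel₀ hm0.ne'
  refine ⟨C / l, by positivity, fun δ q a α Y hq1 hq2 hδ ha hY h => ?_⟩
  have hq : 1 < q := hpm.trans_le hq1
  refine csSup_le ⟨_, 0, by simp, rfl⟩ ?_
  rintro _ ⟨r, hr, rfl⟩
  have hr : 0 ≤ r := hr
  dsimp only
  have h1 := h (l * r) (by positivity)
  have h2 : shiftPow (δ + a) q (l * r) ≤ l ^ (1 + θ) * shiftPow (δ + a) q r :=
    shiftPow_scale (by positivity) hr hl0 hl1 hθ1 (by have := min_le_left pm 2; linarith)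
  have h3 := shiftPow_le_phiShift hq hq2 hδ ha hr
  have hpos := phiShift_nonneg (q := q) hδ ha hr
  have h4 : C * shiftPow (δ + a) q (l * r) ≤ l * phiShift δ q a r := by
    calc C * shiftPow (δ + a) q (l * r)
        ≤ C * (l ^ (1 + θ) * (4 * 2 ^ pp * phiShift δ q a r)) := by gcongr; exact h2.trans (by gcongr)
      _ = C * (l ^ θ * (4 * 2 ^ pp)) * (l * phiShift δ q a r) := by
          rw [add_comm 1 θ, Real.rpow_add_one hl0.ne']; ring
      _ ≤ 1 * (l * phiShift δ q a r) := by gcongr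
      _ = _ := one_mul _
  have h5 : l * (r * α - phiShift δ q a r) ≤ l * (C / l * Y) := by
    rw [← mul_assoc, mul_div_cancel₀ _ hl0.ne']
    nlinarith
  exact le_of_mul_le_mul_left h5 hl0

end

/-! ### Monotonicity and continuity of A and F for a frozen exponent. -/

noncomputable section

/-- For q ≥ 2 the weight increases and the constant is 1. For q ≤ 2, Bernoulli's inequality with
exponent 2-q in [0,1] controls the ratio of the weights and the factor q-1 survives. -/
theorem shiftDeriv_sub_ge {δ q x y : ℝ} (hq : 1 < q) (hδ : 0 ≤ δ) (hy : 0 ≤ y) (hyx : y ≤ x) :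
    min 1 (q - 1) * ((δ + x) ^ (q - 2) * (x - y)) ≤ shiftDeriv δ q x - shiftDeriv δ q y := by
  have hx := hy.trans hyx
  have h0 : 0 ≤ (δ + x) ^ (q - 2) * (x - y) := mul_nonneg (by positivity) (by linarith)
  rcases eq_or_lt_of_le hy with hy0 | hy0
  · rw [← hy0]
    have : min 1 (q - 1) * ((δ + x) ^ (q - 2) * (x - 0)) ≤ 1 * ((δ + x) ^ (q - 2) * (x - 0)) := by
      gcongr
      exact min_le_left _ _
    simpa [shiftDeriv] using this
  have hDx : 0 < δ + x := by linarith
  have hDy : 0 < δ + y := by linarith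
  unfold shiftDeriv
  rcases le_total 2 q with h | h
  · have h1 : (δ + y) ^ (q - 2) ≤ (δ + x) ^ (q - 2) :=
      Real.rpow_le_rpow hDy.le (by linarith) (by linarith)
    calc _ ≤ 1 * ((δ + x) ^ (q - 2) * (x - y)) := by gcongr; exact min_le_left _ _
      _ ≤ _ := by nlinarith
  · have h1 : ((δ + x) / (δ + y)) ^ (2 - q) ≤ 1 + (2 - q) * ((x - y) / (δ + y)) := by
      have := rpow_one_add_le_one_add_mul_self (s := (x - y) / (δ + y)) (p := 2 - q)
        (by have : 0 ≤ (x - y) / (δ + y) := div_nonneg (by linarith) hDy.le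
            linarith) (by linarith) (by linarith)
      convert this using 2
      field_simp; ring
    have h2 : (x - y) / (δ + y) * y ≤ x - y := by
      rw [div_mul_eq_mul_div, div_le_iff₀ hDy]; nlinarith
    have h3 : (δ + y) ^ (q - 2) = (δ + x) ^ (q - 2) * ((δ + x) / (δ + y)) ^ (2 - q) := by
      rw [Real.div_rpow hDx.le hDy.le, ← neg_sub q 2, Real.rpow_neg hDx.le, Real.rpow_neg hDy.le]
      have : (δ + x) ^ (q - 2) ≠ 0 := by positivity
      field_simp
    rw [h3]
    have h4 : ((δ + x) / (δ + y)) ^ (2 - q) * y ≤ y + (2 - q) * (x - y) := by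
      calc _ ≤ (1 + (2 - q) * ((x - y) / (δ + y))) * y := by gcongr
        _ = y + (2 - q) * ((x - y) / (δ + y) * y) := by ring
        _ ≤ _ := by gcongr
    calc _ ≤ (q - 1) * ((δ + x) ^ (q - 2) * (x - y)) := by gcongr; exact min_le_right _ _
      _ = (δ + x) ^ (q - 2) * (x - (y + (2 - q) * (x - y))) := by ring
      _ ≤ (δ + x) ^ (q - 2) * (x - ((δ + x) / (δ + y)) ^ (2 - q) * y) := by gcongr
      _ = _ := by ring

/-- Increments of powers `0 < t ≤ 1`. -/
theorem one_sub_rpow_le {t γ Γ : ℝ} (ht : 0 < t) (ht1 : t ≤ 1) (hγΓ : γ ≤ Γ) (hΓ : 1 ≤ Γ) :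
    1 - t ^ γ ≤ Γ * (1 - t) := by
  have h1 : t ^ Γ ≤ t ^ γ := Real.rpow_le_rpow_of_exponent_ge ht ht1 hγΓ
  have h2 := one_add_mul_self_le_rpow_one_add (s := t - 1) (by linarith) hΓ
  rw [add_sub_cancel] at h2
  nlinarith

/-- The weight may be singular at the smaller argument when q < 2, but the factor y compensates this
because 2-q ≤ 1. Hence only the weight at the larger argument appears on the right. -/
theorem abs_rpow_sub_mul_le {δ q Q x y : ℝ} (hq : 1 < q) (hQ : q ≤ Q) (hδ : 0 ≤ δ) (hy : 0 ≤ y)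
    (hyx : y ≤ x) :
    |(δ + x) ^ (q - 2) - (δ + y) ^ (q - 2)| * y ≤ Q * ((δ + x) ^ (q - 2) * (x - y)) := by
  have hx := hy.trans hyx
  have hxy : 0 ≤ x - y := by linarith
  have hQ0 : 0 < Q := by linarith
  rcases eq_or_lt_of_le hy with hy0 | hy0
  · rw [← hy0, mul_zero, sub_zero]; positivity
  have hDx : 0 < δ + x := by linarith
  have hDy : 0 < δ + y := by linarith
  have ht1 : (δ + y) / (δ + x) ≤ 1 := (div_le_one hDx).2 (by linarith)
  have ht0 : 0 < (δ + y) / (δ + x) := by positivity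
  have h1t : 1 - (δ + y) / (δ + x) = (x - y) / (δ + x) := by field_simp; ring
  have hX : 0 < (δ + x) ^ (q - 2) := by positivity
  rcases le_total 2 q with h | h
  · have h1 : (δ + y) ^ (q - 2) ≤ (δ + x) ^ (q - 2) :=
      Real.rpow_le_rpow hDy.le (by linarith) (by linarith)
    rw [abs_of_nonneg (by linarith)]
    have h2 := one_sub_rpow_le ht0 ht1 (γ := q - 2) (Γ := Q) (by linarith) (by linarith)
    rw [h1t, Real.div_rpow hDy.le hDx.le] at h2
    calc ((δ + x) ^ (q - 2) - (δ + y) ^ (q - 2)) * y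
        = (δ + x) ^ (q - 2) * (1 - (δ + y) ^ (q - 2) / (δ + x) ^ (q - 2)) * y := by
          field_simp
      _ ≤ (δ + x) ^ (q - 2) * (Q * ((x - y) / (δ + x))) * y := by gcongr
      _ = Q * ((δ + x) ^ (q - 2) * ((x - y) * (y / (δ + x)))) := by ring
      _ ≤ Q * ((δ + x) ^ (q - 2) * ((x - y) * 1)) := by
          gcongr; exact (div_le_one hDx).2 (by linarith)
      _ = _ := by ring
  · have h1 : (δ + x) ^ (q - 2) ≤ (δ + y) ^ (q - 2) :=
      Real.rpow_le_rpow_of_nonpos hDy (by linarith) (by linarith)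
    rw [abs_of_nonpos (by linarith), neg_sub]
    have h2 := one_sub_rpow_le ht0 ht1 (γ := 2 - q) (Γ := 1) (by linarith) le_rfl
    rw [h1t, one_mul] at h2
    have h3 : (δ + x) ^ (q - 2) = (δ + y) ^ (q - 2) * ((δ + y) / (δ + x)) ^ (2 - q) := by
      rw [Real.div_rpow hDy.le hDx.le, ← neg_sub q 2, Real.rpow_neg hDx.le, Real.rpow_neg hDy.le]
      have : (δ + y) ^ (q - 2) ≠ 0 := by positivity
      field_simp
    have h4 : (δ + y) ^ (q - 2) * (y / (δ + x)) ≤ (δ + x) ^ (q - 2) := by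
      rw [h3]
      gcongr
      calc y / (δ + x) ≤ (δ + y) / (δ + x) := by gcongr; linarith
        _ ≤ _ := by
          simpa using Real.rpow_le_rpow_of_exponent_ge ht0 ht1 (show 2 - q ≤ 1 by linarith)
    calc ((δ + y) ^ (q - 2) - (δ + x) ^ (q - 2)) * y
        = (δ + y) ^ (q - 2) * (1 - ((δ + y) / (δ + x)) ^ (2 - q)) * y := by rw [h3]; ring
      _ ≤ (δ + y) ^ (q - 2) * ((x - y) / (δ + x)) * y := by gcongr
      _ = ((δ + y) ^ (q - 2) * (y / (δ + x))) * (x - y) := by ring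
      _ ≤ (δ + x) ^ (q - 2) * (x - y) := by gcongr
      _ ≤ _ := by
        have : 0 ≤ (δ + x) ^ (q - 2) * (x - y) := by positivity
        nlinarith

variable {d : ℕ}

/-- Adding the smaller norm at most doubles the base, so the weight at the larger norm can be
replaced by the symmetric one. -/
theorem max_rpow_comparable {δ q Q x y : ℝ} (hq : 1 < q) (hQ : q ≤ Q) (hδ : 0 ≤ δ) (hy : 0 ≤ y)
    (hyx : y ≤ x) : (δ + x) ^ (q - 2) ≤ 2 ^ Q * (δ + x + y) ^ (q - 2) ∧
      (δ + x + y) ^ (q - 2) ≤ 2 ^ Q * (δ + x) ^ (q - 2) := by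
  have hx := hy.trans hyx
  rcases eq_or_lt_of_le hx with h0 | h0
  · have hy' : y = 0 := by linarith
    have : (0:ℝ) ≤ (δ + x) ^ (q - 2) := by positivity
    have h2 : (1:ℝ) ≤ 2 ^ Q := Real.one_le_rpow (by norm_num) (by linarith)
    rw [hy', add_zero]
    constructor <;> nlinarith
  · have hq2 : |q - 2| ≤ Q := abs_le.2 ⟨by linarith, by linarith⟩
    exact ⟨rpow_le_of_le_two_mul (by linarith) (by linarith) (by linarith) (by linarith) hq2,
      rpow_le_of_le_two_mul (by linarith) (by linarith) (by linarith) (by linarith) hq2⟩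

theorem norm_opA_sub_le {δ q Q : ℝ} (hq : 1 < q) (hQ : q ≤ Q) (hδ : 0 ≤ δ) (a b : Rd d) :
    ‖opA δ q a - opA δ q b‖ ≤ (1 + Q) * 2 ^ Q * ((δ + ‖a‖ + ‖b‖) ^ (q - 2) * ‖a - b‖) := by
  wlog hab : ‖b‖ ≤ ‖a‖ generalizing a b
  · have := this b a (le_of_not_ge hab)
    rwa [norm_sub_rev, norm_sub_rev b, add_right_comm] at this
  have h1 := abs_rpow_sub_mul_le hq hQ hδ (norm_nonneg b) hab
  have h2 : ‖a‖ - ‖b‖ ≤ ‖a - b‖ := norm_sub_norm_le a b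
  have h3 := (max_rpow_comparable hq hQ hδ (norm_nonneg b) hab).1
  have hQ0 : 0 < Q := by linarith
  have hsplit : opA δ q a - opA δ q b = (δ + ‖a‖) ^ (q - 2) • (a - b) +
      ((δ + ‖a‖) ^ (q - 2) - (δ + ‖b‖) ^ (q - 2)) • b := by
    unfold opA; module
  rw [hsplit]
  calc _ ≤ (δ + ‖a‖) ^ (q - 2) * ‖a - b‖ +
        |(δ + ‖a‖) ^ (q - 2) - (δ + ‖b‖) ^ (q - 2)| * ‖b‖ := by
        refine (norm_add_le _ _).trans (le_of_eq ?_)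
        rw [norm_smul, norm_smul, Real.norm_eq_abs, Real.norm_eq_abs,
          abs_of_nonneg (by positivity : 0 ≤ (δ + ‖a‖) ^ (q - 2))]
    _ ≤ (δ + ‖a‖) ^ (q - 2) * ‖a - b‖ + Q * ((δ + ‖a‖) ^ (q - 2) * ‖a - b‖) := by
        gcongr (_ + ?_)
        exact h1.trans (by gcongr)
    _ = (1 + Q) * ((δ + ‖a‖) ^ (q - 2) * ‖a - b‖) := by ring
    _ ≤ (1 + Q) * (2 ^ Q * (δ + ‖a‖ + ‖b‖) ^ (q - 2) * ‖a - b‖) := by gcongr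
    _ = _ := by ring

/-- Both the inner product and ‖a-b‖² split into a radial part in ‖a‖-‖b‖ and a multiple of the
nonnegative angular defect ‖a‖‖b‖-⟨a,b⟩. The radial parts are compared by the scalar inequality, the
angular ones by their coefficients. -/
theorem inner_opA_sub_ge {δ q Q : ℝ} (hq : 1 < q) (hQ : q ≤ Q) (hδ : 0 ≤ δ) (a b : Rd d) :
    min 1 (q - 1) * ((δ + ‖a‖ + ‖b‖) ^ (q - 2) * ‖a - b‖ ^ 2) ≤
      2 * 2 ^ Q * inner ℝ (opA δ q a - opA δ q b) (a - b) := by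
  wlog hab : ‖b‖ ≤ ‖a‖ generalizing a b
  · have := this b a (le_of_not_ge hab)
    rwa [norm_sub_rev, add_right_comm, ← neg_sub (opA δ q a), ← neg_sub a b, inner_neg_neg] at this
  have h1 := shiftDeriv_sub_ge hq hδ (norm_nonneg b) hab
  have h3 := (max_rpow_comparable hq hQ hδ (norm_nonneg b) hab).2
  set c := min 1 (q - 1) with hc
  have hc0 : 0 < c := lt_min one_pos (by linarith)
  have hc1 : c ≤ 1 := min_le_left _ _
  set μ := (δ + ‖a‖) ^ (q - 2) with hμ
  set μ' := (δ + ‖b‖) ^ (q - 2) with hμ'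
  have hμ0 : 0 ≤ μ := by positivity
  have hμ0' : 0 ≤ μ' := by positivity
  have hcs : inner ℝ a b ≤ ‖a‖ * ‖b‖ := real_inner_le_norm a b
  have hinner : inner ℝ (opA δ q a - opA δ q b) (a - b) =
      (shiftDeriv δ q ‖a‖ - shiftDeriv δ q ‖b‖) * (‖a‖ - ‖b‖) +
        (μ + μ') * (‖a‖ * ‖b‖ - inner ℝ a b) := by
    simp only [opA, shiftDeriv, inner_sub_left, inner_sub_right, real_inner_smul_left,
      real_inner_self_eq_norm_sq, ← hμ, ← hμ', real_inner_comm a b]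
    ring
  have hnorm : ‖a - b‖ ^ 2 = (‖a‖ - ‖b‖) ^ 2 + 2 * (‖a‖ * ‖b‖ - inner ℝ a b) := by
    rw [norm_sub_sq_real]; ring
  have h4 : c * (μ * ‖a - b‖ ^ 2) ≤ 2 * inner ℝ (opA δ q a - opA δ q b) (a - b) := by
    rw [hinner, hnorm]
    have e1 : c * (μ * (‖a‖ - ‖b‖)) * (‖a‖ - ‖b‖) ≤
        (shiftDeriv δ q ‖a‖ - shiftDeriv δ q ‖b‖) * (‖a‖ - ‖b‖) := by
      exact mul_le_mul_of_nonneg_right h1 (by linarith)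
    have e2 : c * μ * (‖a‖ * ‖b‖ - inner ℝ a b) ≤ (μ + μ') * (‖a‖ * ‖b‖ - inner ℝ a b) := by
      have : c * μ ≤ μ + μ' := by nlinarith
      exact mul_le_mul_of_nonneg_right this (by linarith)
    have e3 : 0 ≤ c * (μ * (‖a‖ - ‖b‖)) * (‖a‖ - ‖b‖) := by
      have : 0 ≤ ‖a‖ - ‖b‖ := by linarith
      positivity
    nlinarith
  calc _ ≤ c * (2 ^ Q * μ * ‖a - b‖ ^ 2) := by gcongr
    _ = 2 ^ Q * (c * (μ * ‖a - b‖ ^ 2)) := by ring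
    _ ≤ 2 ^ Q * (2 * inner ℝ (opA δ q a - opA δ q b) (a - b)) := by gcongr
    _ = _ := by ring

/-- Every estimate for A transfers to F. Since (q+2)/2 > 3/2 when q > 1, the monotonicity constant
of F does not degenerate as q tends to 1. -/
theorem opF_eq_opA (δ q : ℝ) (a : Rd d) : opF δ q a = opA δ ((q + 2) / 2) a := by
  unfold opF opA; congr 2; ring

theorem rpow_half_sq {M e : ℝ} (hM : 0 ≤ M) : (M ^ (e / 2)) ^ 2 = M ^ e := by
  rw [← Real.rpow_natCast, ← Real.rpow_mul hM]; norm_num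

theorem norm_opF_sub_sq_le {δ q Q : ℝ} (hq : 1 < q) (hQ : q ≤ Q) (hδ : 0 ≤ δ) (a b : Rd d) :
    ‖opF δ q a - opF δ q b‖ ^ 2 ≤
      ((3 + Q) * 2 ^ (2 + Q)) ^ 2 * ((δ + ‖a‖ + ‖b‖) ^ (q - 2) * ‖a - b‖ ^ 2) := by
  have h := norm_opA_sub_le (q := (q + 2) / 2) (Q := 2 + Q) (by linarith) (by linarith) hδ a b
  rw [← opF_eq_opA, ← opF_eq_opA, show (q + 2) / 2 - 2 = (q - 2) / 2 by ring] at h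
  calc _ ≤ ((1 + (2 + Q)) * 2 ^ (2 + Q) * ((δ + ‖a‖ + ‖b‖) ^ ((q - 2) / 2) * ‖a - b‖)) ^ 2 := by
        gcongr
    _ = ((3 + Q) * 2 ^ (2 + Q)) ^ 2 * (((δ + ‖a‖ + ‖b‖) ^ ((q - 2) / 2)) ^ 2 * ‖a - b‖ ^ 2) := by
        ring
    _ = _ := by rw [rpow_half_sq (by positivity)]

theorem norm_opF_sub_sq_ge {δ q Q : ℝ} (hq : 1 < q) (hQ : q ≤ Q) (hδ : 0 ≤ δ) (a b : Rd d) :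
    (δ + ‖a‖ + ‖b‖) ^ (q - 2) * ‖a - b‖ ^ 2 ≤
      (4 * 2 ^ (2 + Q)) ^ 2 * ‖opF δ q a - opF δ q b‖ ^ 2 := by
  have h := inner_opA_sub_ge (q := (q + 2) / 2) (Q := 2 + Q) (by linarith) (by linarith) hδ a b
  rw [← opF_eq_opA, ← opF_eq_opA, show (q + 2) / 2 - 2 = (q - 2) / 2 by ring] at h
  have hm : (1:ℝ) / 2 ≤ min 1 ((q + 2) / 2 - 1) := le_min (by norm_num) (by linarith)
  have h1 : (δ + ‖a‖ + ‖b‖) ^ ((q - 2) / 2) * ‖a - b‖ ≤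
      4 * 2 ^ (2 + Q) * ‖opF δ q a - opF δ q b‖ := by
    rcases eq_or_lt_of_le (norm_nonneg (a - b)) with h0 | h0
    · rw [← h0, mul_zero]; positivity
    refine le_of_mul_le_mul_right ?_ h0
    have h2 := real_inner_le_norm (opF δ q a - opF δ q b) (a - b)
    calc _ = 2 * (1 / 2 * ((δ + ‖a‖ + ‖b‖) ^ ((q - 2) / 2) * ‖a - b‖ ^ 2)) := by ring
      _ ≤ 2 * (min 1 ((q + 2) / 2 - 1) * ((δ + ‖a‖ + ‖b‖) ^ ((q - 2) / 2) * ‖a - b‖ ^ 2)) := by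
          gcongr
      _ ≤ 2 * (2 * 2 ^ (2 + Q) * inner ℝ (opF δ q a - opF δ q b) (a - b)) := by gcongr
      _ ≤ 2 * (2 * 2 ^ (2 + Q) * (‖opF δ q a - opF δ q b‖ * ‖a - b‖)) := by gcongr
      _ = _ := by ring
  calc _ = ((δ + ‖a‖ + ‖b‖) ^ ((q - 2) / 2) * ‖a - b‖) ^ 2 := by
        rw [mul_pow, rpow_half_sq (by positivity)]
    _ ≤ (4 * 2 ^ (2 + Q) * ‖opF δ q a - opF δ q b‖) ^ 2 := by gcongr
    _ = _ := by ring

/-- Change of shift for `shiftPow`. -/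
theorem shiftPow_change {δ q Q r : ℝ} (hq : 1 < q) (hQ : q ≤ Q) (hδ : 0 ≤ δ) (hr : 0 ≤ r)
    (a b : Rd d) : shiftPow (δ + ‖b‖) q r ≤
      2 ^ Q * (shiftPow (δ + ‖a‖) q r + (δ + ‖a‖ + ‖b‖) ^ (q - 2) * ‖a - b‖ ^ 2) := by
  have hq2 : |q - 2| ≤ Q := abs_le.2 ⟨by linarith, by linarith⟩
  have hab : ‖a‖ ≤ ‖b‖ + ‖a - b‖ := by
    simpa using norm_add_le b (a - b)
  have hba : ‖b‖ ≤ ‖a‖ + ‖a - b‖ := by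
    simpa [norm_sub_rev] using norm_add_le a (b - a)
  have hn := norm_nonneg (a - b)
  have hna := norm_nonneg a
  have hnb := norm_nonneg b
  have hpos : 0 ≤ (δ + ‖a‖ + ‖b‖) ^ (q - 2) * ‖a - b‖ ^ 2 := by positivity
  have hpos' := shiftPow_nonneg q (by positivity : 0 ≤ δ + ‖a‖) hr
  -- Above the distance of a and b the two shifted arguments are comparable; below it, monotonicity
  -- allows r to be raised to ‖a-b‖, which produces the natural distance.
  rcases le_total ‖a - b‖ r with h | h
  · rcases eq_or_lt_of_le hr with h0 | h0
    · have : shiftPow (δ + ‖b‖) q r = 0 := by simp [shiftPow, ← h0]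
      rw [this]; positivity
    · have h1 : (δ + ‖b‖ + r) ^ (q - 2) ≤ 2 ^ Q * (δ + ‖a‖ + r) ^ (q - 2) :=
        rpow_le_of_le_two_mul (by positivity) (by positivity) (by linarith) (by linarith) hq2
      calc shiftPow (δ + ‖b‖) q r ≤ 2 ^ Q * (δ + ‖a‖ + r) ^ (q - 2) * r ^ 2 := by
            unfold shiftPow; gcongr
        _ = 2 ^ Q * shiftPow (δ + ‖a‖) q r := by unfold shiftPow; ring
        _ ≤ _ := by gcongr; linarith
  · rcases eq_or_lt_of_le hn with h0 | h0
    · have : shiftPow (δ + ‖b‖) q r = 0 := by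
        have : r = 0 := by linarith
        simp [shiftPow, this]
      rw [this]; positivity
    · have h1 : (δ + ‖b‖ + ‖a - b‖) ^ (q - 2) ≤ 2 ^ Q * (δ + ‖a‖ + ‖b‖) ^ (q - 2) := by
        have := norm_sub_le a b
        exact rpow_le_of_le_two_mul (by positivity) (by linarith) (by linarith) (by linarith) hq2
      calc shiftPow (δ + ‖b‖) q r ≤ shiftPow (δ + ‖b‖) q ‖a - b‖ :=
            shiftPow_mono hq.le (by positivity) hr h
        _ ≤ 2 ^ Q * (δ + ‖a‖ + ‖b‖) ^ (q - 2) * ‖a - b‖ ^ 2 := by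
            unfold shiftPow; gcongr
        _ = 2 ^ Q * ((δ + ‖a‖ + ‖b‖) ^ (q - 2) * ‖a - b‖ ^ 2) := by ring
        _ ≤ _ := by gcongr; linarith

/-- Young's inequality for the flux increment. -/
theorem flux_mul_le {δ q Q r : ℝ} (hq : 1 < q) (hQ : q ≤ Q) (hδ : 0 ≤ δ) (hr : 0 ≤ r)
    (a b : Rd d) : (δ + ‖a‖ + ‖b‖) ^ (q - 2) * ‖a - b‖ * r ≤
      2 ^ Q * (shiftPow (δ + ‖a‖) q r + (δ + ‖a‖ + ‖b‖) ^ (q - 2) * ‖a - b‖ ^ 2) := by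
  have hq2 : |q - 2| ≤ Q := abs_le.2 ⟨by linarith, by linarith⟩
  have h1Q : (1:ℝ) ≤ 2 ^ Q := Real.one_le_rpow (by norm_num) (by linarith)
  have hn := norm_nonneg (a - b)
  have hpos : 0 ≤ (δ + ‖a‖ + ‖b‖) ^ (q - 2) * ‖a - b‖ ^ 2 := by positivity
  have hpos' := shiftPow_nonneg q (by positivity : 0 ≤ δ + ‖a‖) hr
  rcases le_total r ‖a - b‖ with h | h
  · calc _ ≤ (δ + ‖a‖ + ‖b‖) ^ (q - 2) * ‖a - b‖ * ‖a - b‖ := by gcongr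
      _ = 1 * ((δ + ‖a‖ + ‖b‖) ^ (q - 2) * ‖a - b‖ ^ 2) := by ring
      _ ≤ _ := by gcongr; linarith
  · rcases eq_or_lt_of_le hn with h0 | h0
    · rw [← h0]; simp; positivity
    have hab : ‖a‖ ≤ ‖b‖ + ‖a - b‖ := by
      simpa using norm_add_le b (a - b)
    have hba : ‖b‖ ≤ ‖a‖ + ‖a - b‖ := by
      simpa [norm_sub_rev] using norm_add_le a (b - a)
    have hna := norm_nonneg a
    have hnb := norm_nonneg b
    have hs := norm_sub_le a b
    have h1 : (δ + ‖a‖ + ‖b‖) ^ (q - 2) ≤ 2 ^ Q * (δ + ‖a‖ + ‖a - b‖) ^ (q - 2) :=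
      rpow_le_of_le_two_mul (by linarith) (by linarith) (by linarith) (by linarith) hq2
    have h2 := shiftDeriv_mono hq.le (by positivity : 0 ≤ δ + ‖a‖) hn h
    calc _ ≤ 2 ^ Q * (δ + ‖a‖ + ‖a - b‖) ^ (q - 2) * ‖a - b‖ * r := by gcongr
      _ = 2 ^ Q * (shiftDeriv (δ + ‖a‖) q ‖a - b‖ * r) := by unfold shiftDeriv; ring
      _ ≤ 2 ^ Q * (shiftDeriv (δ + ‖a‖) q r * r) := by gcongr
      _ = 2 ^ Q * shiftPow (δ + ‖a‖) q r := by rw [shiftPow_eq]; ring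
      _ ≤ _ := by gcongr; linarith

end

/-! ### Changing the exponent. -/

noncomputable section

/-- `σ` is a bound for the local oscillation of the exponent that is small enough, in terms of
`p⁻ = pm`, for an improvement of the integrability by the factor `z²`. -/
structure IsSmallOscillation (pm σ z : ℝ) : Prop where
  one_lt_pm : 1 < pm
  nonneg : 0 ≤ σ
  one_lt : 1 < z
  le : (1 + 4 * σ) * (1 + 4 * σ / (pm - 1)) ≤ z

namespace IsSmallOscillation

variable {pm σ z : ℝ}

theorem one_add_le (h : IsSmallOscillation pm σ z) : 1 + 4 * σ ≤ z := by
  have h1 : 0 ≤ 4 * σ / (pm - 1) :=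
    div_nonneg (by linarith [h.nonneg]) (by linarith [h.one_lt_pm])
  nlinarith [h.le, h.nonneg]

theorem le_mul (h : IsSmallOscillation pm σ z) {P q : ℝ} (hP : pm ≤ P)
    (hPq : |P - q| ≤ 2 * σ) : q ≤ P * z := by
  have h1 := h.one_add_le
  have h2 := abs_le.1 hPq
  nlinarith [h.nonneg, h.one_lt_pm]

theorem div_le (h : IsSmallOscillation pm σ z) {P q : ℝ} (hq : pm ≤ q)
    (hPq : |P - q| ≤ 2 * σ) : (P - 1) / (q - 1) ≤ 1 + 2 * σ / (pm - 1) := by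
  have h0 := h.one_lt_pm
  have h2 := abs_le.1 hPq
  have hs := h.nonneg
  have h3 : 2 * σ / (q - 1) ≤ 2 * σ / (pm - 1) :=
    div_le_div_of_nonneg_left (by positivity) (by linarith) (by linarith)
  calc (P - 1) / (q - 1) ≤ ((q - 1) + 2 * σ) / (q - 1) := by
        gcongr
        · linarith
        · linarith
    _ = 1 + 2 * σ / (q - 1) := by
        have : q - 1 ≠ 0 := by linarith
        field_simp
    _ ≤ _ := by linarith

/-- (P-1)q' is the exponent that arises when the flux power D^{P-1} is raised to q' = q/(q-1) in
Young's inequality. The condition on σ is made so that it stays below Pz. -/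
theorem conj_le_mul (h : IsSmallOscillation pm σ z) {P q : ℝ} (hP : pm ≤ P) (hq : pm ≤ q)
    (hPq : |P - q| ≤ 2 * σ) : (P - 1) * (q / (q - 1)) ≤ P * z := by
  have h0 := h.one_lt_pm
  have h1 := h.div_le hq hPq
  have h2 := abs_le.1 hPq
  have hs := h.nonneg
  have hq1 : 0 < q - 1 := by linarith
  have hpm : 0 < pm - 1 := by linarith
  have h3 : 2 * σ / (pm - 1) ≤ 4 * σ / (pm - 1) := by gcongr; linarith
  have h4 : 0 ≤ 2 * σ / (pm - 1) := by positivity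
  calc (P - 1) * (q / (q - 1)) = q * ((P - 1) / (q - 1)) := by ring
    _ ≤ (P * (1 + 4 * σ)) * (1 + 4 * σ / (pm - 1)) := by
        have : q ≤ P * (1 + 4 * σ) := by nlinarith
        refine mul_le_mul this (by linarith) (div_nonneg (by linarith) hq1.le) ?_
        exact mul_nonneg (by linarith) (by linarith)
    _ = P * ((1 + 4 * σ) * (1 + 4 * σ / (pm - 1))) := by ring
    _ ≤ P * z := mul_le_mul_of_nonneg_left h.le (by linarith)

end IsSmallOscillation

theorem log_sq_le_of_one_le {D γ : ℝ} (hD : 1 ≤ D) (hγ : 0 < γ) :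
    Real.log D ^ 2 ≤ 4 / γ ^ 2 * D ^ γ := by
  have h1 := Real.log_le_rpow_div (x := D) (by linarith) (half_pos hγ)
  have h2 := Real.log_nonneg hD
  calc Real.log D ^ 2 ≤ (D ^ (γ / 2) / (γ / 2)) ^ 2 := by gcongr
    _ = 4 / γ ^ 2 * (D ^ (γ / 2)) ^ 2 := by field_simp; ring
    _ = _ := by rw [rpow_half_sq (by linarith)]

theorem log_sq_le_of_le_one {D γ : ℝ} (hD0 : 0 < D) (hD : D ≤ 1) (hγ : 0 < γ) :
    Real.log D ^ 2 ≤ 4 / γ ^ 2 * D ^ (-γ) := by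
  have := log_sq_le_of_one_le (D := D⁻¹) ((one_le_inv₀ hD0).2 hD) hγ
  rwa [Real.log_inv, neg_sq, Real.inv_rpow hD0.le, ← Real.rpow_neg hD0.le] at this

/-- For D ≥ 1 the gap between Pz and Pz² is at least z-1 and absorbs the logarithm; for D ≤ 1 the
lower bound γ of the exponent absorbs it. -/
theorem exists_log_sq_mul_rpow_le (γ z : ℝ) (hγ : 0 < γ) (hz : 1 < z) :
    ∃ C, 0 < C ∧ ∀ D P x : ℝ, 0 < D → 1 ≤ P → γ ≤ x → x ≤ P * z →
      Real.log D ^ 2 * D ^ x ≤ C * (1 + D ^ (P * z ^ 2)) := by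
  have hz1 : 0 < z - 1 := by linarith
  refine ⟨4 / γ ^ 2 + 4 / (z - 1) ^ 2, by positivity, fun D P x hD hP hx hxP => ?_⟩
  have hA : 0 ≤ 4 / γ ^ 2 := by positivity
  have hB : 0 ≤ 4 / (z - 1) ^ 2 := by positivity
  have hE : 0 ≤ D ^ (P * z ^ 2) := by positivity
  rcases le_total 1 D with h | h
  · have h2 : D ^ (z - 1 + x) ≤ D ^ (P * z ^ 2) :=
      Real.rpow_le_rpow_of_exponent_le h (by nlinarith [mul_nonneg (sub_nonneg.2 hP) hz1.le])
    calc Real.log D ^ 2 * D ^ x ≤ 4 / (z - 1) ^ 2 * D ^ (z - 1) * D ^ x := by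
          gcongr; exact log_sq_le_of_one_le h hz1
      _ = 4 / (z - 1) ^ 2 * D ^ (z - 1 + x) := by rw [Real.rpow_add hD]; ring
      _ ≤ 4 / (z - 1) ^ 2 * D ^ (P * z ^ 2) := by gcongr
      _ ≤ _ := by nlinarith
  · have h2 : D ^ (-γ + x) ≤ 1 := Real.rpow_le_one hD.le h (by linarith)
    calc Real.log D ^ 2 * D ^ x ≤ 4 / γ ^ 2 * D ^ (-γ) * D ^ x := by
          gcongr; exact log_sq_le_of_le_one hD h hγ
      _ = 4 / γ ^ 2 * D ^ (-γ + x) := by rw [Real.rpow_add hD]; ring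
      _ ≤ 4 / γ ^ 2 * 1 := by gcongr
      _ ≤ _ := by nlinarith

theorem add_rpow_le_mul {δ b y Y : ℝ} (hδ : 0 ≤ δ) (hb : 0 ≤ b) (hy : 0 ≤ y) (hyY : y ≤ Y) :
    (δ + b) ^ y ≤ (1 + δ) ^ Y * (1 + b ^ y) := by
  have h1 : (1 + δ) ^ y ≤ (1 + δ) ^ Y :=
    Real.rpow_le_rpow_of_exponent_le (by linarith) hyY
  have hby : 0 ≤ b ^ y := by positivity
  rcases le_total b 1 with h | h
  · calc (δ + b) ^ y ≤ (1 + δ) ^ y * 1 := by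
          rw [mul_one]; exact Real.rpow_le_rpow (by positivity) (by linarith) hy
      _ ≤ _ := by gcongr; linarith
  · calc (δ + b) ^ y ≤ ((1 + δ) * b) ^ y :=
          Real.rpow_le_rpow (by positivity) (by nlinarith) hy
      _ = (1 + δ) ^ y * b ^ y := Real.mul_rpow (by positivity) hb
      _ ≤ _ := by gcongr; linarith

/-- Mean value inequality for the exponential, with the sum of both end values in place of their
maximum. -/
theorem abs_rpow_sub_rpow_le {D : ℝ} (hD : 0 < D) (x y : ℝ) :
    |D ^ x - D ^ y| ≤ |x - y| * |Real.log D| * (D ^ x + D ^ y) := by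
  rw [Real.rpow_def_of_pos hD, Real.rpow_def_of_pos hD, ← abs_mul]
  have key : ∀ u v : ℝ, v ≤ u →
      |Real.exp u - Real.exp v| ≤ |u - v| * (Real.exp u + Real.exp v) := by
    intro u v huv
    rw [abs_of_nonneg (sub_nonneg.2 (Real.exp_le_exp.2 huv)), abs_of_nonneg (sub_nonneg.2 huv)]
    have h1 := Real.add_one_le_exp (v - u)
    have h2 : Real.exp v = Real.exp u * Real.exp (v - u) := by rw [← Real.exp_add]; ring_nf
    have h3 := Real.exp_pos u
    have h4 : 0 ≤ (u - v) * Real.exp v := mul_nonneg (by linarith) (Real.exp_pos v).le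
    nlinarith
  rw [show (x - y) * Real.log D = Real.log D * x - Real.log D * y by ring]
  rcases le_total (Real.log D * y) (Real.log D * x) with h | h
  · exact key _ _ h
  · have := key _ _ h
    rwa [abs_sub_comm, abs_sub_comm (_ * y), add_comm (Real.exp (_ * y))] at this

variable {d : ℕ}

theorem norm_opA_sub_exponent_le {δ P q : ℝ} (hδ : 0 ≤ δ) (b : Rd d) :
    ‖opA δ P b - opA δ q b‖ ≤ |(δ + ‖b‖) ^ (P - 1) - (δ + ‖b‖) ^ (q - 1)| := by
  rcases eq_or_lt_of_le (norm_nonneg b) with h0 | h0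
  · have hb : b = 0 := norm_eq_zero.1 h0.symm
    simp [opA, hb]
  have hD : 0 < δ + ‖b‖ := by linarith
  rw [opA, opA, ← sub_smul, norm_smul, Real.norm_eq_abs]
  calc |(δ + ‖b‖) ^ (P - 2) - (δ + ‖b‖) ^ (q - 2)| * ‖b‖
      ≤ |(δ + ‖b‖) ^ (P - 2) - (δ + ‖b‖) ^ (q - 2)| * (δ + ‖b‖) := by gcongr; linarith
    _ = |((δ + ‖b‖) ^ (P - 2) - (δ + ‖b‖) ^ (q - 2)) * (δ + ‖b‖)| := by
        rw [abs_mul, abs_of_pos hD]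
    _ = _ := by
        rw [sub_mul, ← Real.rpow_add_one hD.ne', ← Real.rpow_add_one hD.ne']
        ring_nf

/-- F behaves like a power with exponent q/2, so the squared mean value bound in the exponent gives
(P-q)² log² D (D^P + D^q), and the integrability gain absorbs the squared logarithm. -/
theorem exists_opF_exponent_le (pm pp δ σ z : ℝ) (hδ : 0 ≤ δ)
    (hσ : IsSmallOscillation pm σ z) :
    ∃ C, 0 < C ∧ ∀ (P q : ℝ) (b : Rd d), pm ≤ P → P ≤ pp → pm ≤ q → |P - q| ≤ 2 * σ →
      ‖opF δ P b - opF δ q b‖ ^ 2 ≤ C * ((P - q) ^ 2 * (1 + ‖b‖ ^ (P * z ^ 2))) := by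
  obtain ⟨C₁, hC₁, h1⟩ := exists_log_sq_mul_rpow_le 1 z one_pos hσ.one_lt
  refine ⟨C₁ * (2 * (1 + δ) ^ (pp * z ^ 2)), by positivity, fun P q b hP hPp hq hPq => ?_⟩
  have hpm := hσ.one_lt_pm
  have hz := hσ.one_lt
  set D := δ + ‖b‖ with hDdef
  have hR : 0 ≤ C₁ * (2 * (1 + δ) ^ (pp * z ^ 2)) * ((P - q) ^ 2 * (1 + ‖b‖ ^ (P * z ^ 2))) := by
    positivity
  rcases eq_or_lt_of_le (norm_nonneg b) with h0 | h0
  · have hb : b = 0 := norm_eq_zero.1 h0.symm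
    have : opF δ P b - opF δ q b = 0 := by simp [opF, hb]
    rw [this, norm_zero, zero_pow two_ne_zero]; exact hR
  have hD : 0 < D := by positivity
  have h2 : ‖opF δ P b - opF δ q b‖ ≤ |D ^ (P / 2) - D ^ (q / 2)| := by
    rw [opF_eq_opA, opF_eq_opA]
    refine (norm_opA_sub_exponent_le hδ b).trans (le_of_eq ?_)
    rw [← hDdef]; ring_nf
  have h3 := abs_rpow_sub_rpow_le hD (P / 2) (q / 2)
  have hlogP := h1 D P P hD (by linarith) (by linarith) (by nlinarith)
  have hlogq := h1 D P q hD (by linarith) (by linarith) (hσ.le_mul hP hPq)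
  have hDb : D ^ (P * z ^ 2) ≤ (1 + δ) ^ (pp * z ^ 2) * (1 + ‖b‖ ^ (P * z ^ 2)) :=
    add_rpow_le_mul hδ h0.le (mul_nonneg (by linarith) (sq_nonneg z)) (by gcongr)
  have h1le : (1:ℝ) ≤ (1 + δ) ^ (pp * z ^ 2) * (1 + ‖b‖ ^ (P * z ^ 2)) := by
    have e1 : (1:ℝ) ≤ (1 + δ) ^ (pp * z ^ 2) :=
      Real.one_le_rpow (by linarith) (mul_nonneg (by linarith) (sq_nonneg z))
    have e2 : 0 ≤ ‖b‖ ^ (P * z ^ 2) := by positivity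
    nlinarith
  calc ‖opF δ P b - opF δ q b‖ ^ 2
      ≤ (|P / 2 - q / 2| * |Real.log D| * (D ^ (P / 2) + D ^ (q / 2))) ^ 2 := by
        gcongr; exact h2.trans h3
    _ = (P - q) ^ 2 / 4 * (Real.log D ^ 2 * (D ^ (P / 2) + D ^ (q / 2)) ^ 2) := by
        rw [mul_pow, mul_pow, sq_abs, sq_abs]; ring
    _ ≤ (P - q) ^ 2 / 4 * (Real.log D ^ 2 * (2 * ((D ^ (P / 2)) ^ 2 + (D ^ (q / 2)) ^ 2))) := by
        gcongr; exact add_sq_le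
    _ = (P - q) ^ 2 / 2 * (Real.log D ^ 2 * D ^ P + Real.log D ^ 2 * D ^ q) := by
        rw [rpow_half_sq hD.le, rpow_half_sq hD.le]; ring
    _ ≤ (P - q) ^ 2 / 2 * (C₁ * (1 + D ^ (P * z ^ 2)) + C₁ * (1 + D ^ (P * z ^ 2))) := by
        gcongr
    _ = C₁ * ((P - q) ^ 2 * (1 + D ^ (P * z ^ 2))) := by ring
    _ ≤ C₁ * ((P - q) ^ 2 * (2 * ((1 + δ) ^ (pp * z ^ 2) * (1 + ‖b‖ ^ (P * z ^ 2))))) := by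
        gcongr; linarith
    _ = _ := by ring

set_option maxHeartbeats 1000000 in
/-- Young's inequality for a change of the exponent, in terms of `D = δ + |b|`. -/
theorem exists_exponent_young (pm pp σ z : ℝ) (hσ : IsSmallOscillation pm σ z) :
    ∃ C, 0 < C ∧ ∀ P q D r : ℝ, pm ≤ P → pm ≤ q → q ≤ pp → |P - q| ≤ 2 * σ → 0 < D →
      0 ≤ r → |D ^ (P - 1) - D ^ (q - 1)| * r ≤
        C * (shiftPow D q r + (P - q) ^ 2 * (1 + D ^ (P * z ^ 2))) := by
  have hpm := hσ.one_lt_pm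
  have hz := hσ.one_lt
  obtain ⟨C₁, hC₁, h1⟩ := exists_log_sq_mul_rpow_le (pm - 1) z (by linarith) hσ.one_lt
  -- Dominates the factors (2K)^{1/(q-1)} that occur below, uniformly for q ≥ pm.
  set B : ℝ := (2 * 2 ^ |pp|) ^ (1 / (pm - 1)) with hB
  have hB0 : 0 < B := by positivity
  refine ⟨4 * 2 ^ |pp| + 8 * C₁ + 2 * B * C₁, by positivity,
    fun P q D r hP hq hqp hPq hD hr => ?_⟩
  have hq2 : |q - 2| ≤ |pp| := by
    rw [abs_of_nonneg (by linarith : 0 ≤ pp)]; exact abs_le.2 ⟨by linarith, by linarith⟩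
  have hK1 : (1:ℝ) ≤ 2 ^ |pp| := Real.one_le_rpow (by norm_num) (abs_nonneg _)
  set K : ℝ := 2 ^ |pp| with hK
  set α := |D ^ (P - 1) - D ^ (q - 1)| with hα
  set ω := P - q with hω
  set Z := 1 + D ^ (P * z ^ 2) with hZ
  have hZ0 : 0 ≤ Z := by positivity
  have hS := shiftPow_nonneg q hD.le hr
  have hα0 : 0 ≤ α := abs_nonneg _
  have hW : 0 ≤ ω ^ 2 * Z := by positivity
  set S := shiftPow D q r with hSdef
  set W := ω ^ 2 * Z with hWdef
  have hBC : 0 ≤ B * C₁ := by positivity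
  have hfinal : ∀ u v : ℝ, u ≤ 4 * K → v ≤ 8 * C₁ + 2 * B * C₁ →
      u * S + v * W ≤ (4 * K + 8 * C₁ + 2 * B * C₁) * (S + W) := by
    intro u v hu hv
    rw [mul_add]
    exact add_le_add (mul_le_mul_of_nonneg_right (by linarith) hS)
      (mul_le_mul_of_nonneg_right (by linarith) hW)
  have hαle : α ≤ D ^ (P - 1) + D ^ (q - 1) := by
    rw [hα]; refine (abs_sub _ _).trans (le_of_eq ?_)
    rw [abs_of_nonneg (by positivity), abs_of_nonneg (by positivity)]
  have hDP : D ^ (P - 1) * D = D ^ P := by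
    rw [← Real.rpow_add_one hD.ne']; ring_nf
  have hDq : D ^ (q - 1) * D = D ^ q := by
    rw [← Real.rpow_add_one hD.ne']; ring_nf
  have hDq2 : D ^ (q - 2) * D = D ^ (q - 1) := by
    rw [← Real.rpow_add_one hD.ne']; ring_nf
  have hlogP := h1 D P P hD (by linarith) (by linarith) (by nlinarith)
  have hlogq := h1 D P q hD (by linarith) (by linarith) (hσ.le_mul hP hPq)
  have hαabs : α ≤ |ω| * |Real.log D| * (D ^ (P - 1) + D ^ (q - 1)) := by
    have := abs_rpow_sub_rpow_le hD (P - 1) (q - 1)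
    rwa [sub_sub_sub_cancel_right] at this
  -- Either D^{P-1} ≤ 3 D^{q-1} (since e < 3), or the factor ω² log² D ≥ 1 is available at no cost.
  rcases le_total (|ω| * |Real.log D|) 1 with hc | hc
  · have hcomp : D ^ (P - 1) ≤ 3 * D ^ (q - 1) := by
      have e1 : D ^ ω ≤ 3 := by
        rw [Real.rpow_def_of_pos hD]
        calc Real.exp (Real.log D * ω) ≤ Real.exp 1 := by
              refine Real.exp_le_exp.2 ((le_abs_self _).trans ?_)
              rw [abs_mul, mul_comm]; exact hc
          _ ≤ 3 := by linarith [Real.exp_one_lt_d9]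
      calc D ^ (P - 1) = D ^ ω * D ^ (q - 1) := by
            rw [← Real.rpow_add hD, hω]; ring_nf
        _ ≤ _ := by gcongr
    -- For r ≤ D the function `shiftPow` is quadratic in r up to constants and the quadratic Young
    -- inequality for (κD) r applies; for r ≥ D the whole flux increment is dominated by
    -- `shiftDeriv` at r.
    rcases le_total r D with hrD | hrD
    · have e1 : D ^ (q - 2) ≤ K * (D + r) ^ (q - 2) :=
        rpow_le_of_le_two_mul hD (by positivity) (by linarith) (by linarith) hq2
      set κ := |ω| * |Real.log D| with hκ
      have hκ0 : 0 ≤ κ := by positivity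
      have e2 : α ≤ 4 * κ * (D ^ (q - 2) * D) := by
        rw [hDq2]
        calc α ≤ κ * (D ^ (P - 1) + D ^ (q - 1)) := hαabs
          _ ≤ κ * (3 * D ^ (q - 1) + D ^ (q - 1)) := by gcongr
          _ = _ := by ring
      have e3 : 4 * κ * D * r ≤ r ^ 2 + 4 * κ ^ 2 * D ^ 2 := by
        nlinarith [sq_nonneg (r - 2 * κ * D)]
      have e4 : D ^ (q - 2) * D ^ 2 = D ^ q := by rw [← hDq, ← hDq2]; ring
      have e5 : κ ^ 2 = ω ^ 2 * Real.log D ^ 2 := by rw [hκ, mul_pow, sq_abs, sq_abs]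
      calc α * r ≤ 4 * κ * (D ^ (q - 2) * D) * r := by gcongr
        _ = D ^ (q - 2) * (4 * κ * D * r) := by ring
        _ ≤ D ^ (q - 2) * (r ^ 2 + 4 * κ ^ 2 * D ^ 2) := by gcongr
        _ = D ^ (q - 2) * r ^ 2 + 4 * ω ^ 2 * (Real.log D ^ 2 * D ^ q) := by
            rw [← e4, mul_add, ← mul_assoc (D ^ (q - 2)) (4 * κ ^ 2), e5]; ring
        _ ≤ K * (D + r) ^ (q - 2) * r ^ 2 + 4 * ω ^ 2 * (C₁ * Z) := by gcongr
        _ = K * S + 4 * C₁ * W := by rw [hSdef, hWdef, shiftPow]; ring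
        _ ≤ _ := hfinal _ _ (by linarith) (by linarith)
    · have e1 : D ^ (q - 2) ≤ K * (D + D) ^ (q - 2) :=
        rpow_le_of_le_two_mul hD (by positivity) (by linarith) (by linarith) hq2
      have e2 : shiftDeriv D q D ≤ shiftDeriv D q r :=
        shiftDeriv_mono (by linarith) hD.le hD.le hrD
      have e3 : α ≤ 4 * (K * shiftDeriv D q r) := by
        calc α ≤ 4 * (D ^ (q - 2) * D) := by rw [hDq2]; linarith
          _ ≤ 4 * (K * (D + D) ^ (q - 2) * D) := by gcongr
          _ = 4 * (K * shiftDeriv D q D) := by unfold shiftDeriv; ring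
          _ ≤ _ := by gcongr
      calc α * r ≤ 4 * (K * shiftDeriv D q r) * r := by gcongr
        _ = 4 * K * S + 0 * W := by rw [hSdef, shiftPow_eq]; ring
        _ ≤ _ := hfinal _ _ le_rfl (by positivity)
  · have hc2 : 1 ≤ ω ^ 2 * Real.log D ^ 2 := by
      rw [← sq_abs ω, ← sq_abs (Real.log D), ← mul_pow]
      exact one_le_pow₀ hc
    -- Inserting ω² log² D turns a bare power of D into the error term W.
    have habs : ∀ x : ℝ, Real.log D ^ 2 * D ^ x ≤ C₁ * Z → D ^ x ≤ C₁ * W := by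
      intro x hx
      calc D ^ x = 1 * D ^ x := (one_mul _).symm
        _ ≤ ω ^ 2 * Real.log D ^ 2 * D ^ x := by gcongr
        _ = ω ^ 2 * (Real.log D ^ 2 * D ^ x) := by ring
        _ ≤ ω ^ 2 * (C₁ * Z) := by gcongr
        _ = _ := by rw [hWdef]; ring
    rcases le_total r D with hrD | hrD
    · calc α * r ≤ (D ^ (P - 1) + D ^ (q - 1)) * D := by gcongr
        _ = D ^ P + D ^ q := by rw [add_mul, hDP, hDq]
        _ ≤ C₁ * W + C₁ * W := add_le_add (habs _ hlogP) (habs _ hlogq)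
        _ = 0 * S + 2 * C₁ * W := by ring
        _ ≤ _ := hfinal _ _ (by positivity) (by linarith)
    · have hr0 : 0 < r := hD.trans_le hrD
      rcases le_total α (shiftDeriv D q r) with hd | hd
      · calc α * r ≤ shiftDeriv D q r * r := by gcongr
          _ = 1 * S + 0 * W := by rw [hSdef, shiftPow_eq]; ring
          _ ≤ _ := hfinal _ _ (by linarith) (by positivity)
      · have e1 : r ^ (q - 2) ≤ K * (D + r) ^ (q - 2) :=
          rpow_le_of_le_two_mul hr0 (by positivity) (by linarith) (by linarith) hq2
        have e2 : r ^ (q - 1) ≤ K * α := by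
          calc r ^ (q - 1) = r ^ (q - 2) * r := by
                rw [← Real.rpow_add_one hr0.ne']; ring_nf
            _ ≤ K * (D + r) ^ (q - 2) * r := by gcongr
            _ = K * shiftDeriv D q r := by unfold shiftDeriv; ring
            _ ≤ _ := by gcongr
        have hq1 : 0 < q - 1 := by linarith
        -- Here α dominates `shiftDeriv` at r, hence a multiple of r^{q-1}; thus r is at most a
        -- power of D and α r is at most a multiple of D^{(e-1)q'}. The exponent e is whichever of P
        -- and q gives the larger power.
        have key : ∀ e, pm ≤ e → α ≤ 2 * D ^ (e - 1) → (e - 1) * (q / (q - 1)) ≤ P * z →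
            α * r ≤ 2 * B * C₁ * W := by
          intro e he hαe hez
          have g1 : r ^ (q - 1) ≤ (2 * K) * D ^ (e - 1) := by
            calc r ^ (q - 1) ≤ K * α := e2
              _ ≤ K * (2 * D ^ (e - 1)) := by gcongr
              _ = _ := by ring
          have g2 : r ≤ B * D ^ ((e - 1) / (q - 1)) := by
            calc r = (r ^ (q - 1)) ^ (1 / (q - 1)) := by
                  rw [← Real.rpow_mul hr0.le, mul_one_div_cancel hq1.ne', Real.rpow_one]
              _ ≤ ((2 * K) * D ^ (e - 1)) ^ (1 / (q - 1)) :=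
                  Real.rpow_le_rpow (by positivity) g1 (by positivity)
              _ = (2 * K) ^ (1 / (q - 1)) * D ^ ((e - 1) / (q - 1)) := by
                  rw [Real.mul_rpow (by positivity) (by positivity), ← Real.rpow_mul hD.le,
                    mul_one_div]
              _ ≤ _ := by
                  gcongr
                  refine Real.rpow_le_rpow_of_exponent_le (by linarith) ?_
                  exact one_div_le_one_div_of_le (by linarith) (by linarith)
          have g3 : (e - 1) + (e - 1) / (q - 1) = (e - 1) * (q / (q - 1)) := by
            field_simp; ring
          have g4 : pm - 1 ≤ (e - 1) * (q / (q - 1)) := by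
            have : 0 ≤ (e - 1) / (q - 1) := div_nonneg (by linarith) hq1.le
            linarith
          calc α * r ≤ 2 * D ^ (e - 1) * (B * D ^ ((e - 1) / (q - 1))) := by gcongr
            _ = 2 * B * D ^ ((e - 1) * (q / (q - 1))) := by
                rw [← g3, Real.rpow_add hD]; ring
            _ ≤ 2 * B * (C₁ * W) := by
                gcongr
                exact habs _ (h1 D P _ hD (by linarith) g4 hez)
            _ = _ := by ring
        have hfin : α * r ≤ 2 * B * C₁ * W := by
          rcases le_total (D ^ (P - 1)) (D ^ (q - 1)) with h | h
          · refine key q hq (by linarith) ?_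
            have : (q - 1) * (q / (q - 1)) = q := by field_simp
            rw [this]; exact hσ.le_mul hP hPq
          · exact key P hP (by linarith) (hσ.conj_le_mul hP hq hPq)
        calc α * r ≤ 0 * S + 2 * B * C₁ * W := by rw [zero_mul, zero_add]; exact hfin
          _ ≤ _ := hfinal _ _ (by positivity) (by linarith)

/-- Young's inequality for a change of the exponent of the operator `opA`. -/
theorem exists_opA_exponent_le (pm pp δ σ z : ℝ) (hδ : 0 ≤ δ)
    (hσ : IsSmallOscillation pm σ z) :
    ∃ C, 0 < C ∧ ∀ (P q r : ℝ) (b : Rd d), pm ≤ P → P ≤ pp → pm ≤ q → q ≤ pp →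
      |P - q| ≤ 2 * σ → 0 ≤ r →
      ‖opA δ P b - opA δ q b‖ * r ≤
        C * (shiftPow (δ + ‖b‖) q r + (P - q) ^ 2 * (1 + ‖b‖ ^ (P * z ^ 2))) := by
  obtain ⟨C, hC, h⟩ := exists_exponent_young pm pp σ z hσ
  have hpm := hσ.one_lt_pm
  refine ⟨C * (2 * (1 + δ) ^ |pp * z ^ 2|), by positivity,
    fun P q r b hP hPp hq hqp hPq hr => ?_⟩
  have hS := shiftPow_nonneg q (by positivity : 0 ≤ δ + ‖b‖) hr
  rcases eq_or_lt_of_le (norm_nonneg b) with h0 | h0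
  · have hb : b = 0 := norm_eq_zero.1 h0.symm
    have : opA δ P b - opA δ q b = 0 := by simp [opA, hb]
    rw [this, norm_zero, zero_mul]
    positivity
  have hM1 : (1:ℝ) ≤ (1 + δ) ^ |pp * z ^ 2| := Real.one_le_rpow (by linarith) (abs_nonneg _)
  have hDb : (δ + ‖b‖) ^ (P * z ^ 2) ≤ (1 + δ) ^ |pp * z ^ 2| * (1 + ‖b‖ ^ (P * z ^ 2)) :=
    add_rpow_le_mul hδ h0.le (mul_nonneg (by linarith) (sq_nonneg z))
      ((mul_le_mul_of_nonneg_right hPp (sq_nonneg z)).trans (le_abs_self _))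
  have hbb : 0 ≤ ‖b‖ ^ (P * z ^ 2) := by positivity
  set N := (1 + δ) ^ |pp * z ^ 2| with hN
  calc ‖opA δ P b - opA δ q b‖ * r
      ≤ |(δ + ‖b‖) ^ (P - 1) - (δ + ‖b‖) ^ (q - 1)| * r := by
        gcongr; exact norm_opA_sub_exponent_le hδ b
    _ ≤ C * (shiftPow (δ + ‖b‖) q r + (P - q) ^ 2 * (1 + (δ + ‖b‖) ^ (P * z ^ 2))) :=
        h P q _ r hP hq hqp hPq (by positivity) hr
    _ ≤ C * (2 * N * shiftPow (δ + ‖b‖) q r +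
          (P - q) ^ 2 * (2 * N * (1 + ‖b‖ ^ (P * z ^ 2)))) := by
        gcongr
        · nlinarith
        · nlinarith
    _ = _ := by ring

/-- The pointwise estimate of the flux by the natural distance and the oscillation of the
exponent. -/
theorem exists_flux_young (pm pp δ σ z : ℝ) (hδ : 0 ≤ δ) (hσ : IsSmallOscillation pm σ z) :
    ∃ C, 0 < C ∧ ∀ (P q r : ℝ) (a b : Rd d), pm ≤ P → P ≤ pp → pm ≤ q → q ≤ pp →
      |P - q| ≤ 2 * σ → 0 ≤ r →
      ‖opA δ q a - opA δ P b‖ * r ≤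
        C * (shiftPow (δ + ‖a‖) q r + ‖opF δ q a - opF δ q b‖ ^ 2 +
          (P - q) ^ 2 * (1 + ‖b‖ ^ (P * z ^ 2))) := by
  obtain ⟨C, hC, h⟩ := exists_opA_exponent_le (d := d) pm pp δ σ z hδ hσ
  have hpm := hσ.one_lt_pm
  set C₂ : ℝ := (4 * 2 ^ (2 + |pp|)) ^ 2 with hC₂
  set K : ℝ := 2 ^ |pp| with hK
  have hC₂1 : 1 ≤ C₂ := by
    have : (1:ℝ) ≤ 2 ^ (2 + |pp|) := Real.one_le_rpow (by norm_num) (by positivity)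
    rw [hC₂]; nlinarith
  have hK0 : 0 < K := by positivity
  refine ⟨(1 + |pp|) * K * K * C₂ + C * K * C₂ + C, by positivity,
    fun P q r a b hP hPp hq hqp hPq hr => ?_⟩
  have hqp' : q ≤ |pp| := hqp.trans (le_abs_self _)
  have hq1 : 1 < q := by linarith
  have h1 := norm_opA_sub_le hq1 hqp' hδ a b
  have h2 := flux_mul_le hq1 hqp' hδ hr a b
  have h3 := shiftPow_change hq1 hqp' hδ hr a b
  have h4 := norm_opF_sub_sq_ge hq1 hqp' hδ a b
  have h5 := h P q r b hP hPp hq hqp hPq hr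
  set S := shiftPow (δ + ‖a‖) q r with hS
  have hS0 : 0 ≤ S := shiftPow_nonneg q (by positivity) hr
  set N := ‖opF δ q a - opF δ q b‖ ^ 2 with hN
  have hN0 : 0 ≤ N := by positivity
  set E := (P - q) ^ 2 * (1 + ‖b‖ ^ (P * z ^ 2)) with hE
  have hE0 : 0 ≤ E := by positivity
  have hSN : S + (δ + ‖a‖ + ‖b‖) ^ (q - 2) * ‖a - b‖ ^ 2 ≤ C₂ * (S + N) := by nlinarith
  have e1 : ‖opA δ q a - opA δ q b‖ * r ≤ (1 + |pp|) * K * K * C₂ * (S + N) := by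
    calc _ ≤ (1 + |pp|) * K * ((δ + ‖a‖ + ‖b‖) ^ (q - 2) * ‖a - b‖) * r := by gcongr
      _ = (1 + |pp|) * K * ((δ + ‖a‖ + ‖b‖) ^ (q - 2) * ‖a - b‖ * r) := by ring
      _ ≤ (1 + |pp|) * K * (K * (C₂ * (S + N))) := by
          exact mul_le_mul_of_nonneg_left (h2.trans (by gcongr)) (by positivity)
      _ = _ := by ring
  -- The change of exponent is naturally measured with the shift δ+‖b‖; moving to the shift δ+‖a‖
  -- costs one natural distance.
  have e2 : ‖opA δ q b - opA δ P b‖ * r ≤ C * K * C₂ * (S + N) + C * E := by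
    rw [norm_sub_rev]
    calc _ ≤ C * (shiftPow (δ + ‖b‖) q r + E) := h5
      _ ≤ C * (K * (C₂ * (S + N)) + E) := by
          gcongr; exact h3.trans (by gcongr)
      _ = _ := by ring
  have e3 : ‖opA δ q a - opA δ P b‖ ≤
      ‖opA δ q a - opA δ q b‖ + ‖opA δ q b - opA δ P b‖ := norm_sub_le_norm_sub_add_norm_sub _ _ _
  have e4 : ‖opA δ q a - opA δ P b‖ * r ≤
      (‖opA δ q a - opA δ q b‖ + ‖opA δ q b - opA δ P b‖) * r := by gcongr
  have f1 : 0 ≤ C * (S + N) := by positivity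
  have f2 : 0 ≤ ((1 + |pp|) * K * K * C₂ + C * K * C₂) * E := by positivity
  nlinarith

end

/-! ### From flux jumps to jumps of F: comparable exponents and elementary cases. -/

noncomputable section

theorem exists_mul_rpow_le_half (m θ : ℝ) (hθ : 0 < θ) :
    ∃ l : ℝ, 0 < l ∧ l ≤ 1 ∧ m * l ^ θ ≤ 1 / 2 := by
  have h : Tendsto (fun l : ℝ => m * l ^ θ) (𝓝[>] 0) (𝓝 (m * 0 ^ θ)) :=
    ((Real.continuousAt_rpow_const 0 θ (Or.inr hθ.le)).tendsto.mono_left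
      nhdsWithin_le_nhds).const_mul m
  rw [Real.zero_rpow hθ.ne', mul_zero] at h
  have h1 : ∀ᶠ l in 𝓝[>] (0:ℝ), m * l ^ θ < 1 / 2 := h.eventually_lt_const (by norm_num)
  have h2 : ∀ᶠ l in 𝓝[>] (0:ℝ), l ∈ Ioc (0:ℝ) 1 :=
    Ioc_mem_nhdsGT one_pos
  obtain ⟨l, hl1, hl2⟩ := (h1.and h2).exists
  exact ⟨l, hl2.1, hl2.2, hl1.le⟩

theorem add_add_sq_le (x y w : ℝ) : (x + y + w) ^ 2 ≤ 3 * (x ^ 2 + y ^ 2 + w ^ 2) := by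
  nlinarith [sq_nonneg (x - y), sq_nonneg (x - w), sq_nonneg (y - w)]

variable {d : ℕ}

theorem norm_opF_sq_le {δ q : ℝ} (hδ : 0 ≤ δ) (a : Rd d) :
    ‖opF δ q a‖ ^ 2 ≤ (δ + ‖a‖) ^ q := by
  rcases eq_or_lt_of_le (norm_nonneg a) with h0 | h0
  · have ha : a = 0 := norm_eq_zero.1 h0.symm
    have : opF δ q a = 0 := by simp [opF, ha]
    rw [this, norm_zero, zero_pow two_ne_zero]; positivity
  have hD : 0 < δ + ‖a‖ := by positivity
  rw [opF, norm_smul, Real.norm_of_nonneg (by positivity), mul_pow, rpow_half_sq hD.le]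
  calc (δ + ‖a‖) ^ (q - 2) * ‖a‖ ^ 2 ≤ (δ + ‖a‖) ^ (q - 2) * (δ + ‖a‖) ^ 2 := by
        gcongr; linarith
    _ = (δ + ‖a‖) ^ q := by
        rw [← Real.rpow_natCast, ← Real.rpow_add hD]; norm_num

/-- The jump estimate where the powers with the exponents `q₀`, `q₁`, `q₂` are comparable. -/
theorem exists_jump_le_of_comparable (pm pp δ σ z C₀ : ℝ) (hδ : 0 ≤ δ) (hC₀ : 0 < C₀)
    (hσ : IsSmallOscillation pm σ z) :
    ∃ C, 0 < C ∧ ∀ (q₀ q₁ q₂ : ℝ) (a₁ a₂ ν : Rd d) (τ Y : ℝ),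
      q₀ ∈ Icc pm pp → q₁ ∈ Icc pm pp → q₂ ∈ Icc pm pp →
      |q₁ - q₀| ≤ 2 * σ → |q₂ - q₀| ≤ 2 * σ → ‖ν‖ = 1 → a₁ - a₂ = τ • ν → 0 ≤ Y →
      (q₁ - q₀) ^ 2 * (1 + ‖a₁‖ ^ (q₁ * z ^ 2)) ≤ C₀ * Y →
      (q₂ - q₀) ^ 2 * (1 + ‖a₂‖ ^ (q₂ * z ^ 2)) ≤ C₀ * Y →
      |q₁ - q₀| * |Real.log (δ + ‖a₁‖ + ‖a₂‖)| ≤ 1 →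
      |q₂ - q₀| * |Real.log (δ + ‖a₁‖ + ‖a₂‖)| ≤ 1 →
      (∀ r, 0 ≤ r → |inner ℝ (opA δ q₁ a₁ - opA δ q₂ a₂) ν| * r ≤
        C₀ * (Y + shiftPow (δ + ‖a₁‖) q₁ r + shiftPow (δ + ‖a₂‖) q₂ r)) →
      ‖opF δ q₁ a₁ - opF δ q₂ a₂‖ ^ 2 ≤ C * Y := by
  have hpm := hσ.one_lt_pm
  obtain ⟨CF, hCF, hF⟩ := exists_opF_exponent_le (d := d) pm pp δ σ z hδ hσ
  obtain ⟨CA, hCA, hA⟩ := exists_opA_exponent_le (d := d) pm pp δ σ z hδ hσ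
  set Q := |pp| with hQ
  set K : ℝ := 2 ^ Q with hK
  set c₁ : ℝ := ((3 + Q) * 2 ^ (2 + Q)) ^ 2 with hc₁
  set κ : ℝ := min 1 (pm - 1) with hκ
  have hκ0 : 0 < κ := lt_min one_pos (by linarith)
  set c₂ : ℝ := 2 * K / κ with hc₂
  set θ := min pm 2 - 1 with hθ
  have hθ0 : 0 < θ := by rw [hθ, sub_pos]; exact lt_min hpm (by norm_num)
  have hθ1 : θ ≤ 1 := by have := min_le_right pm 2; linarith
  have hQ0 : 0 ≤ Q := abs_nonneg _
  have hK0 : 0 < K := by positivity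
  have hc₂0 : 0 < c₂ := by positivity
  have hc₁0 : 0 ≤ c₁ := by positivity
  -- The number l is small enough for all multiples of X on the right to be absorbed into half of
  -- the left-hand side.
  obtain ⟨l, hl0, hl1, hl⟩ := exists_mul_rpow_le_half (c₂ * (6 * K * C₀ + 6 * K * CA)) θ hθ0
  refine ⟨3 * (CF * C₀ + c₁ * (2 / l * (c₂ * (C₀ + 2 * CA * C₀))) + CF * C₀), by positivity, ?_⟩
  rintro q₀ q₁ q₂ a₁ a₂ ν τ Y ⟨hq₀, hq₀'⟩ ⟨hq₁, hq₁'⟩ ⟨hq₂, hq₂'⟩ h10 h20 hν haτ hY hY1 hY2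
    hlog1 hlog2 hJ
  have hqQ : ∀ q, q ≤ pp → q ≤ Q := fun q h => h.trans (le_abs_self _)
  set M := δ + ‖a₁‖ + ‖a₂‖ with hM
  have hM0' : 0 ≤ M := by positivity
  rcases eq_or_lt_of_le hM0' with hM0 | hM0
  · have h1 : ‖a₁‖ = 0 := by
      have := norm_nonneg a₁; have := norm_nonneg a₂; linarith
    have h2 : ‖a₂‖ = 0 := by
      have := norm_nonneg a₁; have := norm_nonneg a₂; linarith
    have : opF δ q₁ a₁ - opF δ q₂ a₂ = 0 := by
      simp [opF, norm_eq_zero.1 h1, norm_eq_zero.1 h2]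
    rw [this, norm_zero, zero_pow two_ne_zero]
    positivity
  set t := ‖a₁ - a₂‖ with ht
  have ht0 : 0 ≤ t := norm_nonneg _
  have htτ : t = |τ| := by rw [ht, haτ, norm_smul, hν, mul_one, Real.norm_eq_abs]
  set X := M ^ (q₀ - 2) * t ^ 2 with hX
  have hX0 : 0 ≤ X := by positivity
  have hmid := norm_opF_sub_sq_le (by linarith : 1 < q₀) (hqQ _ hq₀') hδ a₁ a₂
  have hmono := inner_opA_sub_ge (by linarith : 1 < q₀) (hqQ _ hq₀') hδ a₁ a₂
  have hF1 := hF q₁ q₀ a₁ hq₁ hq₁' hq₀ h10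
  have hF2 := hF q₂ q₀ a₂ hq₂ hq₂' hq₀ h20
  -- Comparability of the exponents: M^{q-q₀} ≤ e < 3, so all weights can be replaced by the one
  -- with exponent q₀.
  have hcomp : ∀ q, |q - q₀| * |Real.log M| ≤ 1 → M ^ (q - 2) ≤ 3 * M ^ (q₀ - 2) := by
    intro q hq
    have e1 : M ^ (q - q₀) ≤ 3 := by
      rw [Real.rpow_def_of_pos hM0]
      calc Real.exp (Real.log M * (q - q₀)) ≤ Real.exp 1 := by
            refine Real.exp_le_exp.2 ((le_abs_self _).trans ?_)
            rw [abs_mul, mul_comm]; exact hq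
        _ ≤ 3 := by linarith [Real.exp_one_lt_d9]
    calc M ^ (q - 2) = M ^ (q - q₀) * M ^ (q₀ - 2) := by
          rw [← Real.rpow_add hM0]; ring_nf
      _ ≤ _ := by gcongr
  have hXpow : ∀ q, q ∈ Icc pm pp → |q - q₀| * |Real.log M| ≤ 1 → ∀ a : Rd d,
      δ + ‖a‖ + t ≤ 2 * M → M ≤ 2 * (δ + ‖a‖ + t) →
      shiftPow (δ + ‖a‖) q (l * t) ≤ l ^ (1 + θ) * (3 * K * X) := by
    intro q hq hqc a ha1 ha2
    have g1 : shiftPow (δ + ‖a‖) q (l * t) ≤ l ^ (1 + θ) * shiftPow (δ + ‖a‖) q t :=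
      shiftPow_scale (by positivity) ht0 hl0 hl1 hθ1
        (by have := min_le_left pm 2; linarith [hq.1])
    have g2 : (δ + ‖a‖ + t) ^ (q - 2) ≤ K * M ^ (q - 2) :=
      rpow_le_of_le_two_mul (by linarith) hM0 ha1 ha2
        (abs_le.2 ⟨by linarith [hq.1, hqQ q hq.2], by linarith [hqQ q hq.2]⟩)
    refine g1.trans (mul_le_mul_of_nonneg_left ?_ (by positivity))
    calc shiftPow (δ + ‖a‖) q t ≤ K * (3 * M ^ (q₀ - 2)) * t ^ 2 := by
          unfold shiftPow
          gcongr
          exact g2.trans (by gcongr; exact hcomp q hqc)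
      _ = 3 * K * X := by rw [hX]; ring
  have hn1 : ‖a₁‖ ≤ ‖a₂‖ + t := by simpa using norm_add_le a₂ (a₁ - a₂)
  have hn2 : ‖a₂‖ ≤ ‖a₁‖ + t := by simpa [ht, norm_sub_rev] using norm_add_le a₁ (a₂ - a₁)
  have hnt : t ≤ ‖a₁‖ + ‖a₂‖ := norm_sub_le a₁ a₂
  have hna1 := norm_nonneg a₁
  have hna2 := norm_nonneg a₂
  have hzero : |q₀ - q₀| * |Real.log M| ≤ 1 := by simp
  have hS11 := hXpow q₁ ⟨hq₁, hq₁'⟩ hlog1 a₁ (by linarith) (by linarith)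
  have hS22 := hXpow q₂ ⟨hq₂, hq₂'⟩ hlog2 a₂ (by linarith) (by linarith)
  have hS01 := hXpow q₀ ⟨hq₀, hq₀'⟩ hzero a₁ (by linarith) (by linarith)
  have hS02 := hXpow q₀ ⟨hq₀, hq₀'⟩ hzero a₂ (by linarith) (by linarith)
  set L := l ^ (1 + θ) with hL
  have hlt : 0 ≤ l * t := by positivity
  -- The free Young parameter is a small multiple of t = ‖a₁-a₂‖: every `shiftPow` term becomes
  -- l^{1+θ} X, whereas the left-hand side will be of order l X.
  have hJ' := hJ (l * t) hlt
  have hA1 := hA q₁ q₀ (l * t) a₁ hq₁ hq₁' hq₀ hq₀' h10 hlt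
  have hA2 := hA q₂ q₀ (l * t) a₂ hq₂ hq₂' hq₀ hq₀' h20 hlt
  set J := |inner ℝ (opA δ q₁ a₁ - opA δ q₂ a₂) ν| with hJdef
  set α₁ := ‖opA δ q₁ a₁ - opA δ q₀ a₁‖ with hα₁
  set α₂ := ‖opA δ q₂ a₂ - opA δ q₀ a₂‖ with hα₂
  -- Since a₁-a₂ is a multiple of ν, the monotonicity pairing sees only the normal component of the
  -- flux jump; passing from q₁, q₂ to q₀ costs α₁ and α₂.
  have hinner : inner ℝ (opA δ q₀ a₁ - opA δ q₀ a₂) (a₁ - a₂) ≤ t * (J + α₁ + α₂) := by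
    have e0 : opA δ q₀ a₁ - opA δ q₀ a₂ = (opA δ q₁ a₁ - opA δ q₂ a₂) -
        (opA δ q₁ a₁ - opA δ q₀ a₁) + (opA δ q₂ a₂ - opA δ q₀ a₂) := by abel
    have e1 : inner ℝ (opA δ q₁ a₁ - opA δ q₂ a₂) (a₁ - a₂) ≤ t * J := by
      rw [haτ, real_inner_smul_right, htτ, hJdef, ← abs_mul]
      exact le_abs_self _
    have e2 : -inner ℝ (opA δ q₁ a₁ - opA δ q₀ a₁) (a₁ - a₂) ≤ α₁ * t :=
      (neg_le_abs _).trans (abs_real_inner_le_norm _ _)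
    have e3 : inner ℝ (opA δ q₂ a₂ - opA δ q₀ a₂) (a₁ - a₂) ≤ α₂ * t :=
      real_inner_le_norm _ _
    rw [e0, inner_add_left, inner_sub_left]
    linarith
  have hXle : κ * X ≤ 2 * K * (t * (J + α₁ + α₂)) := by
    calc κ * X ≤ min 1 (q₀ - 1) * X :=
          mul_le_mul_of_nonneg_right (min_le_min le_rfl (by linarith)) hX0
      _ ≤ 2 * K * inner ℝ (opA δ q₀ a₁ - opA δ q₀ a₂) (a₁ - a₂) := hmono
      _ ≤ _ := by gcongr
  have hlX : l * X ≤ c₂ * ((C₀ + 2 * CA * C₀) * Y + L * (6 * K * C₀ + 6 * K * CA) * X) := by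
    have e1 : J * (l * t) + α₁ * (l * t) + α₂ * (l * t) ≤
        (C₀ + 2 * CA * C₀) * Y + L * (6 * K * C₀ + 6 * K * CA) * X := by
      have g1 : J * (l * t) ≤ C₀ * (Y + L * (3 * K * X) + L * (3 * K * X)) :=
        hJ'.trans (mul_le_mul_of_nonneg_left (by linarith) hC₀.le)
      have g2 : α₁ * (l * t) ≤ CA * (L * (3 * K * X) + C₀ * Y) :=
        hA1.trans (mul_le_mul_of_nonneg_left (by linarith) hCA.le)
      have g3 : α₂ * (l * t) ≤ CA * (L * (3 * K * X) + C₀ * Y) :=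
        hA2.trans (mul_le_mul_of_nonneg_left (by linarith) hCA.le)
      linarith
    calc l * X = l * (κ * X) / κ := by field_simp
      _ ≤ l * (2 * K * (t * (J + α₁ + α₂))) / κ := by gcongr
      _ = c₂ * (J * (l * t) + α₁ * (l * t) + α₂ * (l * t)) := by rw [hc₂]; ring
      _ ≤ _ := by gcongr
  rw [← hc₁, ← hX] at hmid
  clear_value c₁ c₂ X L K κ J α₁ α₂ θ
  have hXfin : X ≤ 2 / l * (c₂ * (C₀ + 2 * CA * C₀)) * Y := by
    have e1 : L = l * l ^ θ := by rw [hL, add_comm, Real.rpow_add_one hl0.ne', mul_comm]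
    have e2 : c₂ * (L * (6 * K * C₀ + 6 * K * CA) * X) ≤ l * X / 2 := by
      calc c₂ * (L * (6 * K * C₀ + 6 * K * CA) * X)
          = l * X * (c₂ * (6 * K * C₀ + 6 * K * CA) * l ^ θ) := by rw [e1]; ring
        _ ≤ l * X * (1 / 2) := by gcongr
        _ = _ := by ring
    have e3 : l * X ≤ 2 * (c₂ * (C₀ + 2 * CA * C₀)) * Y := by
      rw [mul_add] at hlX; linarith
    calc X = l * X / l := by field_simp
      _ ≤ 2 * (c₂ * (C₀ + 2 * CA * C₀)) * Y / l := by gcongr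
      _ = _ := by ring
  have htri : ‖opF δ q₁ a₁ - opF δ q₂ a₂‖ ≤ ‖opF δ q₁ a₁ - opF δ q₀ a₁‖ +
      ‖opF δ q₀ a₁ - opF δ q₀ a₂‖ + ‖opF δ q₂ a₂ - opF δ q₀ a₂‖ := by
    rw [norm_sub_rev (opF δ q₂ a₂)]
    exact (norm_sub_le_norm_sub_add_norm_sub _ (opF δ q₀ a₂) _).trans
      (by gcongr; exact norm_sub_le_norm_sub_add_norm_sub _ _ _)
  calc ‖opF δ q₁ a₁ - opF δ q₂ a₂‖ ^ 2 ≤ (‖opF δ q₁ a₁ - opF δ q₀ a₁‖ +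
      ‖opF δ q₀ a₁ - opF δ q₀ a₂‖ + ‖opF δ q₂ a₂ - opF δ q₀ a₂‖) ^ 2 := by gcongr
    _ ≤ 3 * (‖opF δ q₁ a₁ - opF δ q₀ a₁‖ ^ 2 + ‖opF δ q₀ a₁ - opF δ q₀ a₂‖ ^ 2 +
        ‖opF δ q₂ a₂ - opF δ q₀ a₂‖ ^ 2) := add_add_sq_le _ _ _
    _ ≤ 3 * (CF * (C₀ * Y) + c₁ * (2 / l * (c₂ * (C₀ + 2 * CA * C₀)) * Y) + CF * (C₀ * Y)) := by
        gcongr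
        · exact hF1.trans (by gcongr)
        · exact hmid.trans (by gcongr)
        · exact hF2.trans (by gcongr)
    _ = _ := by ring

/-- The jump estimate where the exponents are not comparable, away from the case where `a₁` is
much smaller than `a₂` and `a₂` is large. -/
theorem exists_jump_le_of_log (pm pp δ σ z C₀ M₀ : ℝ) (hδ : 0 ≤ δ) (hC₀ : 0 < C₀)
    (hM₀ : 1 ≤ M₀) (hσ : IsSmallOscillation pm σ z) :
    ∃ C, 0 < C ∧ ∀ (q₀ q₁ q₂ : ℝ) (a₁ a₂ : Rd d) (Y : ℝ),
      q₁ ∈ Icc pm pp → q₂ ∈ Icc pm pp → |q₁ - q₂| ≤ 2 * σ → 0 ≤ Y →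
      (q₁ - q₀) ^ 2 * (1 + ‖a₁‖ ^ (q₁ * z ^ 2)) ≤ C₀ * Y →
      1 ≤ |q₁ - q₀| * |Real.log (δ + ‖a₁‖ + ‖a₂‖)| →
      ‖opF δ q₁ a₁ - opF δ q₂ a₂‖ ^ 2 ≤ C * Y ∨
        (M₀ ≤ δ + ‖a₁‖ + ‖a₂‖ ∧ ‖a₁‖ ^ z ≤ δ + ‖a₁‖ + ‖a₂‖ ∧
          ‖opF δ q₁ a₁ - opF δ q₂ a₂‖ ^ 2 ≤ C * (δ + ‖a₁‖ + ‖a₂‖) ^ q₂) := by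
  have hpm := hσ.one_lt_pm
  have hz := hσ.one_lt
  have hσ4 := hσ.one_add_le
  have hσ0 := hσ.nonneg
  obtain ⟨C₁, hC₁, h1⟩ := exists_log_sq_mul_rpow_le 1 z one_pos hσ.one_lt
  -- Half of the gain z-1 pays for the difference of the exponents, as 2σ ≤ γ; the other half pays
  -- for the logarithm.
  set γ := (z - 1) / 2 with hγ
  have hγ0 : 0 < γ := by rw [hγ]; linarith
  set B₁ := 4 * (C₁ * (1 + M₀ ^ |pp * z ^ 2|) * C₀) with hB₁
  set B₂ := 4 * (4 / γ ^ 2 * C₀) with hB₂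
  set B₃ := 2 * ((1 + δ) ^ |pp| + 1) with hB₃
  have hB₁0 : 0 < B₁ := by positivity
  have hB₂0 : 0 < B₂ := by positivity
  have hB₃0 : 0 < B₃ := by positivity
  clear_value B₁ B₂ B₃ γ
  refine ⟨B₁ + B₂ + B₃, by positivity, ?_⟩
  rintro q₀ q₁ q₂ a₁ a₂ Y ⟨hq₁, hq₁'⟩ ⟨hq₂, hq₂'⟩ h12 hY hY1 hlog
  set M := δ + ‖a₁‖ + ‖a₂‖ with hM
  have hna1 := norm_nonneg a₁
  have hna2 := norm_nonneg a₂
  have hM0' : 0 ≤ M := by positivity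
  -- The default value `Real.log 0 = 0` would contradict `hlog`.
  have hM0 : 0 < M := by
    rcases eq_or_lt_of_le hM0' with h | h
    · rw [← h, Real.log_zero, abs_zero, mul_zero] at hlog; linarith
    · exact h
  set ω := q₁ - q₀ with hω
  have hlog2 : 1 ≤ ω ^ 2 * Real.log M ^ 2 := by
    rw [← sq_abs ω, ← sq_abs (Real.log M), ← mul_pow]
    exact one_le_pow₀ hlog
  have hω2 : ω ^ 2 ≤ C₀ * Y := by
    have : 0 ≤ ω ^ 2 * ‖a₁‖ ^ (q₁ * z ^ 2) := by positivity
    linarith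
  have hF1 : ‖opF δ q₁ a₁‖ ^ 2 ≤ (δ + ‖a₁‖) ^ q₁ := norm_opF_sq_le hδ a₁
  have hF2 : ‖opF δ q₂ a₂‖ ^ 2 ≤ M ^ q₂ := (norm_opF_sq_le hδ a₂).trans
    (Real.rpow_le_rpow (by positivity) (by linarith) (by linarith))
  have hF1' : (δ + ‖a₁‖) ^ q₁ ≤ M ^ q₁ :=
    Real.rpow_le_rpow (by positivity) (by linarith) (by linarith)
  have htri : ‖opF δ q₁ a₁ - opF δ q₂ a₂‖ ^ 2 ≤ 2 * ((δ + ‖a₁‖) ^ q₁ + M ^ q₂) := by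
    calc _ ≤ (‖opF δ q₁ a₁‖ + ‖opF δ q₂ a₂‖) ^ 2 := by gcongr; exact norm_sub_le _ _
      _ ≤ 2 * (‖opF δ q₁ a₁‖ ^ 2 + ‖opF δ q₂ a₂‖ ^ 2) := add_sq_le
      _ ≤ _ := by gcongr
  have hq2z : q₂ ≤ q₁ * z := hσ.le_mul hq₁ h12
  have hq1z : q₁ ≤ q₂ * z := hσ.le_mul hq₂ (by rwa [abs_sub_comm])
  have hconv : ∀ q H : ℝ, Real.log M ^ 2 * M ^ q ≤ H → M ^ q ≤ ω ^ 2 * H := by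
    intro q H hH
    calc M ^ q ≤ ω ^ 2 * Real.log M ^ 2 * M ^ q := le_mul_of_one_le_left (by positivity) hlog2
      _ = ω ^ 2 * (Real.log M ^ 2 * M ^ q) := by ring
      _ ≤ _ := by gcongr
  -- For bounded M all powers are bounded and the inserted ω² is controlled by Y alone.
  rcases le_total M M₀ with hMM | hMM
  · left
    have e1 : M ^ (q₁ * z ^ 2) ≤ M₀ ^ |pp * z ^ 2| :=
      (Real.rpow_le_rpow hM0.le hMM (mul_nonneg (by linarith) (sq_nonneg z))).trans
        (Real.rpow_le_rpow_of_exponent_le hM₀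
          ((mul_le_mul_of_nonneg_right hq₁' (sq_nonneg z)).trans (le_abs_self _)))
    have e2 : ∀ q, 1 ≤ q → q ≤ q₁ * z → M ^ q ≤ C₀ * Y * (C₁ * (1 + M₀ ^ |pp * z ^ 2|)) := by
      intro q hq hqz
      calc M ^ q ≤ ω ^ 2 * (C₁ * (1 + M₀ ^ |pp * z ^ 2|)) :=
            hconv q _ ((h1 M q₁ q hM0 (by linarith) hq hqz).trans (by gcongr))
        _ ≤ _ := by gcongr
    have e3 := e2 q₁ (by linarith) (le_mul_of_one_le_right (by linarith) hz.le)
    have e4 := e2 q₂ (by linarith) hq2z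
    calc _ ≤ 2 * ((δ + ‖a₁‖) ^ q₁ + M ^ q₂) := htri
      _ ≤ B₁ * Y := by rw [hB₁]; linarith
      _ ≤ _ := by gcongr; linarith
  · have hM1 : 1 ≤ M := hM₀.trans hMM
    -- If M ≤ ‖a₁‖^z, then M^{q+γ} is dominated by ‖a₁‖^{q₁z²}, which is exactly the power that the
    -- error on the side of a₁ controls.
    rcases le_total M (‖a₁‖ ^ z) with ha | ha
    · left
      have ha1 : 0 < ‖a₁‖ := by
        rcases eq_or_lt_of_le hna1 with h | h
        · rw [← h, Real.zero_rpow (by linarith)] at ha; linarith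
        · exact h
      have ha1' : 1 ≤ ‖a₁‖ := by
        by_contra! hlt
        have := Real.rpow_lt_one hna1 hlt (by linarith : 0 < z)
        linarith
      have e2 : ∀ q, 0 ≤ q → q + γ ≤ q₁ * z → M ^ q ≤ 4 / γ ^ 2 * (C₀ * Y) := by
        intro q hq hqz
        have g1 : M ^ (γ + q) ≤ ‖a₁‖ ^ (q₁ * z ^ 2) := by
          calc M ^ (γ + q) ≤ (‖a₁‖ ^ z) ^ (γ + q) :=
                Real.rpow_le_rpow hM0.le ha (by linarith)
            _ = ‖a₁‖ ^ (z * (γ + q)) := (Real.rpow_mul hna1 _ _).symm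
            _ ≤ _ := Real.rpow_le_rpow_of_exponent_le ha1'
                (by linarith [mul_le_mul_of_nonneg_left hqz (by linarith : 0 ≤ z)])
        calc M ^ q ≤ ω ^ 2 * (4 / γ ^ 2 * ‖a₁‖ ^ (q₁ * z ^ 2)) := by
              refine hconv q _ ?_
              calc Real.log M ^ 2 * M ^ q ≤ 4 / γ ^ 2 * M ^ γ * M ^ q := by
                    gcongr; exact log_sq_le_of_one_le hM1 hγ0
                _ = 4 / γ ^ 2 * M ^ (γ + q) := by rw [Real.rpow_add hM0]; ring
                _ ≤ _ := by gcongr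
          _ = 4 / γ ^ 2 * (ω ^ 2 * ‖a₁‖ ^ (q₁ * z ^ 2)) := by ring
          _ ≤ _ := by
              refine mul_le_mul_of_nonneg_left ?_ (by positivity)
              have : 0 ≤ ω ^ 2 := sq_nonneg _
              linarith
      have h12' := abs_le.1 h12
      have hq1z' : z - 1 ≤ q₁ * z - q₁ := by
        have := mul_le_mul_of_nonneg_right (show 1 ≤ q₁ by linarith) (show 0 ≤ z - 1 by linarith)
        linarith
      have e3 := e2 q₁ (by linarith) (by linarith)
      have e4 := e2 q₂ (by linarith) (by linarith)
      calc _ ≤ 2 * ((δ + ‖a₁‖) ^ q₁ + M ^ q₂) := htri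
        _ ≤ B₂ * Y := by rw [hB₂]; linarith
        _ ≤ _ := by gcongr; linarith
    · right
      refine ⟨hMM, ha, ?_⟩
      -- The remaining case: the contribution of a₁ is negligible, as q₁/z ≤ q₂, and everything is
      -- reduced to a bound for M^{q₂}.
      have e1 : ‖a₁‖ ≤ M ^ (1 / z) := by
        calc ‖a₁‖ = (‖a₁‖ ^ z) ^ (1 / z) := by
              rw [← Real.rpow_mul hna1, mul_one_div_cancel (by linarith), Real.rpow_one]
          _ ≤ _ := Real.rpow_le_rpow (by positivity) ha (by positivity)
      have e2 : δ + ‖a₁‖ ≤ (1 + δ) * M ^ (1 / z) := by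
        have : δ * 1 ≤ δ * M ^ (1 / z) :=
          mul_le_mul_of_nonneg_left (Real.one_le_rpow hM1 (by positivity)) hδ
        linarith
      have e3 : (δ + ‖a₁‖) ^ q₁ ≤ (1 + δ) ^ |pp| * M ^ q₂ := by
        calc (δ + ‖a₁‖) ^ q₁ ≤ ((1 + δ) * M ^ (1 / z)) ^ q₁ :=
              Real.rpow_le_rpow (by positivity) e2 (by linarith)
          _ = (1 + δ) ^ q₁ * M ^ (1 / z * q₁) := by
              rw [Real.mul_rpow (by positivity) (by positivity), ← Real.rpow_mul hM0.le]
          _ ≤ _ := by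
              refine mul_le_mul (Real.rpow_le_rpow_of_exponent_le (by linarith)
                (hq₁'.trans (le_abs_self _))) (Real.rpow_le_rpow_of_exponent_le hM1 ?_)
                (by positivity) (by positivity)
              rw [one_div_mul_eq_div, div_le_iff₀ (by linarith)]; exact hq1z
      calc _ ≤ 2 * ((δ + ‖a₁‖) ^ q₁ + M ^ q₂) := htri
        _ ≤ 2 * ((1 + δ) ^ |pp| * M ^ q₂ + M ^ q₂) := by gcongr
        _ = B₃ * M ^ q₂ := by rw [hB₃]; ring
        _ ≤ _ := by gcongr; linarith

end

/-! ### The strip argument for one large and one comparatively small gradient. -/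

noncomputable section

/-- The absorption of a power that is concentrated on a thin strip by the integrability gain. -/
theorem exists_strip_pointwise (pm pp δ σ z ε : ℝ) (hδ : 0 ≤ δ) (hε : 0 < ε) (hε1 : ε ≤ 1)
    (hσ : IsSmallOscillation pm σ z) :
    ∃ η, 0 < η ∧ ∀ (ω q₂ P M g : ℝ), pm ≤ q₂ → q₂ ≤ pp → P ∈ Icc pm pp → |P - q₂| ≤ 2 * σ →
      1 ≤ M → 1 ≤ |ω| * |Real.log M| → 0 ≤ g →
      M ^ (1 + 2 * σ) * (δ + g) ^ (P - 1) ≤ M ^ (1 + 2 * σ) * (ε * M ^ (q₂ - 1)) +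
        η * (ω ^ 2 * (1 + g ^ (P * z ^ 2))) := by
  have hpm := hσ.one_lt_pm
  have hz := hσ.one_lt
  have hσ0 := hσ.nonneg
  set B : ℝ := (1 / ε) ^ (1 / (pm - 1)) with hB
  have hB0 : 0 < B := by positivity
  have hz1 : 0 < z - 1 := by linarith
  set e := 1 + 2 * σ + (z - 1) with he
  have he0 : 0 < e := by rw [he]; linarith
  set N := (1 + δ) ^ |pp * z ^ 2| with hN
  have hN1 : 1 ≤ N := Real.one_le_rpow (by linarith) (abs_nonneg _)
  refine ⟨4 / (z - 1) ^ 2 * B ^ e * (2 * N), by positivity, ?_⟩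
  rintro ω q₂ P M g hq₂ hq₂' ⟨hP, hP'⟩ hPq hM hlog hg
  have hM0 : 0 < M := by linarith
  have hD0 : 0 ≤ δ + g := by positivity
  -- Either the flux of u is small compared with M^{q₂-1}, which is the first term, or D = δ+g
  -- controls M by M ≤ B D^x and the error term with ω² ≥ 1/log² M takes over.
  rcases le_or_gt ((δ + g) ^ (P - 1)) (ε * M ^ (q₂ - 1)) with h | h
  · have : 0 ≤ 4 / (z - 1) ^ 2 * B ^ e * (2 * N) * (ω ^ 2 * (1 + g ^ (P * z ^ 2))) := by
      positivity
    have h2 := mul_le_mul_of_nonneg_left h (by positivity : 0 ≤ M ^ (1 + 2 * σ))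
    linarith
  have hD : 0 < δ + g := by
    rcases eq_or_lt_of_le hD0 with h0 | h0
    · rw [← h0, Real.zero_rpow (by linarith)] at h
      have : 0 < ε * M ^ (q₂ - 1) := by positivity
      linarith
    · exact h0
  set D := δ + g with hDdef
  have hlog2 : 1 ≤ ω ^ 2 * Real.log M ^ 2 := by
    rw [← sq_abs ω, ← sq_abs (Real.log M), ← mul_pow]
    exact one_le_pow₀ hlog
  have hq21 : 0 < q₂ - 1 := by linarith
  set x := (P - 1) / (q₂ - 1) with hx
  have hx0 : 0 ≤ x := div_nonneg (by linarith) hq21.le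
  have hMB : M ≤ B * D ^ x := by
    have h1 : M ^ (q₂ - 1) ≤ 1 / ε * D ^ (P - 1) := by
      rw [one_div_mul_eq_div, le_div_iff₀ hε, mul_comm]; exact h.le
    calc M = (M ^ (q₂ - 1)) ^ (1 / (q₂ - 1)) := by
          rw [← Real.rpow_mul hM0.le, mul_one_div_cancel hq21.ne', Real.rpow_one]
      _ ≤ (1 / ε * D ^ (P - 1)) ^ (1 / (q₂ - 1)) :=
          Real.rpow_le_rpow (by positivity) h1 (by positivity)
      _ = (1 / ε) ^ (1 / (q₂ - 1)) * D ^ x := by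
          rw [Real.mul_rpow (by positivity) (by positivity), ← Real.rpow_mul hD.le, mul_one_div]
      _ ≤ _ := by
          refine mul_le_mul_of_nonneg_right ?_ (by positivity)
          refine Real.rpow_le_rpow_of_exponent_le ((one_le_div hε).2 hε1) ?_
          exact one_div_le_one_div_of_le (by linarith) (by linarith)
  have hxle : x ≤ 1 + 2 * σ / (pm - 1) := hσ.div_le hq₂ hPq
  -- Since P-1 = x(q₂-1), the total exponent is x(q₂+2σ+z-1). The bracket is at most P(1+4σ)z, and
  -- the smallness condition bounds x(1+4σ) by z.
  have hy : x * e + (P - 1) ≤ P * z ^ 2 := by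
    have e1 : x * e + (P - 1) = x * (q₂ + 2 * σ + (z - 1)) := by
      have : P - 1 = x * (q₂ - 1) := by rw [hx]; field_simp
      rw [this, he]; ring
    have hPq' := abs_le.1 hPq
    have e2 : q₂ + 2 * σ + (z - 1) ≤ P * ((1 + 4 * σ) * z) := by
      have f1 : 0 ≤ σ * (P - 1) := mul_nonneg hσ0 (by linarith)
      have f2 : 0 ≤ (z - 1) * (P - 1) := mul_nonneg hz1.le (by linarith)
      have f3 : 0 ≤ P * (σ * (z - 1)) := by
        have : 0 < P := by linarith
        positivity
      nlinarith
    have e3 : 2 * σ / (pm - 1) ≤ 4 * σ / (pm - 1) :=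
      div_le_div_of_nonneg_right (by linarith) (by linarith)
    have hPz : 0 ≤ P * z := mul_nonneg (by linarith) (by linarith)
    rw [e1]
    calc x * (q₂ + 2 * σ + (z - 1)) ≤ (1 + 4 * σ / (pm - 1)) * (P * ((1 + 4 * σ) * z)) :=
          mul_le_mul (by linarith) e2 (by linarith) (by linarith)
      _ = P * z * ((1 + 4 * σ) * (1 + 4 * σ / (pm - 1))) := by ring
      _ ≤ P * z * z := mul_le_mul_of_nonneg_left hσ.le hPz
      _ = _ := by ring
  have hy0 : 0 ≤ x * e + (P - 1) := by
    have : 0 ≤ x * e := by positivity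
    linarith
  have hDy : D ^ (x * e + (P - 1)) ≤ 1 + D ^ (P * z ^ 2) := by
    have : 0 ≤ D ^ (P * z ^ 2) := by positivity
    rcases le_total D 1 with hD1 | hD1
    · have := Real.rpow_le_one hD.le hD1 hy0
      linarith
    · have := Real.rpow_le_rpow_of_exponent_le hD1 hy
      linarith
  have hDg : D ^ (P * z ^ 2) ≤ N * (1 + g ^ (P * z ^ 2)) :=
    add_rpow_le_mul hδ hg (mul_nonneg (by linarith) (sq_nonneg z))
      ((mul_le_mul_of_nonneg_right hP' (sq_nonneg z)).trans (le_abs_self _))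
  have hgg : 0 ≤ g ^ (P * z ^ 2) := by positivity
  have hone : 1 ≤ N * (1 + g ^ (P * z ^ 2)) := by
    calc (1:ℝ) = 1 * 1 := (one_mul 1).symm
      _ ≤ _ := mul_le_mul hN1 (by linarith) zero_le_one (by linarith)
  have hmain : M ^ (1 + 2 * σ) * D ^ (P - 1) ≤
      4 / (z - 1) ^ 2 * B ^ e * (2 * N) * (ω ^ 2 * (1 + g ^ (P * z ^ 2))) := by
    calc M ^ (1 + 2 * σ) * D ^ (P - 1)
        ≤ ω ^ 2 * Real.log M ^ 2 * (M ^ (1 + 2 * σ) * D ^ (P - 1)) :=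
          le_mul_of_one_le_left (by positivity) hlog2
      _ ≤ ω ^ 2 * (4 / (z - 1) ^ 2 * M ^ (z - 1)) * (M ^ (1 + 2 * σ) * D ^ (P - 1)) := by
          gcongr; exact log_sq_le_of_one_le hM hz1
      _ = 4 / (z - 1) ^ 2 * ω ^ 2 * (M ^ e * D ^ (P - 1)) := by
          rw [he, Real.rpow_add hM0 (1 + 2 * σ)]; ring
      _ ≤ 4 / (z - 1) ^ 2 * ω ^ 2 * ((B * D ^ x) ^ e * D ^ (P - 1)) := by gcongr
      _ = 4 / (z - 1) ^ 2 * B ^ e * ω ^ 2 * D ^ (x * e + (P - 1)) := by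
          rw [Real.mul_rpow hB0.le (by positivity), ← Real.rpow_mul hD.le, Real.rpow_add hD]; ring
      _ ≤ 4 / (z - 1) ^ 2 * B ^ e * ω ^ 2 * (2 * (N * (1 + g ^ (P * z ^ 2)))) := by
          gcongr; linarith
      _ = _ := by ring
  have : 0 ≤ M ^ (1 + 2 * σ) * (ε * M ^ (q₂ - 1)) := by positivity
  linarith

variable {d : ℕ}

/-- The estimate that results from test functions which are supported, on the side of the
gradient `a₁`, in a strip of width proportional to `1 / m`. -/
def StripBound (pm pp δ σ z C₀ q₀ q₁ q₂ : ℝ) (a₁ a₂ ν : Rd d) (Y : ℝ) : Prop :=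
  ∀ m r κ η : ℝ, 1 ≤ m → 0 ≤ r → 0 ≤ κ → 0 ≤ η →
    (∀ P g : ℝ, P ∈ Icc pm pp → |P - q₂| ≤ 2 * σ → 0 ≤ g →
      m * r * (δ + g) ^ (P - 1) ≤
        m * r * κ + η * ((q₁ - q₀) ^ 2 * (1 + g ^ (P * z ^ 2)))) →
    |inner ℝ (opA δ q₂ a₂) ν| * r ≤ C₀ * (Y + shiftPow (δ + ‖a₂‖) q₂ r +
      shiftPow (δ + ‖a₁‖) q₁ r / m + r * κ + η * Y)

/-- This threshold guarantees M-δ-3‖a₁‖ ≥ M/2 once ‖a₁‖ ≤ M^{1/z}, which is what the lower bound for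
the normal component of a₂ requires. -/
theorem exists_add_mul_rpow_le (δ z : ℝ) (hz : 1 < z) :
    ∃ M₀, 1 ≤ M₀ ∧ ∀ M, M₀ ≤ M → δ + 3 * M ^ (1 / z) ≤ M / 2 := by
  have h1 : Tendsto (fun M : ℝ => M ^ (1 - 1 / z)) atTop atTop :=
    tendsto_rpow_atTop (by rw [sub_pos, div_lt_one (by linarith)]; exact hz)
  obtain ⟨N, hN⟩ := eventually_atTop.1
    ((h1.eventually_ge_atTop 12).and (eventually_ge_atTop (max 1 (4 * δ))))
  refine ⟨max N 1, le_max_right _ _, fun M hM => ?_⟩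
  obtain ⟨h2, h3⟩ := hN M ((le_max_left _ _).trans hM)
  have hM1 : 1 ≤ M := (le_max_left _ _).trans h3
  have hMδ : 4 * δ ≤ M := (le_max_right _ _).trans h3
  have hM0 : 0 < M := by linarith
  have h4 : M = M ^ (1 - 1 / z) * M ^ (1 / z) := by
    rw [← Real.rpow_add hM0]; simp
  have h5 : 12 * M ^ (1 / z) ≤ M := by
    calc 12 * M ^ (1 / z) ≤ M ^ (1 - 1 / z) * M ^ (1 / z) := by gcongr
      _ = M := h4.symm
  linarith

/-- As ‖a₁‖ is only of order M^{1/z} and a₁-a₂ is normal, the normal component of a₂ is at least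
M/2, hence that of its flux is at least c M^{q₂-1}. The strip bound with r of order M then reads
M^{q₂} ≤ C Y plus three small multiples of M^{q₂}, which are absorbed. -/
theorem exists_jump_le_of_strip (pm pp δ σ z C₀ : ℝ) (hδ : 0 ≤ δ) (hC₀ : 0 < C₀)
    (hσ : IsSmallOscillation pm σ z) :
    ∃ C M₀, 0 < C ∧ 1 ≤ M₀ ∧ ∀ (q₀ q₁ q₂ : ℝ) (a₁ a₂ ν : Rd d) (τ Y : ℝ),
      q₁ ∈ Icc pm pp → q₂ ∈ Icc pm pp → |q₁ - q₂| ≤ 2 * σ → ‖ν‖ = 1 → a₁ - a₂ = τ • ν →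
      0 ≤ Y → 1 ≤ |q₁ - q₀| * |Real.log (δ + ‖a₁‖ + ‖a₂‖)| → M₀ ≤ δ + ‖a₁‖ + ‖a₂‖ →
      ‖a₁‖ ^ z ≤ δ + ‖a₁‖ + ‖a₂‖ → StripBound pm pp δ σ z C₀ q₀ q₁ q₂ a₁ a₂ ν Y →
      (δ + ‖a₁‖ + ‖a₂‖) ^ q₂ ≤ C * Y := by
  have hpm := hσ.one_lt_pm
  have hz := hσ.one_lt
  have hσ0 := hσ.nonneg
  obtain ⟨M₀, hM₀, hM₀'⟩ := exists_add_mul_rpow_le δ z hz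
  set K : ℝ := 2 ^ |pp| with hK
  have hK1 : 1 ≤ K := Real.one_le_rpow (by norm_num) (abs_nonneg _)
  have hK0 : 0 < K := by linarith
  set c : ℝ := 1 / (2 * K) with hc
  have hc0 : 0 < c := by positivity
  set θ := min pm 2 - 1 with hθ
  have hθ0 : 0 < θ := by rw [hθ, sub_pos]; exact lt_min hpm (by norm_num)
  have hθ1 : θ ≤ 1 := by have := min_le_right pm 2; linarith
  have hθpm : 1 + θ ≤ pm := by have := min_le_left pm 2; linarith
  -- The parameters are fixed in the order l, m₀, ε, where m₀ depends on l; each makes one term at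
  -- most c l M^{q₂}/8, so that 3/8 of the left-hand side is absorbed in total.
  obtain ⟨l, hl0, hl1, hl⟩ := exists_mul_rpow_le_half (4 * C₀ * K / c) θ hθ0
  set m₀ : ℝ := max 1 (8 * C₀ * K / (c * l)) with hm₀
  have hm₀1 : 1 ≤ m₀ := le_max_left _ _
  have hm₀0 : 0 < m₀ := by linarith
  set ε : ℝ := min 1 (c / (8 * C₀)) with hε
  have hε0 : 0 < ε := by positivity
  obtain ⟨η, hη, hstrip⟩ := exists_strip_pointwise pm pp δ σ z ε hδ hε0 (min_le_left _ _) hσ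
  have hlC : C₀ * K * l ^ θ ≤ c / 8 := by
    have : C₀ * K * l ^ θ = c / 4 * (4 * C₀ * K / c * l ^ θ) := by field_simp
    rw [this]
    calc c / 4 * (4 * C₀ * K / c * l ^ θ) ≤ c / 4 * (1 / 2) := by gcongr
      _ = _ := by ring
  have hmC : C₀ * K / m₀ ≤ c * l / 8 := by
    rw [div_le_iff₀ hm₀0]
    have : 8 * C₀ * K / (c * l) ≤ m₀ := le_max_right _ _
    rw [div_le_iff₀ (by positivity)] at this
    linarith
  have hεC : C₀ * ε ≤ c / 8 := by
    have : ε ≤ c / (8 * C₀) := min_le_right _ _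
    rw [le_div_iff₀ (by positivity)] at this
    linarith
  clear_value ε c
  refine ⟨2 / (c * l) * (C₀ * (1 + m₀ * l * η)), M₀, by positivity, hM₀, ?_⟩
  rintro q₀ q₁ q₂ a₁ a₂ ν τ Y ⟨hq₁, hq₁'⟩ ⟨hq₂, hq₂'⟩ h12 hν haτ hY hlog hMM ha hS
  set M := δ + ‖a₁‖ + ‖a₂‖ with hM
  have hna1 := norm_nonneg a₁
  have hna2 := norm_nonneg a₂
  have hM1 : 1 ≤ M := hM₀.trans hMM
  have hM0 : 0 < M := by linarith
  have hM3 := hM₀' M hMM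
  have ha1 : ‖a₁‖ ≤ M ^ (1 / z) := by
    calc ‖a₁‖ = (‖a₁‖ ^ z) ^ (1 / z) := by
          rw [← Real.rpow_mul hna1, mul_one_div_cancel (by linarith), Real.rpow_one]
      _ ≤ _ := Real.rpow_le_rpow (by positivity) ha (by positivity)
  have hq2abs : |q₂ - 2| ≤ |pp| := by
    rw [abs_of_nonneg (by linarith : 0 ≤ pp)]
    exact abs_le.2 ⟨by linarith, by linarith⟩
  have hq1abs : |q₁ - 2| ≤ |pp| := by
    rw [abs_of_nonneg (by linarith : 0 ≤ pp)]
    exact abs_le.2 ⟨by linarith, by linarith⟩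
  have hlower : c * M ^ (q₂ - 1) ≤ |inner ℝ (opA δ q₂ a₂) ν| := by
    have e1 : ‖a₁ - a₂‖ = |τ| := by rw [haτ, norm_smul, hν, mul_one, Real.norm_eq_abs]
    have e2 : ‖a₂‖ ≤ ‖a₁‖ + |τ| := by
      rw [← e1]; simpa [norm_sub_rev] using norm_add_le a₁ (a₂ - a₁)
    have e3 : inner ℝ a₂ ν = inner ℝ a₁ ν - τ := by
      have : a₂ = a₁ - τ • ν := by rw [← haτ]; abel
      rw [this, inner_sub_left, real_inner_smul_left, real_inner_self_eq_norm_sq, hν]; ring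
    have e4 : |inner ℝ a₁ ν| ≤ ‖a₁‖ := by
      simpa [hν] using abs_real_inner_le_norm a₁ ν
    -- The normal component of a₂ differs from τ by at most ‖a₁‖, and |τ| ≥ ‖a₂‖-‖a₁‖ = M-δ-2‖a₁‖.
    have e5 : M / 2 ≤ |inner ℝ a₂ ν| := by
      have : |τ| - |inner ℝ a₁ ν| ≤ |inner ℝ a₂ ν| := by
        rw [e3, abs_sub_comm]; exact abs_sub_abs_le_abs_sub _ _
      linarith
    have e6 : M ^ (q₂ - 2) ≤ K * (δ + ‖a₂‖) ^ (q₂ - 2) :=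
      rpow_le_of_le_two_mul hM0 (by linarith) (by linarith) (by linarith) hq2abs
    have e7 : M ^ (q₂ - 1) = M ^ (q₂ - 2) * M := by
      rw [← Real.rpow_add_one hM0.ne']; ring_nf
    rw [opA, real_inner_smul_left, abs_mul, abs_of_nonneg (by positivity)]
    calc c * M ^ (q₂ - 1) = c * 2 * M ^ (q₂ - 2) * (M / 2) := by rw [e7]; ring
      _ ≤ c * 2 * (K * (δ + ‖a₂‖) ^ (q₂ - 2)) * (M / 2) := by gcongr
      _ = (c * (2 * K)) * ((δ + ‖a₂‖) ^ (q₂ - 2) * (M / 2)) := by ring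
      _ = (δ + ‖a₂‖) ^ (q₂ - 2) * (M / 2) := by
          rw [hc, one_div_mul_cancel (by positivity), one_mul]
      _ ≤ _ := by gcongr
  have hMq2 : M ^ (q₂ - 1) * M = M ^ q₂ := by
    rw [← Real.rpow_add_one hM0.ne']; ring_nf
  have hpow : ∀ q, |q - 2| ≤ |pp| → ∀ a, 0 ≤ a → a ≤ M → shiftPow a q M ≤ K * M ^ q := by
    intro q hq a ha0 haM
    have e1 : (a + M) ^ (q - 2) ≤ K * M ^ (q - 2) :=
      rpow_le_of_le_two_mul (by linarith) hM0 (by linarith) (by linarith) hq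
    calc shiftPow a q M ≤ K * M ^ (q - 2) * M ^ 2 := by unfold shiftPow; gcongr
      _ = K * M ^ q := by
        rw [mul_assoc, ← Real.rpow_natCast, ← Real.rpow_add hM0]; norm_num
  set r := l * M with hr
  have hr0 : 0 ≤ r := by positivity
  have hS2 : shiftPow (δ + ‖a₂‖) q₂ r ≤ l * l ^ θ * (K * M ^ q₂) := by
    calc shiftPow (δ + ‖a₂‖) q₂ r ≤ l ^ (1 + θ) * shiftPow (δ + ‖a₂‖) q₂ M :=
          shiftPow_scale (by positivity) hM0.le hl0 hl1 hθ1 (by linarith)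
      _ ≤ l ^ (1 + θ) * (K * M ^ q₂) := by
          gcongr; exact hpow q₂ hq2abs _ (by positivity) (by linarith)
      _ = _ := by rw [add_comm 1 θ, Real.rpow_add_one hl0.ne', mul_comm l]
  -- The factor M^{2σ} compensates q₁ ≠ q₂: the term with exponent q₁ is at most a multiple of
  -- M^{q₂+2σ} and is divided by m.
  set m := m₀ * M ^ (2 * σ) with hm
  have hMσ : 1 ≤ M ^ (2 * σ) := Real.one_le_rpow hM1 (by linarith)
  have hm1 : 1 ≤ m := by
    calc (1:ℝ) = 1 * 1 := (one_mul 1).symm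
      _ ≤ _ := mul_le_mul hm₀1 hMσ zero_le_one (by linarith)
  have hS1 : shiftPow (δ + ‖a₁‖) q₁ r / m ≤ K / m₀ * M ^ q₂ := by
    have e1 : shiftPow (δ + ‖a₁‖) q₁ r ≤ K * M ^ q₁ :=
      (shiftPow_mono (by linarith) (by positivity) hr0
        (mul_le_of_le_one_left hM0.le hl1)).trans
        (hpow q₁ hq1abs _ (by positivity) (by linarith))
    have e2 : M ^ q₁ ≤ M ^ q₂ * M ^ (2 * σ) := by
      rw [← Real.rpow_add hM0]
      exact Real.rpow_le_rpow_of_exponent_le hM1 (by linarith [(abs_le.1 h12).2])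
    rw [div_le_iff₀ (by linarith), hm]
    calc shiftPow (δ + ‖a₁‖) q₁ r ≤ K * (M ^ q₂ * M ^ (2 * σ)) := e1.trans (by gcongr)
      _ = _ := by field_simp
  have hmr : m * r = m₀ * l * M ^ (1 + 2 * σ) := by
    rw [hm, hr, Real.rpow_add hM0, Real.rpow_one]; ring
  have hfin := hS m r (ε * M ^ (q₂ - 1)) (m₀ * l * η) hm1 hr0 (by positivity) (by positivity) (by
    intro P g hP hPq hg
    rw [hmr]
    have := mul_le_mul_of_nonneg_left (hstrip (q₁ - q₀) q₂ P M g hq₂ hq₂' hP hPq hM1 hlog hg)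
      (by positivity : 0 ≤ m₀ * l)
    linarith)
  have hrκ : r * (ε * M ^ (q₂ - 1)) = l * ε * M ^ q₂ := by rw [hr, ← hMq2]; ring
  rw [hrκ] at hfin
  have hX : 0 ≤ M ^ q₂ := by positivity
  have hleft : c * l * M ^ q₂ ≤ |inner ℝ (opA δ q₂ a₂) ν| * r := by
    calc c * l * M ^ q₂ = c * M ^ (q₂ - 1) * r := by rw [hr, ← hMq2]; ring
      _ ≤ _ := by gcongr
  have g1 : C₀ * (l * l ^ θ * (K * M ^ q₂)) ≤ c / 8 * (l * M ^ q₂) := by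
    calc _ = (C₀ * K * l ^ θ) * (l * M ^ q₂) := by ring
      _ ≤ _ := by gcongr
  have g2 : C₀ * (K / m₀ * M ^ q₂) ≤ c * l / 8 * M ^ q₂ := by
    calc _ = (C₀ * K / m₀) * M ^ q₂ := by ring
      _ ≤ _ := by gcongr
  have g3 : C₀ * (l * ε * M ^ q₂) ≤ c / 8 * (l * M ^ q₂) := by
    calc _ = (C₀ * ε) * (l * M ^ q₂) := by ring
      _ ≤ _ := by gcongr
  have g4 := mul_le_mul_of_nonneg_left hS2 hC₀.le
  have g5 := mul_le_mul_of_nonneg_left hS1 hC₀.le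
  have g6 : c * l * M ^ q₂ ≤ 2 * (C₀ * (1 + m₀ * l * η)) * Y := by
    have : 0 ≤ c * l * M ^ q₂ := by positivity
    linarith
  calc M ^ q₂ = c * l * M ^ q₂ / (c * l) := by field_simp
    _ ≤ 2 * (C₀ * (1 + m₀ * l * η)) * Y / (c * l) := by gcongr
    _ = _ := by ring

/-- The algebraic part of the jump estimate. -/
theorem exists_jump_le (pm pp δ σ z C₀ : ℝ) (hδ : 0 ≤ δ) (hC₀ : 0 < C₀)
    (hσ : IsSmallOscillation pm σ z) :
    ∃ C, 0 < C ∧ ∀ (q₀ q₁ q₂ : ℝ) (a₁ a₂ ν : Rd d) (τ Y : ℝ),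
      q₀ ∈ Icc pm pp → q₁ ∈ Icc pm pp → q₂ ∈ Icc pm pp →
      |q₁ - q₀| ≤ 2 * σ → |q₂ - q₀| ≤ 2 * σ → |q₁ - q₂| ≤ 2 * σ →
      ‖ν‖ = 1 → a₁ - a₂ = τ • ν → 0 ≤ Y →
      (q₁ - q₀) ^ 2 * (1 + ‖a₁‖ ^ (q₁ * z ^ 2)) ≤ C₀ * Y →
      (q₂ - q₀) ^ 2 * (1 + ‖a₂‖ ^ (q₂ * z ^ 2)) ≤ C₀ * Y →
      (∀ r, 0 ≤ r → |inner ℝ (opA δ q₁ a₁ - opA δ q₂ a₂) ν| * r ≤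
        C₀ * (Y + shiftPow (δ + ‖a₁‖) q₁ r + shiftPow (δ + ‖a₂‖) q₂ r)) →
      StripBound pm pp δ σ z C₀ q₀ q₁ q₂ a₁ a₂ ν Y →
      StripBound pm pp δ σ z C₀ q₀ q₂ q₁ a₂ a₁ ν Y →
      ‖opF δ q₁ a₁ - opF δ q₂ a₂‖ ^ 2 ≤ C * Y := by
  obtain ⟨C₁, hC₁, h1⟩ := exists_jump_le_of_comparable (d := d) pm pp δ σ z C₀ hδ hC₀ hσ
  obtain ⟨C₂, M₀, hC₂, hM₀, h2⟩ := exists_jump_le_of_strip (d := d) pm pp δ σ z C₀ hδ hC₀ hσ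
  obtain ⟨C₃, hC₃, h3⟩ := exists_jump_le_of_log (d := d) pm pp δ σ z C₀ M₀ hδ hC₀ hM₀ hσ
  refine ⟨C₁ + C₃ + C₃ * C₂, by positivity, ?_⟩
  intro q₀ q₁ q₂ a₁ a₂ ν τ Y hq₀ hq₁ hq₂ h10 h20 h12 hν haτ hY hY1 hY2 hJ hS1 hS2
  have hone : ∀ (q₁ q₂ : ℝ) (a₁ a₂ : Rd d) (τ : ℝ), q₁ ∈ Icc pm pp → q₂ ∈ Icc pm pp →
      |q₁ - q₂| ≤ 2 * σ → a₁ - a₂ = τ • ν →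
      (q₁ - q₀) ^ 2 * (1 + ‖a₁‖ ^ (q₁ * z ^ 2)) ≤ C₀ * Y →
      StripBound pm pp δ σ z C₀ q₀ q₁ q₂ a₁ a₂ ν Y →
      1 ≤ |q₁ - q₀| * |Real.log (δ + ‖a₁‖ + ‖a₂‖)| →
      ‖opF δ q₁ a₁ - opF δ q₂ a₂‖ ^ 2 ≤ (C₁ + C₃ + C₃ * C₂) * Y := by
    intro q₁ q₂ a₁ a₂ τ hq₁ hq₂ h12 haτ hY1 hS hlog
    rcases h3 q₀ q₁ q₂ a₁ a₂ Y hq₁ hq₂ h12 hY hY1 hlog with h | ⟨hM, ha, h⟩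
    · refine h.trans (mul_le_mul_of_nonneg_right ?_ hY)
      have : 0 ≤ C₃ * C₂ := by positivity
      linarith
    · have h4 := h2 q₀ q₁ q₂ a₁ a₂ ν τ Y hq₁ hq₂ h12 hν haτ hY hlog hM ha hS
      calc _ ≤ C₃ * (C₂ * Y) := h.trans (mul_le_mul_of_nonneg_left h4 hC₃.le)
        _ = C₃ * C₂ * Y := by ring
        _ ≤ _ := mul_le_mul_of_nonneg_right (by linarith) hY
  -- If one of the exponents is not comparable with q₀, the estimate for that side is used, with the
  -- roles of the elements exchanged if necessary; if both are comparable, monotonicity suffices.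
  rcases le_total 1 (|q₁ - q₀| * |Real.log (δ + ‖a₁‖ + ‖a₂‖)|) with hl1 | hl1
  · exact hone q₁ q₂ a₁ a₂ τ hq₁ hq₂ h12 haτ hY1 hS1 hl1
  rcases le_total 1 (|q₂ - q₀| * |Real.log (δ + ‖a₁‖ + ‖a₂‖)|) with hl2 | hl2
  · rw [norm_sub_rev]
    refine hone q₂ q₁ a₂ a₁ (-τ) hq₂ hq₁ (by rwa [abs_sub_comm]) ?_ hY2 hS2 ?_
    · rw [neg_smul, ← haτ, neg_sub]
    · rwa [add_right_comm]
  · refine (h1 q₀ q₁ q₂ a₁ a₂ ν τ Y hq₀ hq₁ hq₂ h10 h20 hν haτ hY hY1 hY2 hl1 hl2 hJ).trans ?_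
    refine mul_le_mul_of_nonneg_right ?_ hY
    have : 0 ≤ C₃ * C₂ := by positivity
    linarith

end

/-! ### Geometry of simplices and their facets. -/

noncomputable section

variable {d : ℕ}

/-- `lam z` are the barycentric coordinates of the simplex with vertex set `t`, and `n z` their
gradients. -/
structure IsBaryCoords (t : Finset (Rd d)) (lam : Rd d → Rd d → ℝ) (n : Rd d → Rd d) : Prop where
  eq_add : ∀ z ∈ t, ∀ x y, lam z x = lam z y + inner ℝ (n z) (x - y)
  self : ∀ z ∈ t, lam z z = 1
  ne : ∀ z ∈ t, ∀ w ∈ t, z ≠ w → lam z w = 0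
  sum_eq : ∀ x, ∑ z ∈ t, lam z x = 1
  sum_smul : ∀ x, ∑ z ∈ t, lam z x • z = x
  mem_simplex : ∀ x, x ∈ simplex t ↔ ∀ z ∈ t, 0 ≤ lam z x
  mem_interior : ∀ x, x ∈ interior (simplex t) ↔ ∀ z ∈ t, 0 < lam z x

theorem exists_isBaryCoords {t : Finset (Rd d)} (ht : AffineIndependent ℝ ((↑) : t → Rd d))
    (hcard : t.card = d + 1) : ∃ lam n, IsBaryCoords t lam n := by
  classical
  have hspan : affineSpan ℝ (range ((↑) : t → Rd d)) = ⊤ := by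
    rw [ht.affineSpan_eq_top_iff_card_eq_finrank_add_one]
    simp [hcard]
  let b : AffineBasis t ℝ (Rd d) := ⟨(↑), ht, hspan⟩
  have hb : ∀ i, b i = i := fun i => rfl
  have hrange : range b = (t : Set (Rd d)) := by ext; simp [hb]
  refine ⟨fun z x => if h : z ∈ t then b.coord ⟨z, h⟩ x else 0,
    fun z => if h : z ∈ t then (InnerProductSpace.toDual ℝ (Rd d)).symm
      (LinearMap.toContinuousLinearMap (b.coord ⟨z, h⟩).linear) else 0, ?_, ?_, ?_, ?_, ?_, ?_, ?_⟩
  · intro z hz x y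
    simp only [hz, dif_pos, InnerProductSpace.toDual_symm_apply]
    have := (b.coord ⟨z, hz⟩).map_vadd y (x - y)
    simp only [vadd_eq_add, sub_add_cancel] at this
    rw [this, add_comm]; rfl
  · intro z hz
    simp only [hz, dif_pos]
    exact b.coord_apply_eq ⟨z, hz⟩
  · intro z hz w hw hzw
    simp only [hz, dif_pos]
    exact b.coord_apply_ne (i := ⟨z, hz⟩) (j := ⟨w, hw⟩) (by simpa using hzw)
  · intro x
    rw [← b.sum_coord_apply_eq_one x, ← Finset.sum_attach]
    refine Finset.sum_congr rfl fun z _ => ?_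
    simp
  · intro x
    conv_rhs => rw [← b.linear_combination_coord_eq_self x]
    rw [← Finset.sum_attach]
    refine Finset.sum_congr rfl fun z _ => ?_
    simp [hb]
  · intro x
    rw [simplex, ← hrange, b.convexHull_eq_nonneg_coord]
    constructor
    · intro h z hz
      simpa only [hz, dif_pos] using h ⟨z, hz⟩
    · intro h z
      simpa only [z.2, dif_pos] using h z z.2
  · intro x
    rw [simplex, ← hrange, b.interior_convexHull]
    constructor
    · intro h z hz
      simpa only [hz, dif_pos] using h ⟨z, hz⟩
    · intro h z
      simpa only [z.2, dif_pos] using h z z.2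

theorem isCompact_simplex (t : Finset (Rd d)) : IsCompact (simplex t) :=
  t.finite_toSet.isCompact_convexHull ℝ

theorem convex_simplex (t : Finset (Rd d)) : Convex ℝ (simplex t) := convex_convexHull ℝ _

theorem mem_simplex_of_mem {t : Finset (Rd d)} {z : Rd d} (hz : z ∈ t) : z ∈ simplex t :=
  subset_convexHull ℝ _ hz

theorem dist_le_diam_simplex {t : Finset (Rd d)} {x y : Rd d} (hx : x ∈ simplex t)
    (hy : y ∈ simplex t) : dist x y ≤ Metric.diam (simplex t) :=
  Metric.dist_le_diam_of_mem (isCompact_simplex t).isBounded hx hy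

namespace IsBaryCoords

variable {t : Finset (Rd d)} {lam : Rd d → Rd d → ℝ} {n : Rd d → Rd d}

theorem le_one (h : IsBaryCoords t lam n) {x z : Rd d} (hx : x ∈ simplex t) (hz : z ∈ t) :
    lam z x ≤ 1 := by
  rw [← h.sum_eq x]
  exact Finset.single_le_sum (f := fun w => lam w x) (fun w hw => (h.mem_simplex x).1 hx w hw) hz

/-- Moving by s < r from the centre in the direction of n z raises the coordinate by s‖n z‖, but
coordinates stay in [0,1] on the simplex. -/
theorem norm_mul_le (h : IsBaryCoords t lam n) {x₀ z : Rd d} {r : ℝ} (hr : 0 < r)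
    (hball : Metric.ball x₀ r ⊆ simplex t) (hz : z ∈ t) : ‖n z‖ * r ≤ 1 := by
  rcases eq_or_lt_of_le (norm_nonneg (n z)) with h0 | h0
  · rw [← h0]; simp
  by_contra! hlt
  obtain ⟨s, hs1, hs2⟩ := exists_between ((div_lt_iff₀' h0).2 hlt)
  have hs0 : 0 < s := lt_trans (by positivity) hs1
  set x := x₀ + (s / ‖n z‖) • n z with hx
  have hxball : x ∈ Metric.ball x₀ r := by
    rw [Metric.mem_ball, hx, dist_self_add_left, norm_smul, Real.norm_of_nonneg (by positivity),
      div_mul_cancel₀ _ h0.ne']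
    exact hs2
  have h1 := h.le_one (hball hxball) hz
  have h2 := (h.mem_simplex x₀).1 (hball (Metric.mem_ball_self hr)) z hz
  rw [h.eq_add z hz x x₀, hx, add_sub_cancel_left, real_inner_smul_right,
    real_inner_self_eq_norm_sq] at h1
  have h3 : s / ‖n z‖ * ‖n z‖ ^ 2 = s * ‖n z‖ := by field_simp
  rw [h3] at h1
  rw [div_lt_iff₀ h0] at hs1
  linarith

theorem barycentre_eq (h : IsBaryCoords t lam n) (hcard : t.card = d + 1) {z : Rd d}
    (hz : z ∈ t) : lam z (barycentre t) = ((d : ℝ) + 1)⁻¹ := by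
  have h1 : ∀ w, lam z w = lam z z + inner ℝ (n z) (w - z) := fun w => h.eq_add z hz w z
  have hc : (t.card : ℝ) = d + 1 := by rw [hcard]; push_cast; ring
  have hc0 : (t.card : ℝ) ≠ 0 := by rw [hc]; positivity
  have h2 : barycentre t - z = (t.card : ℝ)⁻¹ • ∑ w ∈ t, (w - z) := by
    rw [barycentre, Finset.sum_sub_distrib, Finset.sum_const, smul_sub, ← Nat.cast_smul_eq_nsmul ℝ,
      inv_smul_smul₀ hc0]
  have h3 : ∑ w ∈ t, lam z w = 1 := by
    rw [Finset.sum_eq_single z (fun w hw hne => h.ne z hz w hw hne.symm) (fun hn => absurd hz hn),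
      h.self z hz]
  rw [h1, h2, real_inner_smul_right, inner_sum]
  have h4 : ∑ w ∈ t, inner ℝ (n z) (w - z) = ∑ w ∈ t, (lam z w - 1) :=
    Finset.sum_congr rfl fun w _ => by rw [h1 w, h.self z hz]; ring
  rw [h4, Finset.sum_sub_distrib, h3, Finset.sum_const, h.self z hz, nsmul_eq_mul, mul_one, mul_sub,
    inv_mul_cancel₀ hc0, hc]
  ring

theorem barycentre_mem_interior (h : IsBaryCoords t lam n) (hcard : t.card = d + 1) :
    barycentre t ∈ interior (simplex t) := by
  rw [h.mem_interior]
  intro z hz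
  rw [h.barycentre_eq hcard hz]
  positivity

/-- A vector that is orthogonal to the facet opposite to `z` is a multiple of `n z`. -/
theorem exists_eq_smul (h : IsBaryCoords t lam n) {z : Rd d} (hz : z ∈ t) {m y₀ : Rd d}
    (hm : ∀ w ∈ t, w ≠ z → inner ℝ m (w - y₀) = 0) (hy : lam z y₀ = 0) :
    m = (inner ℝ m (z - y₀) : ℝ) • n z := by
  classical
  refine ext_inner_right ℝ fun x => ?_
  have h1 : x = ∑ w ∈ t, lam w (y₀ + x) • (w - y₀) := by
    simp_rw [smul_sub]
    rw [Finset.sum_sub_distrib, h.sum_smul, ← Finset.sum_smul, h.sum_eq]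
    simp
  have h2 : inner ℝ m x = lam z (y₀ + x) * inner ℝ m (z - y₀) := by
    conv_lhs => rw [h1]
    rw [inner_sum, Finset.sum_eq_single z]
    · rw [real_inner_smul_right]
    · intro w hw hne
      rw [real_inner_smul_right, hm w hw hne, mul_zero]
    · exact fun hn => absurd hz hn
  rw [h2, h.eq_add z hz (y₀ + x) y₀, hy, add_sub_cancel_left, real_inner_smul_left]
  ring

end IsBaryCoords

/-- The barycentre is an interior point, so near it v coincides with the affine function and the
full gradient is the elementwise one. -/
theorem gradOn_eq {t : Finset (Rd d)} {lam : Rd d → Rd d → ℝ} {n : Rd d → Rd d}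
    (h : IsBaryCoords t lam n) (hcard : t.card = d + 1) {v : Rd d → ℝ} {g : Rd d} {b : ℝ}
    (hv : ∀ x ∈ simplex t, v x = inner ℝ g x + b) : gradOn v t = g := by
  have h1 : v =ᶠ[𝓝 (barycentre t)] fun x => inner ℝ g x + b := by
    filter_upwards [mem_interior_iff_mem_nhds.1 (h.barycentre_mem_interior hcard)] with x hx
      using hv x hx
  have h2 : HasGradientAt (fun x : Rd d => inner ℝ g x + b) g (barycentre t) := by
    rw [hasGradientAt_iff_hasFDerivAt]
    exact ((InnerProductSpace.toDual ℝ (Rd d) g).hasFDerivAt).add_const b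
  rw [gradOn, h1.gradient.eq_of_nhds, h2.gradient]

/-- A ball of radius larger than half the supremum avoids the question of attainment; this is the
origin of the factor 2 in front of ω₀. -/
theorem inradius_spec {t : Finset (Rd d)} (hd : 1 ≤ d) (ht : AffineIndependent ℝ ((↑) : t → Rd d))
    (hcard : t.card = d + 1) {ω₀ : ℝ} (hω : Metric.diam (simplex t) / inradius (simplex t) ≤ ω₀) :
    ∃ x₀ r, 0 < r ∧ Metric.ball x₀ r ⊆ simplex t ∧ Metric.diam (simplex t) ≤ 2 * ω₀ * r ∧
      r ≤ Metric.diam (simplex t) := by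
  obtain ⟨lam, n, h⟩ := exists_isBaryCoords ht hcard
  have : Nontrivial (Rd d) := by
    have : Nonempty (Fin d) := ⟨⟨0, hd⟩⟩
    infer_instance
  have hle : ∀ x r, 0 < r → Metric.ball x r ⊆ simplex t → r ≤ Metric.diam (simplex t) := by
    intro x r hr hball
    obtain ⟨e, he⟩ := exists_norm_eq (Rd d) zero_le_one
    refine le_of_forall_lt_imp_le_of_dense fun s hs => ?_
    rcases le_or_gt s 0 with hs0 | hs0
    · exact hs0.trans Metric.diam_nonneg
    have h1 : x + s • e ∈ simplex t := by
      refine hball ?_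
      rw [Metric.mem_ball, dist_self_add_left, norm_smul, he, mul_one, Real.norm_of_nonneg hs0.le]
      exact hs
    have := dist_le_diam_simplex h1 (hball (Metric.mem_ball_self hr))
    rwa [dist_self_add_left, norm_smul, he, mul_one, Real.norm_of_nonneg hs0.le] at this
  set s := {r | 0 < r ∧ ∃ x ∈ simplex t, Metric.ball x r ⊆ simplex t} with hs
  have hbdd : BddAbove s := ⟨Metric.diam (simplex t), fun r hr => by
    obtain ⟨h0, x, _, hx⟩ := hr
    exact hle x r h0 hx⟩
  have hne : ∃ r, r ∈ s := by
    obtain ⟨r, hr, hball⟩ := Metric.mem_nhds_iff.1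
      (mem_interior_iff_mem_nhds.1 (h.barycentre_mem_interior hcard))
    exact ⟨r, hr, _, interior_subset (h.barycentre_mem_interior hcard), hball⟩
  have hpos : 0 < inradius (simplex t) := by
    obtain ⟨r, hr⟩ := hne
    exact hr.1.trans_le (le_csSup hbdd hr)
  obtain ⟨r, hr, hlt⟩ := exists_lt_of_lt_csSup hne
    (show inradius (simplex t) / 2 < sSup s from half_lt_self hpos)
  obtain ⟨hr0, x, _, hball⟩ := hr
  refine ⟨x, r, hr0, hball, ?_, hle x r hr0 hball⟩
  rw [div_le_iff₀ hpos] at hω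
  have hω0 : 0 ≤ ω₀ := by
    by_contra! hneg
    have := mul_neg_of_neg_of_pos hneg hpos
    linarith [Metric.diam_nonneg (s := simplex t)]
  calc Metric.diam (simplex t) ≤ ω₀ * inradius (simplex t) := hω
    _ ≤ ω₀ * (2 * r) := by gcongr; linarith
    _ = _ := by ring

theorem exists_mem_ge_of_mem_simplex {t : Finset (Rd d)} {x : Rd d} (hx : x ∈ simplex t)
    (e : Rd d) : ∃ w ∈ t, inner ℝ e x ≤ inner ℝ e w := by
  have hconv : ConvexOn ℝ univ (fun y : Rd d => inner ℝ e y) :=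
    (innerₛₗ ℝ e).convexOn convex_univ
  exact hconv.exists_ge_of_mem_convexHull (subset_univ _) hx

/-- The diameter of a facet is bounded below by the radius of a ball in the simplex. -/
theorem le_diam_facet {S t : Finset (Rd d)} (hd : 2 ≤ d) (hSt : S ⊆ t) (hS : S.card = d)
    (ht : t.card = d + 1) {x₀ : Rd d} {r : ℝ} (hball : Metric.ball x₀ r ⊆ simplex t) :
    r ≤ Metric.diam (simplex S) := by
  classical
  obtain ⟨z, hz⟩ : ∃ z, t \ S = {z} := by
    rw [← Finset.card_eq_one, Finset.card_sdiff_of_subset hSt]; omega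
  obtain ⟨s₀, hs₀⟩ : S.Nonempty := by rw [← Finset.card_pos]; omega
  -- In a direction orthogonal to the edge from s₀ to z, the opposite vertex z has the same height
  -- as s₀, so the extent of the simplex in this direction is already attained on the facet. Such a
  -- direction exists because d ≥ 2.
  obtain ⟨e, he, heo⟩ : ∃ e : Rd d, ‖e‖ = 1 ∧ inner ℝ e (z - s₀) = 0 := by
    have h1 : 0 < Module.finrank ℝ (ℝ ∙ (z - s₀))ᗮ := by
      have h2 := Submodule.finrank_add_finrank_orthogonal (ℝ ∙ (z - s₀))
      have h3 : Module.finrank ℝ (ℝ ∙ (z - s₀)) ≤ 1 := by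
        simpa using finrank_span_le_card ({z - s₀} : Set (Rd d)) (R := ℝ)
      rw [finrank_euclideanSpace_fin] at h2
      omega
    have : Nontrivial (ℝ ∙ (z - s₀))ᗮ := Module.finrank_pos_iff.1 h1
    obtain ⟨e, he⟩ := exists_norm_eq (ℝ ∙ (z - s₀))ᗮ zero_le_one
    refine ⟨e, he, ?_⟩
    rw [real_inner_comm]
    exact Submodule.mem_orthogonal_singleton_iff_inner_right.1 e.2
  have hfacet : ∀ e : Rd d, inner ℝ e (z - s₀) = 0 → ∀ x ∈ simplex t,
      ∃ w ∈ S, inner ℝ e x ≤ inner ℝ e w := by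
    intro e heo x hx
    obtain ⟨w, hw, hwx⟩ := exists_mem_ge_of_mem_simplex hx e
    by_cases hwS : w ∈ S
    · exact ⟨w, hwS, hwx⟩
    · have : w = z := by
        have : w ∈ t \ S := Finset.mem_sdiff.2 ⟨hw, hwS⟩
        rw [hz] at this; exact Finset.mem_singleton.1 this
      refine ⟨s₀, hs₀, hwx.trans ?_⟩
      rw [inner_sub_right] at heo
      rw [this]; linarith
  refine le_of_forall_lt_imp_le_of_dense fun s hs => ?_
  rcases le_or_gt s 0 with hs0 | hs0
  · exact hs0.trans Metric.diam_nonneg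
  have hmem : ∀ c : ℝ, |c| = s → x₀ + c • e ∈ simplex t := fun c hc => by
    refine hball ?_
    rw [Metric.mem_ball, dist_self_add_left, norm_smul, he, mul_one, Real.norm_eq_abs, hc]
    exact hs
  obtain ⟨w, hw, hw1⟩ := hfacet e heo _ (hmem s (abs_of_pos hs0))
  obtain ⟨w', hw', hw2⟩ := hfacet (-e) (by rw [inner_neg_left, heo, neg_zero]) _
    (hmem (-s) (by rw [abs_neg, abs_of_pos hs0]))
  have h1 : inner ℝ e (w - w') ≤ dist w w' := by
    rw [dist_eq_norm]
    simpa [he] using real_inner_le_norm e (w - w')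
  have h2 := dist_le_diam_simplex (mem_simplex_of_mem hw) (mem_simplex_of_mem hw')
  rw [inner_add_right, real_inner_smul_right, real_inner_self_eq_norm_sq, he] at hw1
  rw [inner_neg_left, inner_neg_left, inner_add_right, real_inner_smul_right,
    real_inner_self_eq_norm_sq, he] at hw2
  rw [inner_sub_right] at h1
  linarith

theorem diam_facet_le {S t : Finset (Rd d)} (hSt : S ⊆ t) :
    Metric.diam (simplex S) ≤ Metric.diam (simplex t) :=
  Metric.diam_mono (convexHull_mono (by exact_mod_cast hSt)) (isCompact_simplex t).isBounded

/-- Two adjacent simplices contain the two halves of a ball around the barycentre of the common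
facet. -/
theorem exists_halfBalls {S t₁ t₂ : Finset (Rd d)} (hd : 1 ≤ d)
    (h1 : AffineIndependent ℝ ((↑) : t₁ → Rd d)) (h2 : AffineIndependent ℝ ((↑) : t₂ → Rd d))
    (hc1 : t₁.card = d + 1) (hc2 : t₂.card = d + 1) (hne : t₁ ≠ t₂) (hS1 : S ⊆ t₁) (hS2 : S ⊆ t₂)
    (hS : S.card = d)
    (hinter : simplex t₁ ∩ simplex t₂ ⊆ convexHull ℝ ((t₁ : Set (Rd d)) ∩ t₂))
    {x₁ x₂ : Rd d} {r₁ r₂ : ℝ} (hr1 : 0 < r₁) (hr2 : 0 < r₂)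
    (hb1 : Metric.ball x₁ r₁ ⊆ simplex t₁) (hb2 : Metric.ball x₂ r₂ ⊆ simplex t₂) :
    ∃ (y₀ ν : Rd d), ‖ν‖ = 1 ∧ y₀ ∈ simplex t₁ ∧ y₀ ∈ simplex t₂ ∧
      (∀ x ∈ Metric.closedBall y₀ (min r₁ r₂ / d), 0 ≤ inner ℝ ν (x - y₀) → x ∈ simplex t₁) ∧
      (∀ x ∈ Metric.closedBall y₀ (min r₁ r₂ / d), inner ℝ ν (x - y₀) ≤ 0 → x ∈ simplex t₂) ∧
      ∀ m : Rd d, (∀ w ∈ S, inner ℝ m (w - y₀) = 0) → ∃ τ : ℝ, m = τ • ν := by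
  classical
  obtain ⟨lam₁, n₁, H1⟩ := exists_isBaryCoords h1 hc1
  obtain ⟨lam₂, n₂, H2⟩ := exists_isBaryCoords h2 hc2
  have hvert : ∀ t : Finset (Rd d), S ⊆ t → t.card = d + 1 → ∃ z ∈ t, z ∉ S ∧
      ∀ w ∈ t, w ≠ z → w ∈ S := by
    intro t hSt hct
    obtain ⟨z, hz⟩ : ∃ z, t \ S = {z} := by
      rw [← Finset.card_eq_one, Finset.card_sdiff_of_subset hSt]; omega
    have hz' : z ∈ t \ S := by rw [hz]; exact Finset.mem_singleton_self z
    refine ⟨z, (Finset.mem_sdiff.1 hz').1, (Finset.mem_sdiff.1 hz').2, fun w hw hwz => ?_⟩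
    by_contra hwS
    have : w ∈ t \ S := Finset.mem_sdiff.2 ⟨hw, hwS⟩
    rw [hz] at this
    exact hwz (Finset.mem_singleton.1 this)
  obtain ⟨z₁, hz1, hz1S, hz1w⟩ := hvert t₁ hS1 hc1
  obtain ⟨z₂, hz2, hz2S, hz2w⟩ := hvert t₂ hS2 hc2
  set y₀ := barycentre S with hy₀
  have hd0 : (0:ℝ) < d := by exact_mod_cast hd
  have hlamy : ∀ (t : Finset (Rd d)) lam n, IsBaryCoords t lam n → S ⊆ t → ∀ z ∈ t,
      lam z y₀ = (d : ℝ)⁻¹ * ∑ w ∈ S, lam z w := by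
    intro t lam n H hSt z hz
    have e1 : ∀ w, lam z w = lam z z + inner ℝ (n z) (w - z) := fun w => H.eq_add z hz w z
    have e2 : y₀ - z = (d : ℝ)⁻¹ • ∑ w ∈ S, (w - z) := by
      rw [hy₀, barycentre, hS, Finset.sum_sub_distrib, Finset.sum_const, smul_sub, hS,
        ← Nat.cast_smul_eq_nsmul ℝ, inv_smul_smul₀ hd0.ne']
    rw [e1, e2, real_inner_smul_right, inner_sum]
    rw [Finset.sum_congr rfl fun w _ => e1 w, Finset.sum_add_distrib, Finset.sum_const, hS, mul_add, nsmul_eq_mul,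
      inv_mul_cancel_left₀ hd0.ne']
  have hlamS : ∀ (t : Finset (Rd d)) lam n, IsBaryCoords t lam n → S ⊆ t → ∀ z ∈ S,
      lam z y₀ = (d : ℝ)⁻¹ := by
    intro t lam n H hSt z hz
    rw [hlamy t lam n H hSt z (hSt hz), Finset.sum_eq_single z
      (fun w hw hne => H.ne z (hSt hz) w (hSt hw) hne.symm) (fun hn => absurd hz hn),
      H.self z (hSt hz), mul_one]
  have hlamz : ∀ (t : Finset (Rd d)) lam n, IsBaryCoords t lam n → S ⊆ t → ∀ z ∈ t, z ∉ S →
      lam z y₀ = 0 := by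
    intro t lam n H hSt z hz hzS
    rw [hlamy t lam n H hSt z hz, Finset.sum_eq_zero, mul_zero]
    intro w hw
    exact H.ne z hz w (hSt hw) (fun h => hzS (h ▸ hw))
  have hy1 := hlamz t₁ lam₁ n₁ H1 hS1 z₁ hz1 hz1S
  have hy2 := hlamz t₂ lam₂ n₂ H2 hS2 z₂ hz2 hz2S
  -- At the barycentre of the facet the coordinates of its vertices equal 1/d and their slopes are
  -- at most 1/r, so they remain nonnegative at distance r/d. Only the sign of the coordinate of the
  -- opposite vertex remains to be decided.
  have hlamball : ∀ (t : Finset (Rd d)) lam n, IsBaryCoords t lam n → S ⊆ t → ∀ c r, 0 < r →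
      Metric.ball c r ⊆ simplex t → min r₁ r₂ ≤ r → ∀ x ∈ Metric.closedBall y₀ (min r₁ r₂ / d),
      ∀ z ∈ S, 0 ≤ lam z x := by
    intro t lam n H hSt c r hr hb hmin x hx z hz
    rw [H.eq_add z (hSt hz) x y₀, hlamS t lam n H hSt z hz]
    have e1 : -(inner ℝ (n z) (x - y₀)) ≤ ‖n z‖ * ‖x - y₀‖ :=
      (neg_le_abs _).trans (abs_real_inner_le_norm _ _)
    have e2 := H.norm_mul_le hr hb (hSt hz)
    have e3 : ‖n z‖ * ‖x - y₀‖ ≤ (d : ℝ)⁻¹ := by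
      calc ‖n z‖ * ‖x - y₀‖ ≤ ‖n z‖ * (r / d) := by
            gcongr
            rw [← dist_eq_norm]
            exact (Metric.mem_closedBall.1 hx).trans (by gcongr)
        _ = ‖n z‖ * r * (d : ℝ)⁻¹ := by ring
        _ ≤ 1 * (d : ℝ)⁻¹ := by gcongr
        _ = _ := one_mul _
    linarith
  have hn1 : n₁ z₁ ≠ 0 := by
    intro h0
    have := H1.eq_add z₁ hz1 z₁ y₀
    rw [H1.self z₁ hz1, hy1, h0, inner_zero_left] at this
    norm_num at this
  have hn1' : 0 < ‖n₁ z₁‖ := norm_pos_iff.2 hn1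
  have hperp2 : ∀ w ∈ S, inner ℝ (n₂ z₂) (w - y₀) = 0 := by
    intro w hw
    have := H2.eq_add z₂ hz2 w y₀
    rw [hy2, H2.ne z₂ hz2 w (hS2 hw) (fun h => hz2S (h ▸ hw)), zero_add] at this
    exact this.symm
  have hpar : ∀ m : Rd d, (∀ w ∈ S, inner ℝ m (w - y₀) = 0) →
      m = (inner ℝ m (z₁ - y₀) : ℝ) • n₁ z₁ := fun m hm =>
    H1.exists_eq_smul hz1 (fun w hw hwz => hm w (hz1w w hw hwz)) hy1
  -- Both gradients of opposite-vertex coordinates are orthogonal to the common facet, hence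
  -- parallel; the sign of c tells whether the simplices lie on opposite sides.
  set c : ℝ := inner ℝ (n₂ z₂) (z₁ - y₀) with hc
  have hn2 : n₂ z₂ = c • n₁ z₁ := hpar _ hperp2
  have hinS : ∀ x, x ∈ simplex t₁ → x ∈ simplex t₂ → lam₁ z₁ x = 0 := by
    intro x hx1 hx2
    have hsub : (t₁ : Set (Rd d)) ∩ t₂ ⊆ S := by
      rintro w ⟨hw1, hw2⟩
      by_contra hwS
      have e1 : w = z₁ := by
        by_contra hne; exact hwS (hz1w w hw1 hne)
      have e2 : w = z₂ := by
        by_contra hne; exact hwS (hz2w w hw2 hne)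
      refine hne (Finset.eq_of_subset_of_card_le (fun u hu => ?_) (by omega))
      by_cases huz : u = z₁
      · rw [huz, ← e1, e2]; exact hz2
      · exact hS2 (hz1w u hu huz)
    have hxS := convexHull_mono hsub (hinter ⟨hx1, hx2⟩)
    have hle : ∀ e : Rd d, (∀ w ∈ S, inner ℝ e (w - y₀) = 0) → inner ℝ e (x - y₀) ≤ 0 := by
      intro e he
      obtain ⟨w, hw, hwx⟩ := exists_mem_ge_of_mem_simplex hxS e
      have := he w hw
      rw [inner_sub_right] at this ⊢
      linarith
    have hperp1 : ∀ w ∈ S, inner ℝ (n₁ z₁) (w - y₀) = 0 := by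
      intro w hw
      have := H1.eq_add z₁ hz1 w y₀
      rw [hy1, H1.ne z₁ hz1 w (hS1 hw) (fun h => hz1S (h ▸ hw)), zero_add] at this
      exact this.symm
    have e1 := hle (n₁ z₁) hperp1
    have e2 := (H1.mem_simplex x).1 hx1 z₁ hz1
    rw [H1.eq_add z₁ hz1 x y₀, hy1, zero_add] at e2 ⊢
    linarith
  have hR : 0 < min r₁ r₂ / d := div_pos (lt_min hr1 hr2) hd0
  have hmem1 : ∀ x ∈ Metric.closedBall y₀ (min r₁ r₂ / d), 0 ≤ inner ℝ (n₁ z₁) (x - y₀) →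
      x ∈ simplex t₁ := by
    intro x hx hin
    rw [H1.mem_simplex]
    intro z hz
    by_cases hzz : z = z₁
    · rw [hzz, H1.eq_add z₁ hz1 x y₀, hy1, zero_add]; exact hin
    · exact hlamball t₁ lam₁ n₁ H1 hS1 x₁ r₁ hr1 hb1 (min_le_left _ _) x hx z (hz1w z hz hzz)
  have hmem2 : ∀ x ∈ Metric.closedBall y₀ (min r₁ r₂ / d), 0 ≤ inner ℝ (n₂ z₂) (x - y₀) →
      x ∈ simplex t₂ := by
    intro x hx hin
    rw [H2.mem_simplex]
    intro z hz
    by_cases hzz : z = z₂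
    · rw [hzz, H2.eq_add z₂ hz2 x y₀, hy2, zero_add]; exact hin
    · exact hlamball t₂ lam₂ n₂ H2 hS2 x₂ r₂ hr2 hb2 (min_le_right _ _) x hx z (hz2w z hz hzz)
  -- Otherwise a point slightly off the facet would lie in both simplices, contrary to the
  -- conformity of the triangulation.
  have hc0 : c < 0 := by
    by_contra! hcn
    set x := y₀ + (min r₁ r₂ / d / ‖n₁ z₁‖) • n₁ z₁ with hx
    have hxb : x ∈ Metric.closedBall y₀ (min r₁ r₂ / d) := by
      rw [Metric.mem_closedBall, hx, dist_self_add_left, norm_smul,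
        Real.norm_of_nonneg (by positivity), div_mul_cancel₀ _ hn1'.ne']
    have hin : 0 < inner ℝ (n₁ z₁) (x - y₀) := by
      rw [hx, add_sub_cancel_left, real_inner_smul_right, real_inner_self_eq_norm_sq]
      positivity
    have hx1 := hmem1 x hxb hin.le
    have hx2 := hmem2 x hxb (by rw [hn2, real_inner_smul_left]; positivity)
    have := hinS x hx1 hx2
    rw [H1.eq_add z₁ hz1 x y₀, hy1, zero_add] at this
    linarith
  have hy₀1 : y₀ ∈ simplex t₁ := hmem1 y₀ (Metric.mem_closedBall_self hR.le) (by simp)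
  have hy₀2 : y₀ ∈ simplex t₂ := hmem2 y₀ (Metric.mem_closedBall_self hR.le) (by simp)
  refine ⟨y₀, ‖n₁ z₁‖⁻¹ • n₁ z₁, ?_, hy₀1, hy₀2, ?_, ?_, ?_⟩
  · rw [norm_smul, norm_inv, norm_norm, inv_mul_cancel₀ hn1'.ne']
  · intro x hx hin
    rw [real_inner_smul_left] at hin
    exact hmem1 x hx (by
      by_contra! hlt
      have := mul_neg_of_pos_of_neg (inv_pos.2 hn1') hlt
      linarith)
  · intro x hx hin
    rw [real_inner_smul_left] at hin
    refine hmem2 x hx ?_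
    rw [hn2, real_inner_smul_left]
    refine mul_nonneg_of_nonpos_of_nonpos hc0.le ?_
    by_contra! hlt
    have := mul_pos (inv_pos.2 hn1') hlt
    linarith
  · intro m hm
    refine ⟨inner ℝ m (z₁ - y₀) * ‖n₁ z₁‖, ?_⟩
    rw [smul_smul, mul_assoc, mul_inv_cancel₀ hn1'.ne', mul_one]
    exact hpar m hm

/-- The surface measure of a facet is bounded by a power of its diameter. -/
theorem exists_measure_facet_le (d : ℕ) : ∃ C : NNReal, ∀ S : Finset (Rd d), S.card = d →
    1 ≤ d → (μHE[d - 1] : Measure (Rd d)) (simplex S) ≤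
      C * ENNReal.ofReal (Metric.diam (simplex S)) ^ (d - 1) := by
  classical
  refine ⟨Measure.addHaarScalarFactor (volume : Measure (EuclideanSpace ℝ (Fin (d - 1))))
    μH[(d - 1 : ℕ)] * ((d - 1 : ℕ) : NNReal) ^ (d - 1), fun S hS hd => ?_⟩
  obtain ⟨s₀, hs₀⟩ : S.Nonempty := by rw [← Finset.card_pos]; omega
  set ι := S.erase s₀ with hι
  have hcard : Fintype.card ι = d - 1 := by
    rw [Fintype.card_coe, Finset.card_erase_of_mem hs₀, hS]
  set h : NNReal := (Metric.diam (simplex S)).toNNReal with hh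
  have hcoe : (h : ℝ) = Metric.diam (simplex S) := Real.coe_toNNReal _ Metric.diam_nonneg
  -- The facet lies in the image of the unit cube of dimension d-1 under an affine map with
  -- Lipschitz constant (d-1)h, and that cube has Hausdorff measure 1.
  set f : (ι → ℝ) → Rd d := fun l => s₀ + ∑ i, l i • ((i : Rd d) - s₀) with hf
  have hlip : LipschitzWith (((d - 1 : ℕ) : NNReal) * h) f := by
    refine LipschitzWith.of_dist_le_mul fun l m => ?_
    have e1 : f l - f m = ∑ i, (l i - m i) • ((i : Rd d) - s₀) := by
      rw [hf]; simp only [add_sub_add_left_eq_sub, ← Finset.sum_sub_distrib, ← sub_smul]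
    rw [dist_eq_norm, e1]
    calc ‖∑ i, (l i - m i) • ((i : Rd d) - s₀)‖
        ≤ ∑ i, ‖(l i - m i) • ((i : Rd d) - s₀)‖ := norm_sum_le _ _
      _ ≤ ∑ _i : ι, dist l m * h := by
          refine Finset.sum_le_sum fun i _ => ?_
          rw [norm_smul, hcoe]
          refine mul_le_mul ?_ ?_ (norm_nonneg _) dist_nonneg
          · rw [← dist_eq_norm]
            exact dist_le_pi_dist l m i
          · rw [← dist_eq_norm]
            exact dist_le_diam_simplex (mem_simplex_of_mem (Finset.mem_of_mem_erase i.2))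
              (mem_simplex_of_mem hs₀)
      _ = _ := by
          rw [Finset.sum_const, Finset.card_univ, hcard, nsmul_eq_mul]
          simp only [NNReal.coe_mul, NNReal.coe_natCast]
          ring
  have hsub : simplex S ⊆ f '' Icc 0 1 := by
    intro x hx
    rw [simplex, Finset.mem_convexHull'] at hx
    obtain ⟨w, hw0, hw1, hwx⟩ := hx
    refine ⟨fun i => w i, ⟨fun i => hw0 i (Finset.mem_of_mem_erase i.2), fun i => ?_⟩, ?_⟩
    · rw [Pi.one_apply, ← hw1]
      exact Finset.single_le_sum (fun y hy => hw0 y hy) (Finset.mem_of_mem_erase i.2)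
    · have e1 : ∑ i : ι, w i • ((i : Rd d) - s₀) = ∑ y ∈ S, w y • (y - s₀) := by
        rw [Finset.sum_coe_sort ι (fun y => w y • (y - s₀)), hι, ← Finset.add_sum_erase S _ hs₀]
        simp
      show s₀ + ∑ i : ι, w i • ((i : Rd d) - s₀) = x
      rw [e1]
      simp only [smul_sub, Finset.sum_sub_distrib]
      rw [hwx, ← Finset.sum_smul, hw1, one_smul]
      abel
  have hvol : μH[((d - 1 : ℕ) : ℝ)] (Icc (0 : ι → ℝ) 1) = 1 := by
    rw [← hcard, hausdorffMeasure_pi_real, Real.volume_Icc_pi]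
    simp
  rw [Measure.euclideanHausdorffMeasure_def, Measure.smul_apply, ENNReal.smul_def, smul_eq_mul]
  have hle : μH[((d - 1 : ℕ) : ℝ)] (simplex S) ≤
      ((((d - 1 : ℕ) : NNReal) * h : NNReal) : ℝ≥0∞) ^ (d - 1) := by
    calc μH[((d - 1 : ℕ) : ℝ)] (simplex S) ≤ μH[((d - 1 : ℕ) : ℝ)] (f '' Icc 0 1) :=
          measure_mono hsub
      _ ≤ _ := hlip.hausdorffMeasure_image_le (by positivity) _
      _ = _ := by rw [hvol, mul_one, ENNReal.rpow_natCast]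
  calc _ ≤ (Measure.addHaarScalarFactor (volume : Measure (EuclideanSpace ℝ (Fin (d - 1))))
        μH[(d - 1 : ℕ)] : ℝ≥0∞) * ((((d - 1 : ℕ) : NNReal) * h : NNReal) : ℝ≥0∞) ^ (d - 1) := by
        gcongr
    _ = _ := by
        rw [← ENNReal.ofNNReal_toNNReal, ← hh]
        push_cast
        ring

end

/-! ### Test functions and integrability in the variable exponent setting. -/

noncomputable section

variable {d : ℕ} {Ω ΓD : Set (Rd d)}

/-- A bounded Lipschitz domain is regular open. -/
theorem IsBoundedLipschitzDomain.interior_closure (h : IsBoundedLipschitzDomain Ω) :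
    interior (closure Ω) = Ω := by
  refine Subset.antisymm (fun x hx => ?_) h.isOpen.subset_interior_closure
  by_contra hxΩ
  have hfr : x ∈ frontier Ω := by
    rw [frontier, h.isOpen.interior_eq]
    exact ⟨interior_subset hx, hxΩ⟩
  obtain ⟨ν, U, g, K, hν, hU, hxU, hg, hyU⟩ := h.graph x hfr
  have hνν : inner ℝ ν ν = (1 : ℝ) := by rw [real_inner_self_eq_norm_sq, hν]; norm_num
  have hge : g (x - inner ℝ ν x • ν) ≤ inner ℝ ν x := by
    by_contra! hlt
    exact hxΩ ((hyU x hxU).2 hlt)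
  -- A small step in direction ν leads strictly above the Lipschitz graph, where a whole
  -- neighbourhood misses Ω, while the point would still lie in the closure of Ω.
  have hcont : Tendsto (fun ε : ℝ => x + ε • ν) (𝓝[>] 0) (𝓝 x) := by
    have : Tendsto (fun ε : ℝ => x + ε • ν) (𝓝 0) (𝓝 (x + (0 : ℝ) • ν)) :=
      (Continuous.tendsto (by fun_prop) 0)
    rw [zero_smul, add_zero] at this
    exact this.mono_left nhdsWithin_le_nhds
  have hev := (hcont.eventually ((hU.inter isOpen_interior).mem_nhds ⟨hxU, hx⟩)).and
    self_mem_nhdsWithin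
  obtain ⟨ε, ⟨hεU, hεi⟩, hε⟩ := hev.exists
  have hε : 0 < ε := hε
  set y := x + ε • ν with hy
  have hVopen : IsOpen (U ∩ {w : Rd d | g (w - inner ℝ ν w • ν) < inner ℝ ν w}) := by
    refine hU.inter (isOpen_lt ?_ (by fun_prop))
    exact hg.continuous.comp (by fun_prop)
  have hyV : y ∈ U ∩ {w : Rd d | g (w - inner ℝ ν w • ν) < inner ℝ ν w} := by
    refine ⟨hεU, ?_⟩
    have e1 : inner ℝ ν y = inner ℝ ν x + ε := by
      rw [hy, inner_add_right, inner_smul_right, hνν, mul_one]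
    have e2 : y - inner ℝ ν y • ν = x - inner ℝ ν x • ν := by
      rw [e1, hy, add_smul]; abel
    show g (y - inner ℝ ν y • ν) < inner ℝ ν y
    rw [e2, e1]
    linarith
  obtain ⟨w, ⟨hwU, hwlt⟩, hwΩ⟩ := mem_closure_iff.1 (interior_subset hεi) _ hVopen hyV
  exact absurd ((hyU w hwU).1 hwΩ) (not_lt.2 (le_of_lt hwlt))

theorem IsBoundedLipschitzDomain.volume_lt_top (h : IsBoundedLipschitzDomain Ω) :
    volume Ω < ∞ := h.isBounded.measure_lt_top

theorem continuous_gradient {w : Rd d → ℝ} (hw : ContDiff ℝ (⊤ : ℕ∞) w) :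
    Continuous (gradient w) := by
  have : Continuous (fderiv ℝ w) := hw.continuous_fderiv (by simp)
  exact (InnerProductSpace.toDual ℝ (Rd d)).symm.continuous.comp this

theorem gradient_eq_zero_of_notMem_tsupport {w : Rd d → ℝ} {x : Rd d} (hx : x ∉ tsupport w) :
    gradient w x = 0 := by
  rw [gradient, fderiv_of_notMem_tsupport ℝ hx, map_zero]

/-- Continuous functions with compact support lie in variable Lebesgue spaces on sets of finite
measure. -/
theorem memLpVar_of_hasCompactSupport {F : Type*} [NormedAddCommGroup F]
    [SecondCountableTopologyEither (Rd d) F] {w : Rd d → F} (hw : Continuous w)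
    (hc : HasCompactSupport w) (hΩ : MeasurableSet Ω) (hΩ' : volume Ω < ∞) {q : Rd d → ℝ} {Q : ℝ}
    (hq : ∀ x ∈ Ω, 0 ≤ q x ∧ q x ≤ Q) : MemLpVar Ω q w := by
  refine ⟨hw.aestronglyMeasurable, ?_⟩
  obtain ⟨B, hB⟩ := hc.exists_bound_of_continuous hw
  have hB0 : 0 ≤ B := (norm_nonneg _).trans (hB 0)
  calc ∫⁻ x in Ω, ENNReal.ofReal (‖w x‖ ^ q x)
      ≤ ∫⁻ _ in Ω, ENNReal.ofReal ((1 + B) ^ Q) := by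
        refine setLIntegral_mono' hΩ fun x hx => ENNReal.ofReal_le_ofReal ?_
        calc ‖w x‖ ^ q x ≤ (1 + B) ^ q x :=
              Real.rpow_le_rpow (norm_nonneg _) ((hB x).trans (by linarith)) (hq x hx).1
          _ ≤ _ := Real.rpow_le_rpow_of_exponent_le (by linarith) (hq x hx).2
    _ < ∞ := by
        rw [setLIntegral_const]
        exact ENNReal.mul_lt_top ENNReal.ofReal_lt_top hΩ'

/-- Test functions belong to the Sobolev space with zero trace. -/
theorem memW1D_of_hasCompactSupport (hΩ : IsBoundedLipschitzDomain Ω)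
    {q : Rd d → ℝ} {Q : ℝ} (hq : ∀ x ∈ Ω, 0 ≤ q x ∧ q x ≤ Q) {w : Rd d → ℝ}
    (hw : ContDiff ℝ (⊤ : ℕ∞) w) (hc : HasCompactSupport w) (hs : tsupport w ⊆ Ω) :
    MemW1D Ω ΓD q w (gradient w) := by
  have hgc : HasCompactSupport (gradient w) :=
    HasCompactSupport.of_support_subset_isCompact hc fun x hx => by
      by_contra hx'
      exact hx (gradient_eq_zero_of_notMem_tsupport hx')
  refine ⟨memLpVar_of_hasCompactSupport hw.continuous hc hΩ.isOpen.measurableSet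
      hΩ.volume_lt_top hq,
    memLpVar_of_hasCompactSupport (continuous_gradient hw) hgc hΩ.isOpen.measurableSet
      hΩ.volume_lt_top hq, ?_, 0, ⟨aestronglyMeasurable_zero, fun _ => w, fun _ => hw, ?_, ?_⟩, ?_⟩
  · intro ψ hψ hψc hψs e
    have hz : ∀ x ∉ Ω, w x = 0 := fun x hx => image_eq_zero_of_notMem_tsupport fun h => hx (hs h)
    rw [setIntegral_eq_integral_of_forall_compl_eq_zero (fun x hx => by rw [hz x hx, zero_mul]),
      setIntegral_eq_integral_of_forall_compl_eq_zero (fun x hx => by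
        rw [gradient_eq_zero_of_notMem_tsupport (fun h => hx (hs h)), inner_zero_left, zero_mul])]
    simp only [inner_gradient_left]
    have hw1 : Differentiable ℝ w := hw.differentiable (by simp)
    have hψ1 : Differentiable ℝ ψ := hψ.differentiable (by simp)
    have cw : Continuous fun x => fderiv ℝ w x e :=
      (hw.continuous_fderiv (by simp)).clm_apply continuous_const
    have cψ : Continuous fun x => fderiv ℝ ψ x e :=
      (hψ.continuous_fderiv (by simp)).clm_apply continuous_const
    refine integral_mul_fderiv_eq_neg_fderiv_mul_of_integrable ?_ ?_ ?_
      (fun x _ => hw1 x) (fun x _ => hψ1 x)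
    · exact (cw.mul hψ.continuous).integrable_of_hasCompactSupport hψc.mul_left
    · exact (hw.continuous.mul cψ).integrable_of_hasCompactSupport hc.mul_right
    · exact (hw.continuous.mul hψ.continuous).integrable_of_hasCompactSupport hc.mul_right
  · simp
  · have h0 : ∀ x ∈ frontier Ω, w x = 0 := fun x hx => image_eq_zero_of_notMem_tsupport fun h => by
      rw [hΩ.isOpen.frontier_eq] at hx
      exact hx.2 (hs h)
    have : ∫⁻ x in frontier Ω, ‖w x - (0 : Rd d → ℝ) x‖ₑ ∂(μHE[d - 1] : Measure (Rd d)) = 0 := by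
      rw [setLIntegral_congr_fun (g := fun _ => 0) isClosed_frontier.measurableSet
        (fun x hx => by simp [h0 x hx])]
      simp
    simp only [this]
    exact tendsto_const_nhds
  · exact ae_of_all _ fun _ => rfl

theorem norm_opA_le_rpow {δ q : ℝ} (hδ : 0 ≤ δ) (a : Rd d) :
    ‖opA δ q a‖ ≤ (δ + ‖a‖) ^ (q - 1) := by
  have ha := norm_nonneg a
  rw [opA, norm_smul, Real.norm_eq_abs, abs_of_nonneg (by positivity)]
  rcases eq_or_lt_of_le (add_nonneg hδ ha) with h0 | h0
  · rw [show ‖a‖ = 0 by linarith, mul_zero]; positivity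
  · calc (δ + ‖a‖) ^ (q - 2) * ‖a‖ ≤ (δ + ‖a‖) ^ (q - 2) * (δ + ‖a‖) := by gcongr; linarith
      _ = (δ + ‖a‖) ^ (q - 1) := by rw [← Real.rpow_add_one h0.ne']; ring_nf

/-- A crude domination by the modular density of the gradient, with constants uniform in the
exponent, which makes the flux integrable on bounded sets. -/
theorem norm_opA_le {δ q Q : ℝ} (hδ : 0 ≤ δ) (hq : 1 ≤ q) (hQ : q ≤ Q) (a : Rd d) :
    ‖opA δ q a‖ ≤ 2 ^ Q * ((1 + δ) ^ Q + ‖a‖ ^ q) := by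
  have ha := norm_nonneg a
  have h1 : ‖opA δ q a‖ ≤ (1 + δ + ‖a‖) ^ q :=
    calc ‖opA δ q a‖ ≤ (δ + ‖a‖) ^ (q - 1) := norm_opA_le_rpow hδ a
      _ ≤ (1 + δ + ‖a‖) ^ (q - 1) := Real.rpow_le_rpow (by positivity) (by linarith) (by linarith)
      _ ≤ _ := Real.rpow_le_rpow_of_exponent_le (by linarith) (by linarith)
  refine h1.trans ?_
  have hm : 1 + δ + ‖a‖ ≤ 2 * max (1 + δ) ‖a‖ := by
    have := le_max_left (1 + δ) ‖a‖
    have := le_max_right (1 + δ) ‖a‖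
    linarith
  have hm0 : 0 ≤ max (1 + δ) ‖a‖ := le_max_of_le_right ha
  calc (1 + δ + ‖a‖) ^ q ≤ (2 * max (1 + δ) ‖a‖) ^ q :=
        Real.rpow_le_rpow (by positivity) hm (by linarith)
    _ = 2 ^ q * (max (1 + δ) ‖a‖) ^ q := Real.mul_rpow (by norm_num) hm0
    _ ≤ 2 ^ Q * ((1 + δ) ^ Q + ‖a‖ ^ q) := by
        refine mul_le_mul (Real.rpow_le_rpow_of_exponent_le (by norm_num) hQ) ?_
          (by positivity) (by positivity)
        have h3 : (1 + δ) ^ q ≤ (1 + δ) ^ Q :=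
          Real.rpow_le_rpow_of_exponent_le (by linarith) hQ
        have h4 : 0 ≤ ‖a‖ ^ q := by positivity
        have h5 : 0 ≤ (1 + δ) ^ Q := by positivity
        rcases max_cases (1 + δ) ‖a‖ with h | h <;> rw [h.1] <;> linarith

/-- The flux of a function in the variable Sobolev space is integrable. -/
theorem integrableOn_opA (hΩ : MeasurableSet Ω) (hΩ' : volume Ω < ∞) {δ pp : ℝ} (hδ : 0 ≤ δ)
    {p : Rd d → ℝ} (hp : ContinuousOn p Ω) (hp1 : ∀ x ∈ Ω, 1 < p x ∧ p x ≤ pp)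
    {G : Rd d → Rd d} (hG : MemLpVar Ω p G) : IntegrableOn (fun x => opA δ (p x) (G x)) Ω := by
  have hpm : AEMeasurable p (volume.restrict Ω) := hp.aemeasurable hΩ
  have hmeas : AEStronglyMeasurable (fun x => opA δ (p x) (G x)) (volume.restrict Ω) := by
    have : AEMeasurable (fun x => (δ + ‖G x‖) ^ (p x - 2)) (volume.restrict Ω) :=
      (hG.1.norm.aemeasurable.const_add δ).pow (hpm.sub_const 2)
    exact this.aestronglyMeasurable.smul hG.1
  have hGi : IntegrableOn (fun x => ‖G x‖ ^ p x) Ω := by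
    refine ⟨(hG.1.norm.aemeasurable.pow hpm).aestronglyMeasurable, ?_⟩
    rw [hasFiniteIntegral_iff_ofReal (ae_of_all _ fun x => by positivity)]
    exact hG.2
  have : IsFiniteMeasure (volume.restrict Ω) := ⟨by simpa using hΩ'⟩
  refine Integrable.mono' (((integrable_const ((1 + δ) ^ pp)).add hGi).const_mul (2 ^ pp)) hmeas ?_
  exact (ae_restrict_iff' hΩ).2 (ae_of_all _ fun x hx =>
    norm_opA_le hδ (hp1 x hx).1.le (hp1 x hx).2 (G x))

/-- The conjugate exponent is at least 1, so |f| ≤ 1 + |f|^{p'} and Ω has finite measure. -/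
theorem integrableOn_of_memLpVar_conj (hΩ : MeasurableSet Ω) (hΩ' : volume Ω < ∞)
    {p : Rd d → ℝ} (hp : ContinuousOn p Ω) (hp1 : ∀ x ∈ Ω, 1 < p x) {f : Rd d → ℝ}
    (hf : MemLpVar Ω (fun x => p x / (p x - 1)) f) : IntegrableOn f Ω := by
  have hpm : AEMeasurable p (volume.restrict Ω) := hp.aemeasurable hΩ
  have hfi : IntegrableOn (fun x => ‖f x‖ ^ (p x / (p x - 1))) Ω := by
    refine ⟨(hf.1.norm.aemeasurable.pow (hpm.div (hpm.sub_const 1))).aestronglyMeasurable, ?_⟩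
    rw [hasFiniteIntegral_iff_ofReal (ae_of_all _ fun x => by positivity)]
    exact hf.2
  have : IsFiniteMeasure (volume.restrict Ω) := ⟨by simpa using hΩ'⟩
  refine Integrable.mono' ((integrable_const 1).add hfi) hf.1 ?_
  refine (ae_restrict_iff' hΩ).2 (ae_of_all _ fun x hx => ?_)
  have h1 : 1 ≤ p x / (p x - 1) := by
    rw [le_div_iff₀ (by linarith [hp1 x hx])]; linarith
  show ‖f x‖ ≤ 1 + ‖f x‖ ^ (p x / (p x - 1))
  rcases le_or_gt ‖f x‖ 1 with h | h
  · have : 0 ≤ ‖f x‖ ^ (p x / (p x - 1)) := by positivity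
    linarith
  · have := Real.rpow_le_rpow_of_exponent_le h.le h1
    rw [Real.rpow_one] at this
    linarith

/-- The weak equation tested with a smooth function with compact support in a measurable subset. -/
theorem IsWeakSolution.integral_eq (hΩ : IsBoundedLipschitzDomain Ω)
    {δ pp : ℝ} {p f u : Rd d → ℝ} {G : Rd d → Rd d} (hp : ∀ x ∈ Ω, 0 ≤ p x ∧ p x ≤ pp)
    (hu : IsWeakSolution Ω ΓD δ p f u G) {w : Rd d → ℝ} (hw : ContDiff ℝ (⊤ : ℕ∞) w)
    (hc : HasCompactSupport w) {K : Set (Rd d)} (hs : tsupport w ⊆ K) (hK : K ⊆ Ω) :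
    ∫ x in K, inner ℝ (opA δ (p x) (G x)) (gradient w x) = ∫ x in K, f x * w x := by
  have h := hu.2 w (gradient w) (memW1D_of_hasCompactSupport hΩ hp hw hc (hs.trans hK))
  rw [setIntegral_eq_of_subset_of_forall_sdiff_eq_zero hΩ.isOpen.measurableSet hK (fun x hx => by
      rw [gradient_eq_zero_of_notMem_tsupport (fun h => hx.2 (hs h)), inner_zero_right]),
    setIntegral_eq_of_subset_of_forall_sdiff_eq_zero hΩ.isOpen.measurableSet hK (fun x hx => by
      rw [image_eq_zero_of_notMem_tsupport (fun h => hx.2 (hs h)), mul_zero])] at h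
  exact h

end

/-! ### Bumps with normal mean gradient on half balls, and thin slabs. -/

noncomputable section

variable {d : ℕ}

theorem deriv_smoothTransition_eq_zero {x : ℝ} (hx : x < 0 ∨ 1 < x) :
    deriv Real.smoothTransition x = 0 := by
  rcases hx with hx | hx
  · have : Real.smoothTransition =ᶠ[𝓝 x] fun _ => 0 := by
      filter_upwards [Iio_mem_nhds hx] with y hy
      exact Real.smoothTransition.zero_of_nonpos (le_of_lt hy)
    rw [this.deriv_eq, deriv_const]
  · have : Real.smoothTransition =ᶠ[𝓝 x] fun _ => 1 := by
      filter_upwards [Ioi_mem_nhds hx] with y hy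
      exact Real.smoothTransition.one_of_one_le (le_of_lt hy)
    rw [this.deriv_eq, deriv_const]

theorem differentiable_smoothTransition : Differentiable ℝ Real.smoothTransition :=
  (Real.smoothTransition.contDiff (n := 1)).differentiable (by simp)

theorem continuous_deriv_smoothTransition : Continuous (deriv Real.smoothTransition) :=
  (Real.smoothTransition.contDiff (n := 1)).continuous_deriv (by simp)

theorem deriv_smoothTransition_nonneg (x : ℝ) : 0 ≤ deriv Real.smoothTransition x :=
  Real.smoothTransition.monotone.deriv_nonneg

theorem exists_deriv_smoothTransition_le :
    ∃ L : ℝ, 0 < L ∧ ∀ x, |deriv Real.smoothTransition x| ≤ L := by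
  obtain ⟨L, hL⟩ := (isCompact_Icc (a := (0 : ℝ)) (b := 1)).exists_bound_of_continuousOn
    continuous_deriv_smoothTransition.continuousOn
  refine ⟨max L 1, by positivity, fun x => ?_⟩
  by_cases hx : x ∈ Icc (0 : ℝ) 1
  · exact (hL x hx).trans (le_max_left _ _)
  · rw [mem_Icc, not_and_or, not_le, not_le] at hx
    rw [deriv_smoothTransition_eq_zero hx, abs_zero]; positivity

theorem exists_deriv_smoothTransition_pos :
    ∃ x : ℝ, 0 < x ∧ x < 1 ∧ deriv Real.smoothTransition x ≠ 0 := by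
  obtain ⟨x, hx, hd⟩ := exists_deriv_eq_slope Real.smoothTransition (zero_lt_one' ℝ)
    Real.smoothTransition.continuous.continuousOn
    differentiable_smoothTransition.differentiableOn
  refine ⟨x, hx.1, hx.2, ?_⟩
  rw [hd, Real.smoothTransition.one, Real.smoothTransition.zero]
  norm_num

/-- A smooth bump on the unit ball, cut off where `m ⟪ν, z⟫ > 2`. -/
def cutBump (ν : Rd d) (m : ℝ) (z : Rd d) : ℝ :=
  Real.smoothTransition (2 - 2 * ‖z‖ ^ 2) * Real.smoothTransition (2 - m * inner ℝ ν z)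

/-- The gradient of `cutBump`. -/
def cutBumpGrad (ν : Rd d) (m : ℝ) (z : Rd d) : Rd d :=
  (-4 * deriv Real.smoothTransition (2 - 2 * ‖z‖ ^ 2) *
      Real.smoothTransition (2 - m * inner ℝ ν z)) • z +
    (-m * deriv Real.smoothTransition (2 - m * inner ℝ ν z) *
      Real.smoothTransition (2 - 2 * ‖z‖ ^ 2)) • ν

theorem contDiff_cutBump (ν : Rd d) (m : ℝ) : ContDiff ℝ (⊤ : ℕ∞) (cutBump ν m) := by
  refine ContDiff.mul (Real.smoothTransition.contDiff.comp ?_)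
    (Real.smoothTransition.contDiff.comp ?_)
  · exact contDiff_const.sub (contDiff_const.mul (contDiff_norm_sq ℝ))
  · exact contDiff_const.sub (contDiff_const.mul (contDiff_const.inner ℝ contDiff_id))

theorem continuous_cutBumpGrad (ν : Rd d) (m : ℝ) : Continuous (cutBumpGrad ν m) := by
  have h1 := continuous_deriv_smoothTransition
  have h2 := Real.smoothTransition.continuous
  unfold cutBumpGrad
  fun_prop

theorem hasGradientAt_cutBump (ν : Rd d) (m : ℝ) (z : Rd d) :
    HasGradientAt (cutBump ν m) (cutBumpGrad ν m z) z := by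
  have h1 : HasFDerivAt (fun z : Rd d => 2 - 2 * ‖z‖ ^ 2) (-((2 : ℝ) • (2 • innerSL ℝ z))) z :=
    ((hasStrictFDerivAt_norm_sq z).hasFDerivAt.const_mul 2).const_sub 2
  have h2 : HasFDerivAt (fun z : Rd d => 2 - m * inner ℝ ν z) (-(m • innerSL ℝ ν)) z :=
    ((innerSL ℝ ν).hasFDerivAt.const_mul m).const_sub 2
  have e1 := (differentiable_smoothTransition (2 - 2 * ‖z‖ ^ 2)).hasDerivAt.comp_hasFDerivAt z h1
  have e2 := (differentiable_smoothTransition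
    (2 - m * inner ℝ ν z)).hasDerivAt.comp_hasFDerivAt z h2
  rw [hasGradientAt_iff_hasFDerivAt]
  refine (e1.mul e2).congr_fderiv ?_
  ext e
  simp only [cutBumpGrad, InnerProductSpace.toDual_apply_apply, inner_add_left,
    real_inner_smul_left, _root_.add_apply, _root_.smul_apply, _root_.neg_apply,
    innerSL_apply_apply, smul_eq_mul, Function.comp, nsmul_eq_mul]
  push_cast
  ring

theorem cutBump_nonneg (ν : Rd d) (m : ℝ) (z : Rd d) : 0 ≤ cutBump ν m z :=
  mul_nonneg (Real.smoothTransition.nonneg _) (Real.smoothTransition.nonneg _)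

theorem cutBump_le_one (ν : Rd d) (m : ℝ) (z : Rd d) : cutBump ν m z ≤ 1 :=
  mul_le_one₀ (Real.smoothTransition.le_one _) (Real.smoothTransition.nonneg _)
    (Real.smoothTransition.le_one _)

theorem cutBump_eq_zero {ν : Rd d} {m : ℝ} {z : Rd d} (hz : 1 ≤ ‖z‖) : cutBump ν m z = 0 := by
  rw [cutBump, Real.smoothTransition.zero_of_nonpos (by nlinarith), zero_mul]

theorem cutBump_eq_zero_of_lt {ν : Rd d} {m : ℝ} {z : Rd d} (hz : 2 < m * inner ℝ ν z) :
    cutBump ν m z = 0 := by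
  rw [cutBump, Real.smoothTransition.zero_of_nonpos (x := 2 - m * inner ℝ ν z) (by linarith),
    mul_zero]

theorem cutBumpGrad_eq_zero {ν : Rd d} {m : ℝ} {z : Rd d} (hz : 1 < ‖z‖) :
    cutBumpGrad ν m z = 0 := by
  rw [cutBumpGrad, Real.smoothTransition.zero_of_nonpos (x := 2 - 2 * ‖z‖ ^ 2) (by nlinarith),
    deriv_smoothTransition_eq_zero (Or.inl (by nlinarith))]
  simp

theorem cutBumpGrad_eq_zero_of_lt {ν : Rd d} {m : ℝ} {z : Rd d} (hz : 2 < m * inner ℝ ν z) :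
    cutBumpGrad ν m z = 0 := by
  rw [cutBumpGrad, Real.smoothTransition.zero_of_nonpos (x := 2 - m * inner ℝ ν z) (by linarith),
    deriv_smoothTransition_eq_zero (x := 2 - m * inner ℝ ν z) (Or.inl (by linarith))]
  simp

theorem cutBumpGrad_of_nonpos {ν : Rd d} {m : ℝ} (hm : 0 ≤ m) {z : Rd d}
    (hz : inner ℝ ν z ≤ 0) :
    cutBumpGrad ν m z = (-4 * deriv Real.smoothTransition (2 - 2 * ‖z‖ ^ 2)) • z := by
  have := mul_nonpos_of_nonneg_of_nonpos hm hz
  rw [cutBumpGrad, Real.smoothTransition.one_of_one_le (x := 2 - m * inner ℝ ν z) (by linarith),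
    deriv_smoothTransition_eq_zero (x := 2 - m * inner ℝ ν z) (Or.inr (by linarith))]
  simp

/-- The constant does not depend on the dimension, the direction or m. On the side ⟨ν,z⟩ ≤ 0 the
cut-off factor is constant, so m is not seen there. -/
theorem exists_norm_cutBumpGrad_le : ∃ C : ℝ, 0 < C ∧ ∀ (d : ℕ) (ν : Rd d) (m : ℝ) (z : Rd d),
    ‖ν‖ = 1 → 0 ≤ m → ‖cutBumpGrad ν m z‖ ≤ C * (1 + m) ∧
      (inner ℝ ν z ≤ 0 → ‖cutBumpGrad ν m z‖ ≤ C) := by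
  obtain ⟨L, hL, hLb⟩ := exists_deriv_smoothTransition_le
  refine ⟨4 * L, by positivity, fun d ν m z hν hm => ?_⟩
  rcases lt_or_ge 1 ‖z‖ with hz | hz
  · rw [cutBumpGrad_eq_zero hz, norm_zero]
    exact ⟨by positivity, fun _ => by positivity⟩
  have h1 : ‖(-4 * deriv Real.smoothTransition (2 - 2 * ‖z‖ ^ 2)) • z‖ ≤ 4 * L := by
    rw [norm_smul, Real.norm_eq_abs, abs_mul, abs_neg, abs_of_pos (by norm_num : (0 : ℝ) < 4)]
    have := mul_le_mul (hLb (2 - 2 * ‖z‖ ^ 2)) hz (norm_nonneg _) hL.le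
    linarith
  constructor
  · refine (norm_add_le _ _).trans ?_
    have e1 : ‖(-4 * deriv Real.smoothTransition (2 - 2 * ‖z‖ ^ 2) *
        Real.smoothTransition (2 - m * inner ℝ ν z)) • z‖ ≤ 4 * L := by
      rw [mul_comm, mul_comm (-4) _, mul_comm, mul_comm _ (-4 : ℝ)]
      rw [mul_comm, mul_smul, norm_smul, Real.norm_eq_abs,
        abs_of_nonneg (Real.smoothTransition.nonneg _)]
      exact (mul_le_of_le_one_left (norm_nonneg _) (Real.smoothTransition.le_one _)).trans h1
    have e2 : ‖(-m * deriv Real.smoothTransition (2 - m * inner ℝ ν z) *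
        Real.smoothTransition (2 - 2 * ‖z‖ ^ 2)) • ν‖ ≤ m * L := by
      rw [norm_smul, hν, mul_one, Real.norm_eq_abs, abs_mul, abs_mul, abs_neg, abs_of_nonneg hm,
        abs_of_nonneg (Real.smoothTransition.nonneg _)]
      refine (mul_le_of_le_one_right (by positivity) (Real.smoothTransition.le_one _)).trans ?_
      exact mul_le_mul_of_nonneg_left (hLb _) hm
    have := mul_nonneg hm hL.le
    linarith
  · intro hz0
    rw [cutBumpGrad_of_nonpos hm hz0]
    exact h1

/-- The normal component of the integral of the gradient of the bump over a half space. -/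
def bumpFlux (ν : Rd d) : ℝ :=
  ∫ z : Rd d, -4 * deriv Real.smoothTransition (2 - 2 * ‖z‖ ^ 2) * min (inner ℝ ν z) 0

theorem integral_comp_isometry {F : Type*} [NormedAddCommGroup F] [NormedSpace ℝ F]
    (ρ : Rd d ≃ₗᵢ[ℝ] Rd d) (g : Rd d → F) : ∫ z, g (ρ z) = ∫ z, g z :=
  (ρ.measurePreserving).integral_comp ρ.toHomeomorph.measurableEmbedding g

/-- The reflection that exchanges ν and ν' preserves Lebesgue measure and the radial profile; hence
one constant κ serves all unit normals. -/
theorem bumpFlux_eq {ν ν' : Rd d} (h : ‖ν‖ = ‖ν'‖) : bumpFlux ν = bumpFlux ν' := by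
  set ρ := (ℝ ∙ (ν - ν'))ᗮ.reflection with hρ
  have hρν : ρ ν = ν' := Submodule.reflection_sub h
  rw [bumpFlux, bumpFlux, ← integral_comp_isometry ρ
    (fun z => -4 * deriv Real.smoothTransition (2 - 2 * ‖z‖ ^ 2) * min (inner ℝ ν' z) 0)]
  congr 1 with z
  rw [ρ.norm_map, ← hρν, ρ.inner_map_map]

/-- The integrand is a product of two nonpositive factors. It is nonzero at a point on the negative
ν-axis where the profile has nonzero slope. -/
theorem bumpFlux_pos {ν : Rd d} (hν : ‖ν‖ = 1) : 0 < bumpFlux ν := by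
  have h1 := continuous_deriv_smoothTransition
  obtain ⟨x, hx0, hx1, hx⟩ := exists_deriv_smoothTransition_pos
  set z₀ : Rd d := (-(√((2 - x) / 2))) • ν with hz₀
  have hpos : 0 < (2 - x) / 2 := by linarith
  have hn : 2 - 2 * ‖z₀‖ ^ 2 = x := by
    rw [hz₀, norm_smul, hν, mul_one, norm_neg, Real.norm_eq_abs, sq_abs, Real.sq_sqrt hpos.le]
    ring
  have hin : inner ℝ ν z₀ = -√((2 - x) / 2) := by
    rw [hz₀, inner_smul_right, real_inner_self_eq_norm_sq, hν]; ring
  refine Continuous.integral_pos_of_hasCompactSupport_nonneg_nonzero (x := z₀) (by fun_prop) ?_ ?_ ?_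
  · refine HasCompactSupport.of_support_subset_isCompact (isCompact_closedBall 0 1) fun z hz => ?_
    by_contra hz'
    rw [mem_closedBall_zero_iff, not_le] at hz'
    refine hz ?_
    show -4 * deriv Real.smoothTransition (2 - 2 * ‖z‖ ^ 2) * min (inner ℝ ν z) 0 = 0
    rw [deriv_smoothTransition_eq_zero (Or.inl (by nlinarith))]; simp
  · intro z
    have h2 : min (inner ℝ ν z) 0 ≤ 0 := min_le_right _ _
    have h3 := deriv_smoothTransition_nonneg (2 - 2 * ‖z‖ ^ 2)
    show 0 ≤ _
    exact mul_nonneg_of_nonpos_of_nonpos (by linarith) h2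
  · rw [hn, hin, min_eq_left (neg_nonpos.2 (Real.sqrt_nonneg _))]
    have : √((2 - x) / 2) ≠ 0 := (Real.sqrt_pos.2 hpos).ne'
    exact mul_ne_zero (mul_ne_zero (by norm_num) hx) (neg_ne_zero.2 this)

theorem integrable_cutBumpGrad (ν : Rd d) (m : ℝ) : Integrable (cutBumpGrad ν m) :=
  (continuous_cutBumpGrad ν m).integrable_of_hasCompactSupport
    (HasCompactSupport.of_support_subset_isCompact (isCompact_closedBall 0 1) fun z hz => by
      by_contra hz'
      rw [mem_closedBall_zero_iff, not_le] at hz'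
      exact hz (cutBumpGrad_eq_zero hz'))

theorem measurableSet_inner_le (ν : Rd d) (c : ℝ) : MeasurableSet {z : Rd d | inner ℝ ν z ≤ c} :=
  measurableSet_le (by fun_prop) measurable_const

/-- On this half space the cut-off is inactive, so the result does not depend on m. Reflection in
the hyperplane orthogonal to a tangential vector kills the tangential components. -/
theorem setIntegral_cutBumpGrad {ν : Rd d} (hν : ‖ν‖ = 1) {m : ℝ} (hm : 0 ≤ m) :
    ∫ z in {z : Rd d | inner ℝ ν z ≤ 0}, cutBumpGrad ν m z = bumpFlux ν • ν := by
  set S := {z : Rd d | inner ℝ ν z ≤ 0} with hS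
  have hSm : MeasurableSet S := measurableSet_inner_le ν 0
  set V := ∫ z in S, cutBumpGrad ν m z with hV
  have key : ∀ e : Rd d, inner ℝ e V = ∫ z : Rd d, S.indicator
      (fun z => -4 * deriv Real.smoothTransition (2 - 2 * ‖z‖ ^ 2) * inner ℝ e z) z := by
    intro e
    rw [hV, ← integral_inner (integrable_cutBumpGrad ν m).integrableOn, integral_indicator hSm]
    refine setIntegral_congr_fun hSm fun z hz => ?_
    simp only [cutBumpGrad_of_nonpos hm hz, inner_smul_right]
  have hνV : inner ℝ ν V = bumpFlux ν := by
    rw [key, bumpFlux]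
    congr 1 with z
    by_cases hz : z ∈ S
    · rw [indicator_of_mem hz, min_eq_left hz]
    · rw [indicator_of_notMem hz, min_eq_right (le_of_not_ge hz), mul_zero]
  have horth : ∀ e : Rd d, inner ℝ ν e = (0 : ℝ) → inner ℝ e V = (0 : ℝ) := by
    intro e he
    set ρ := (ℝ ∙ e)ᗮ.reflection with hρ
    have hρe : ρ e = -e := Submodule.reflection_orthogonalComplement_singleton_eq_neg e
    have hρν : ρ ν = ν := by
      refine Submodule.reflection_mem_subspace_eq_self ?_
      rw [Submodule.mem_orthogonal_singleton_iff_inner_left]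
      exact he
    have hS' : ∀ z, ρ z ∈ S ↔ z ∈ S := fun z => by
      have : inner ℝ ν (ρ z) = inner ℝ ν z := by
        conv_lhs => rw [← hρν]
        exact ρ.inner_map_map ν z
      show inner ℝ ν (ρ z) ≤ 0 ↔ inner ℝ ν z ≤ 0
      rw [this]
    have h1 := integral_comp_isometry ρ (S.indicator
      (fun z => -4 * deriv Real.smoothTransition (2 - 2 * ‖z‖ ^ 2) * inner ℝ e z))
    have h2 : ∀ z, S.indicator
        (fun z => -4 * deriv Real.smoothTransition (2 - 2 * ‖z‖ ^ 2) * inner ℝ e z) (ρ z) =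
        -S.indicator
        (fun z => -4 * deriv Real.smoothTransition (2 - 2 * ‖z‖ ^ 2) * inner ℝ e z) z := by
      intro z
      have h3 : inner ℝ e (ρ z) = -inner ℝ e z := by
        have : e = ρ (-e) := by rw [map_neg, hρe, neg_neg]
        conv_lhs => rw [this]
        rw [ρ.inner_map_map, inner_neg_left]
      by_cases hz : z ∈ S
      · rw [indicator_of_mem hz, indicator_of_mem ((hS' z).2 hz), ρ.norm_map, h3]; ring
      · rw [indicator_of_notMem hz, indicator_of_notMem (fun h => hz ((hS' z).1 h)), neg_zero]
    simp only [h2] at h1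
    rw [integral_neg] at h1
    rw [key]; linarith
  have h4 : inner ℝ ν (V - bumpFlux ν • ν) = (0 : ℝ) := by
    rw [inner_sub_right, hνV, inner_smul_right, real_inner_self_eq_norm_sq, hν]; ring
  have h5 := horth _ h4
  have h6 : inner ℝ (V - bumpFlux ν • ν) (V - bumpFlux ν • ν) = (0 : ℝ) := by
    rw [inner_sub_right, h5, inner_smul_right, real_inner_comm, h4]; ring
  exact sub_eq_zero.1 (inner_self_eq_zero.1 h6)

/-- This allows a constant flux to be subtracted in the weak equation. -/
theorem integral_gradient_eq_zero {w : Rd d → ℝ} (hw : ContDiff ℝ (⊤ : ℕ∞) w)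
    (hc : HasCompactSupport w) : ∫ x, gradient w x = 0 := by
  have hgc : HasCompactSupport (gradient w) :=
    HasCompactSupport.of_support_subset_isCompact hc fun x hx => by
      by_contra hx'
      exact hx (gradient_eq_zero_of_notMem_tsupport hx')
  have hint : Integrable (gradient w) :=
    (continuous_gradient hw).integrable_of_hasCompactSupport hgc
  refine ext_inner_left ℝ fun e => ?_
  rw [← integral_inner hint, inner_zero_right]
  have hw1 : Differentiable ℝ w := hw.differentiable (by simp)
  have h := integral_mul_fderiv_eq_neg_fderiv_mul_of_integrable (μ := (volume : Measure (Rd d)))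
    (f := fun _ : Rd d => (1 : ℝ)) (g := w) (v := e) (by simp)
    (by
      simp only [one_mul, ← inner_gradient_left]
      exact hint.inner_const e)
    (by simpa using hw.continuous.integrable_of_hasCompactSupport hc) (by simp)
    (fun x _ => hw1 x)
  simp only [one_mul, ← inner_gradient_left, real_inner_comm] at h ⊢
  simpa using h

/-- Smooth bumps on a ball whose gradients have a normal mean value over the half balls, and which
are cut off on one side of the hyperplane. -/
theorem exists_bump (d : ℕ) : ∃ C κ : ℝ, 0 < C ∧ 0 < κ ∧
    ∀ (y₀ ν : Rd d) (R m : ℝ), ‖ν‖ = 1 → 0 < R → 0 ≤ m → ∃ w : Rd d → ℝ,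
      ContDiff ℝ (⊤ : ℕ∞) w ∧ HasCompactSupport w ∧ tsupport w ⊆ Metric.closedBall y₀ R ∧
      (∀ x, 0 ≤ w x ∧ w x ≤ 1) ∧
      (∀ x, ‖gradient w x‖ ≤ C * (1 + m) / R) ∧
      (∀ x, inner ℝ ν (x - y₀) ≤ 0 → ‖gradient w x‖ ≤ C / R) ∧
      (∀ x, 2 * R < m * inner ℝ ν (x - y₀) → w x = 0 ∧ gradient w x = 0) ∧
      (m = 0 → ∀ x ∈ Metric.closedBall y₀ (R / 2), w x = 1) ∧
      ∫ x in {x | inner ℝ ν (x - y₀) ≤ 0}, gradient w x = (κ * R ^ d / R) • ν ∧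
      ∫ x in {x | 0 < inner ℝ ν (x - y₀)}, gradient w x = -((κ * R ^ d / R) • ν) := by
  obtain ⟨C, hC, hCb⟩ := exists_norm_cutBumpGrad_le
  -- Without unit vectors (d = 0) the claim is void and any constants serve.
  rcases isEmpty_or_nonempty {ν : Rd d // ‖ν‖ = 1} with hemp | ⟨⟨ν₀, hν₀⟩⟩
  · exact ⟨1, 1, one_pos, one_pos, fun y₀ ν R m hν => (hemp.false ⟨ν, hν⟩).elim⟩
  refine ⟨C, bumpFlux ν₀, hC, bumpFlux_pos hν₀, fun y₀ ν R m hν hR hm => ?_⟩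
  rw [bumpFlux_eq (hν₀.trans hν.symm)]
  set w : Rd d → ℝ := fun x => cutBump ν m (R⁻¹ • (x - y₀)) with hw
  have hin : ∀ x, inner ℝ ν (R⁻¹ • (x - y₀)) = R⁻¹ * inner ℝ ν (x - y₀) := fun x =>
    inner_smul_right _ _ _
  have hnorm : ∀ x, ‖R⁻¹ • (x - y₀)‖ = R⁻¹ * ‖x - y₀‖ := fun x => by
    rw [norm_smul, norm_inv, Real.norm_eq_abs, abs_of_pos hR]
  have hgrad : ∀ x, gradient w x = R⁻¹ • cutBumpGrad ν m (R⁻¹ • (x - y₀)) := by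
    intro x
    refine HasGradientAt.gradient ?_
    rw [hasGradientAt_iff_hasFDerivAt]
    have h1 : HasFDerivAt (fun x : Rd d => R⁻¹ • (x - y₀))
        (R⁻¹ • ContinuousLinearMap.id ℝ (Rd d)) x :=
      ((hasFDerivAt_id x).sub_const y₀).const_smul R⁻¹
    refine ((hasGradientAt_iff_hasFDerivAt.1
      (hasGradientAt_cutBump ν m (R⁻¹ • (x - y₀)))).comp x h1).congr_fderiv ?_
    ext e
    simp
  have hsupp : Function.support w ⊆ Metric.closedBall y₀ R := by
    intro x hx
    by_contra hx'
    rw [Metric.mem_closedBall, dist_eq_norm, not_le] at hx'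
    refine hx (cutBump_eq_zero ?_)
    rw [hnorm, le_inv_mul_iff₀ hR]; linarith
  have hc : HasCompactSupport w :=
    HasCompactSupport.of_support_subset_isCompact (isCompact_closedBall y₀ R) hsupp
  have hsm : ContDiff ℝ (⊤ : ℕ∞) w :=
    (contDiff_cutBump ν m).comp ((contDiff_id.sub contDiff_const).const_smul R⁻¹)
  have hSm : MeasurableSet {x : Rd d | inner ℝ ν (x - y₀) ≤ 0} :=
    measurableSet_le (by fun_prop) measurable_const
  have hneg : ∫ x in {x | inner ℝ ν (x - y₀) ≤ 0}, gradient w x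
      = (bumpFlux ν * R ^ d / R) • ν := by
    set F := {z : Rd d | inner ℝ ν z ≤ 0}.indicator (cutBumpGrad ν m) with hF
    have e1 : ∀ x, {x : Rd d | inner ℝ ν (x - y₀) ≤ 0}.indicator (gradient w) x =
        R⁻¹ • F (R⁻¹ • (x - y₀)) := by
      intro x
      by_cases hx : inner ℝ ν (x - y₀) ≤ 0
      · rw [indicator_of_mem (by exact hx), hF, indicator_of_mem, hgrad]
        show inner ℝ ν (R⁻¹ • (x - y₀)) ≤ 0
        rw [hin]
        exact mul_nonpos_of_nonneg_of_nonpos (by positivity) hx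
      · rw [indicator_of_notMem (by exact hx), hF, indicator_of_notMem, smul_zero]
        show ¬ inner ℝ ν (R⁻¹ • (x - y₀)) ≤ 0
        rw [hin, not_le]
        exact mul_pos (by positivity) (not_le.1 hx)
    rw [← integral_indicator hSm]
    simp only [e1]
    rw [integral_smul, integral_sub_right_eq_self (fun x => F (R⁻¹ • x)) y₀,
      Measure.integral_comp_inv_smul, hF, integral_indicator (measurableSet_inner_le ν 0),
      setIntegral_cutBumpGrad hν hm, smul_smul, smul_smul, finrank_euclideanSpace_fin,
      abs_of_pos (by positivity)]
    congr 1
    field_simp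
  refine ⟨w, hsm, hc, ?_, fun x => ⟨cutBump_nonneg _ _ _, cutBump_le_one _ _ _⟩, ?_, ?_, ?_, ?_,
    hneg, ?_⟩
  · exact closure_minimal hsupp Metric.isClosed_closedBall
  · intro x
    rw [hgrad, norm_smul, norm_inv, Real.norm_eq_abs, abs_of_pos hR, ← div_eq_inv_mul]
    exact div_le_div_of_nonneg_right (hCb d ν m _ hν hm).1 hR.le
  · intro x hx
    rw [hgrad, norm_smul, norm_inv, Real.norm_eq_abs, abs_of_pos hR, ← div_eq_inv_mul]
    refine div_le_div_of_nonneg_right ((hCb d ν m _ hν hm).2 ?_) hR.le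
    rw [hin]
    exact mul_nonpos_of_nonneg_of_nonpos (by positivity) hx
  · intro x hx
    have h2 : 2 < m * inner ℝ ν (R⁻¹ • (x - y₀)) := by
      rw [hin, mul_left_comm, lt_inv_mul_iff₀ hR]; linarith
    refine ⟨cutBump_eq_zero_of_lt h2, ?_⟩
    rw [hgrad, cutBumpGrad_eq_zero_of_lt h2, smul_zero]
  · intro hm0 x hx
    rw [Metric.mem_closedBall, dist_eq_norm] at hx
    have h1 : ‖R⁻¹ • (x - y₀)‖ ≤ 1 / 2 := by
      rw [hnorm, inv_mul_le_iff₀ hR]; linarith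
    have h2 := norm_nonneg (R⁻¹ • (x - y₀))
    rw [hw, hm0]
    simp only [cutBump]
    rw [Real.smoothTransition.one_of_one_le (by nlinarith),
      Real.smoothTransition.one_of_one_le (by norm_num), one_mul]
  · have hint : Integrable (gradient w) :=
      (continuous_gradient hsm).integrable_of_hasCompactSupport
        (HasCompactSupport.of_support_subset_isCompact hc fun x hx => by
          by_contra hx'
          exact hx (gradient_eq_zero_of_notMem_tsupport hx'))
    -- The flux through the side that is cut off equals minus the other one, because the total
    -- integral of the gradient vanishes; thus it does not depend on m either.
    have h1 := integral_add_compl hSm hint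
    rw [integral_gradient_eq_zero hsm hc, hneg] at h1
    have h2 : {x : Rd d | inner ℝ ν (x - y₀) ≤ 0}ᶜ = {x | 0 < inner ℝ ν (x - y₀)} := by
      ext x; simp
    rw [h2] at h1
    exact eq_neg_of_add_eq_zero_right h1

/-- The part of a half ball near its flat boundary has small measure. -/
theorem volume_slab_le {y₀ ν : Rd d} {R ε : ℝ} (hν : ‖ν‖ = 1) (hR : 0 < R) (hε : 0 ≤ ε)
    (hε1 : ε ≤ 1) :
    volume (Metric.closedBall y₀ R ∩ {x | 0 < inner ℝ ν (x - y₀) ∧ inner ℝ ν (x - y₀) < ε * R}) ≤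
      ENNReal.ofReal (d * ε) * volume (Metric.closedBall y₀ R) := by
  set H := Metric.closedBall y₀ R ∩ {x | 0 < inner ℝ ν (x - y₀)} with hH
  set A := Metric.closedBall y₀ R ∩ {x | 0 < inner ℝ ν (x - y₀) ∧ inner ℝ ν (x - y₀) < ε * R}
  -- Contraction towards the pole y₀+Rν maps the half ball into itself and lifts it above the slab.
  -- So the slab has at most the volume that is lost, a fraction 1-(1-ε)^d ≤ dε.
  set T := AffineMap.homothety (y₀ + R • ν) (1 - ε) '' H with hT
  have hνν : inner ℝ ν ν = (1 : ℝ) := by rw [real_inner_self_eq_norm_sq, hν]; norm_num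
  have hmH : MeasurableSet H :=
    Metric.isClosed_closedBall.measurableSet.inter
      (measurableSet_lt measurable_const (by fun_prop))
  have hmA : MeasurableSet (Metric.closedBall y₀ R ∩ ({x : Rd d | 0 < inner ℝ ν (x - y₀)} ∩
      {x | inner ℝ ν (x - y₀) < ε * R})) :=
    Metric.isClosed_closedBall.measurableSet.inter
      ((measurableSet_lt measurable_const (by fun_prop)).inter
        (measurableSet_lt (by fun_prop) measurable_const))
  have hfin : volume H ≠ ∞ :=
    ((measure_mono inter_subset_left).trans_lt measure_closedBall_lt_top).ne
  have hTvol : volume T = ENNReal.ofReal ((1 - ε) ^ d) * volume H := by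
    rw [hT, Measure.addHaar_image_homothety, finrank_euclideanSpace_fin,
      abs_of_nonneg (pow_nonneg (by linarith) d)]
  have hsub : T ⊆ H \ A := by
    rintro _ ⟨x, ⟨hx1, hx2⟩, rfl⟩
    have hx2 : 0 < inner ℝ ν (x - y₀) := hx2
    have e1 : AffineMap.homothety (y₀ + R • ν) (1 - ε) x - y₀ =
        (1 - ε) • (x - y₀) + (ε * R) • ν := by
      rw [AffineMap.homothety_apply, vsub_eq_sub, vadd_eq_add]
      module
    have e2 : inner ℝ ν (AffineMap.homothety (y₀ + R • ν) (1 - ε) x - y₀) =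
        (1 - ε) * inner ℝ ν (x - y₀) + ε * R := by
      rw [e1, inner_add_right, inner_smul_right, inner_smul_right, hνν, mul_one]
    have h3 : 0 ≤ (1 - ε) * inner ℝ ν (x - y₀) := mul_nonneg (by linarith) hx2.le
    refine ⟨⟨?_, ?_⟩, ?_⟩
    · rw [Metric.mem_closedBall, dist_eq_norm] at hx1 ⊢
      rw [e1]
      refine (norm_add_le _ _).trans ?_
      rw [norm_smul, norm_smul, hν, mul_one, Real.norm_eq_abs, Real.norm_eq_abs,
        abs_of_nonneg (by linarith : 0 ≤ 1 - ε), abs_of_nonneg (by positivity)]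
      have := mul_le_mul_of_nonneg_left hx1 (by linarith : 0 ≤ 1 - ε)
      linarith
    · show 0 < inner ℝ ν (AffineMap.homothety (y₀ + R • ν) (1 - ε) x - y₀)
      rw [e2]
      rcases eq_or_lt_of_le hε with h0 | h0
      · rw [← h0]; simpa using hx2
      · have := mul_pos h0 hR
        linarith
    · rintro ⟨-, -, h4⟩
      have h4 : inner ℝ ν (AffineMap.homothety (y₀ + R • ν) (1 - ε) x - y₀) < ε * R := h4
      rw [e2] at h4
      linarith
  have hAH : A ⊆ H := fun x hx => ⟨hx.1, hx.2.1⟩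
  have hsum : volume A + volume (H \ A) = volume H := by
    have := measure_inter_add_sdiff (μ := volume) H (t := A) hmA
    rwa [inter_eq_self_of_subset_right hAH] at this
  have hbern : 1 - d * ε ≤ (1 - ε) ^ d := by
    have := one_add_mul_le_pow (a := -ε) (by linarith) d
    calc 1 - d * ε = 1 + d * -ε := by ring
      _ ≤ (1 + -ε) ^ d := this
      _ = _ := by ring
  have h5 : volume A + ENNReal.ofReal ((1 - ε) ^ d) * volume H ≤ volume H := by
    rw [← hTvol, ← hsum]
    gcongr
  have h6 : volume H ≤ ENNReal.ofReal (d * ε) * volume H +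
      ENNReal.ofReal ((1 - ε) ^ d) * volume H := by
    rw [← add_mul, ← ENNReal.ofReal_add (by positivity) (pow_nonneg (by linarith) d)]
    refine le_mul_of_one_le_left zero_le ?_
    rw [ENNReal.one_le_ofReal]; linarith
  have h7 : volume A ≤ ENNReal.ofReal (d * ε) * volume H :=
    (ENNReal.add_le_add_iff_right (ENNReal.mul_ne_top ENNReal.ofReal_ne_top hfin)).1 (h5.trans h6)
  refine h7.trans ?_
  gcongr
  exact inter_subset_left

end

/-! ### The element residual. -/

noncomputable section

variable {d : ℕ} {Ω ΓD : Set (Rd d)} {δ pm pp : ℝ} {p f u : Rd d → ℝ} {G : Rd d → Rd d}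

/-- The data of a `p(·)`-Dirichlet problem, together with its solution. -/
structure IsDirichletData (Ω ΓD : Set (Rd d)) (δ pm pp : ℝ) (p f u : Rd d → ℝ)
    (G : Rd d → Rd d) : Prop where
  domain : IsBoundedLipschitzDomain Ω
  one_lt : 1 < pm
  nonneg : 0 ≤ δ
  continuousOn : ContinuousOn p (closure Ω)
  mem_Icc : ∀ x ∈ closure Ω, p x ∈ Icc pm pp
  memLp : MemLpVar Ω (fun x => p x / (p x - 1)) f
  sol : IsWeakSolution Ω ΓD δ p f u G

namespace IsDirichletData

theorem integrableOn_flux (h : IsDirichletData Ω ΓD δ pm pp p f u G) :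
    IntegrableOn (fun x => opA δ (p x) (G x)) Ω :=
  integrableOn_opA h.domain.isOpen.measurableSet h.domain.volume_lt_top h.nonneg
    (h.continuousOn.mono subset_closure)
    (fun x hx => ⟨h.one_lt.trans_le (h.mem_Icc x (subset_closure hx)).1,
      (h.mem_Icc x (subset_closure hx)).2⟩) h.sol.1.memLp_gradient

theorem integrableOn_rhs (h : IsDirichletData Ω ΓD δ pm pp p f u G) : IntegrableOn f Ω :=
  integrableOn_of_memLpVar_conj h.domain.isOpen.measurableSet h.domain.volume_lt_top
    (h.continuousOn.mono subset_closure)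
    (fun x hx => h.one_lt.trans_le (h.mem_Icc x (subset_closure hx)).1) h.memLp

theorem integral_eq (h : IsDirichletData Ω ΓD δ pm pp p f u G) {w : Rd d → ℝ}
    (hw : ContDiff ℝ (⊤ : ℕ∞) w) (hc : HasCompactSupport w) {K : Set (Rd d)}
    (hs : tsupport w ⊆ K) (hK : K ⊆ Ω) :
    ∫ x in K, inner ℝ (opA δ (p x) (G x)) (gradient w x) = ∫ x in K, f x * w x :=
  h.sol.integral_eq h.domain (fun x hx =>
    ⟨by linarith [(h.mem_Icc x (subset_closure hx)).1, h.one_lt],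
      (h.mem_Icc x (subset_closure hx)).2⟩) hw hc hs hK

theorem aestronglyMeasurable_gradient (h : IsDirichletData Ω ΓD δ pm pp p f u G)
    {K : Set (Rd d)} (hK : K ⊆ Ω) : AEStronglyMeasurable G (volume.restrict K) :=
  h.sol.1.memLp_gradient.1.mono_measure (Measure.restrict_mono hK le_rfl)

theorem aemeasurable_exponent (h : IsDirichletData Ω ΓD δ pm pp p f u G)
    {K : Set (Rd d)} (hK : K ⊆ Ω) : AEMeasurable p (volume.restrict K) :=
  ((h.continuousOn.mono subset_closure).aemeasurable h.domain.isOpen.measurableSet).mono_measure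
    (Measure.restrict_mono hK le_rfl)

/-- Elements are only known to lie in the closure of Ω; since a Lipschitz domain is the interior of
its closure, open sets inside the elements lie in Ω and carry admissible test functions. -/
theorem subset_of_subset_closure (h : IsDirichletData Ω ΓD δ pm pp p f u G) {K U : Set (Rd d)}
    (hKU : K ⊆ U) (hU : IsOpen U) (hUΩ : U ⊆ closure Ω) : K ⊆ Ω := by
  rw [← h.domain.interior_closure]
  exact hKU.trans (interior_maximal hUΩ hU)

end IsDirichletData

theorem ofReal_abs_setIntegral_le (K : Set (Rd d)) (g : Rd d → ℝ) :
    ENNReal.ofReal |∫ x in K, g x| ≤ ∫⁻ x in K, ENNReal.ofReal |g x| := by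
  simpa only [Real.enorm_eq_ofReal_abs] using
    enorm_integral_le_lintegral_enorm (μ := volume.restrict K) g

theorem setLIntegral_ofReal_const_mul (K : Set (Rd d)) {c : ℝ} (hc : 0 ≤ c) (g : Rd d → ℝ) :
    ∫⁻ x in K, ENNReal.ofReal (c * g x) = ENNReal.ofReal c * ∫⁻ x in K, ENNReal.ofReal (g x) := by
  simp only [ENNReal.ofReal_mul hc]
  exact lintegral_const_mul' _ _ ENNReal.ofReal_ne_top

/-- The integrated form of Young's inequality for the flux. -/
theorem exists_lintegral_flux_le (d : ℕ) (pm pp δ σ z : ℝ) (hδ : 0 ≤ δ)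
    (hσ : IsSmallOscillation pm σ z) : ∃ C : ℝ, 0 < C ∧
    ∀ (Ω ΓD : Set (Rd d)) (p f u : Rd d → ℝ) (G : Rd d → Rd d),
      IsDirichletData Ω ΓD δ pm pp p f u G →
    ∀ (K : Set (Rd d)) (q M ρ : ℝ) (a : Rd d), MeasurableSet K → K ⊆ Ω → pm ≤ q → q ≤ pp →
      (∀ x ∈ K, |p x - q| ≤ 2 * σ ∧ |p x - q| ≤ M) → 0 ≤ ρ →
      ∫⁻ x in K, ENNReal.ofReal (‖opA δ q a - opA δ (p x) (G x)‖ * ρ) ≤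
        ENNReal.ofReal C * (ENNReal.ofReal (shiftPow (δ + ‖a‖) q ρ) * volume K +
          (∫⁻ x in K, ENNReal.ofReal (‖opF δ q a - opF δ q (G x)‖ ^ 2)) +
          ∫⁻ x in K, ENNReal.ofReal (M ^ 2 * (1 + ‖G x‖ ^ (p x * z ^ 2)))) := by
  obtain ⟨C, hC, hCb⟩ := exists_flux_young (d := d) pm pp δ σ z hδ hσ
  refine ⟨C, hC, fun Ω ΓD p f u G hD K q M ρ a hK hKΩ hq hq' hp hρ => ?_⟩
  have hG := hD.aestronglyMeasurable_gradient hKΩ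
  have hpK := hD.aemeasurable_exponent hKΩ
  have hΦ := shiftPow_nonneg q (add_nonneg hδ (norm_nonneg a)) hρ
  have hm2 : AEMeasurable (fun x => ENNReal.ofReal (‖opF δ q a - opF δ q (G x)‖ ^ 2))
      (volume.restrict K) := by
    have h1 : AEMeasurable (fun x => (δ + ‖G x‖) ^ ((q - 2) / 2)) (volume.restrict K) :=
      (hG.norm.aemeasurable.const_add δ).pow_const _
    have h2 : AEStronglyMeasurable (fun x => opF δ q (G x)) (volume.restrict K) :=
      h1.aestronglyMeasurable.smul hG
    exact ((aestronglyMeasurable_const.sub h2).norm.aemeasurable.pow_const 2).ennreal_ofReal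
  have hm3 : AEMeasurable (fun x => ENNReal.ofReal (shiftPow (δ + ‖a‖) q ρ) +
      ENNReal.ofReal (‖opF δ q a - opF δ q (G x)‖ ^ 2)) (volume.restrict K) :=
    aemeasurable_const.add hm2
  calc ∫⁻ x in K, ENNReal.ofReal (‖opA δ q a - opA δ (p x) (G x)‖ * ρ)
      ≤ ∫⁻ x in K, ENNReal.ofReal C * ((ENNReal.ofReal (shiftPow (δ + ‖a‖) q ρ) +
          ENNReal.ofReal (‖opF δ q a - opF δ q (G x)‖ ^ 2)) +
          ENNReal.ofReal (M ^ 2 * (1 + ‖G x‖ ^ (p x * z ^ 2)))) := by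
        refine setLIntegral_mono' hK fun x hx => ?_
        rw [← ENNReal.ofReal_add hΦ (by positivity), ← ENNReal.ofReal_add (by positivity)
          (by positivity), ← ENNReal.ofReal_mul hC.le]
        refine ENNReal.ofReal_le_ofReal ?_
        obtain ⟨hP1, hP2⟩ := hD.mem_Icc x (subset_closure (hKΩ hx))
        refine (hCb (p x) q ρ a (G x) hP1 hP2 hq hq' (hp x hx).1 hρ).trans ?_
        refine mul_le_mul_of_nonneg_left (add_le_add le_rfl ?_) hC.le
        refine mul_le_mul_of_nonneg_right ?_ (by positivity)
        rw [← sq_abs]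
        exact pow_le_pow_left₀ (abs_nonneg _) (hp x hx).2 2
    _ = _ := by
        rw [lintegral_const_mul' _ _ ENNReal.ofReal_ne_top,
          lintegral_add_left' hm3, lintegral_add_left measurable_const,
          setLIntegral_const]

theorem volume_closedBall_eq (x : Rd d) {R : ℝ} (hR : 0 ≤ R) :
    volume (Metric.closedBall x R) =
      ENNReal.ofReal (R ^ d * (volume (Metric.ball (0 : Rd d) 1)).toReal) := by
  rw [Measure.addHaar_closedBall _ _ hR, finrank_euclideanSpace_fin,
    ENNReal.ofReal_mul (by positivity), ENNReal.ofReal_toReal measure_ball_lt_top.ne]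

theorem volume_unitBall_toReal_pos (d : ℕ) : 0 < (volume (Metric.ball (0 : Rd d) 1)).toReal :=
  ENNReal.toReal_pos (Metric.measure_ball_pos _ _ one_pos).ne' measure_ball_lt_top.ne

theorem exists_norm_eq_one (hd : 1 ≤ d) : ∃ ν : Rd d, ‖ν‖ = 1 :=
  ⟨EuclideanSpace.single (⟨0, hd⟩ : Fin d) 1, by simp⟩

/-- The local efficiency of the element residual. -/
theorem exists_residual_le (d : ℕ) (hd : 1 ≤ d) (pm pp δ σ z Λ : ℝ) (hδ : 0 ≤ δ) (hΛ : 0 < Λ)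
    (hσ : IsSmallOscillation pm σ z) : ∃ C : ℝ, 0 < C ∧
    ∀ (Ω ΓD : Set (Rd d)) (p f u : Rd d → ℝ) (G : Rd d → Rd d),
      IsDirichletData Ω ΓD δ pm pp p f u G →
    ∀ (T : Set (Rd d)) (x₀ a : Rd d) (r h q M c : ℝ), IsCompact T → T ⊆ closure Ω →
      0 < r → Metric.ball x₀ r ⊆ T → (∀ x ∈ T, dist x x₀ ≤ h) → h ≤ Λ * r → 0 ≤ h →
      pm ≤ q → q ≤ pp → (∀ x ∈ T, |p x - q| ≤ 2 * σ ∧ |p x - q| ≤ M) →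
      ∫⁻ _ in T, ENNReal.ofReal (fenchelConj (phiShift δ q ‖a‖) |h * c|) ≤
        ENNReal.ofReal C * ((∫⁻ x in T, ENNReal.ofReal (‖opF δ q a - opF δ q (G x)‖ ^ 2)) +
          (∫⁻ x in T, ENNReal.ofReal (M ^ 2 * (1 + ‖G x‖ ^ (p x * z ^ 2)))) +
          ∫⁻ x in T, ENNReal.ofReal (fenchelConj (phiShift δ q ‖a‖) |h * (f x - c)|)) := by
  obtain ⟨Cf, hCf, hflux⟩ := exists_lintegral_flux_le d pm pp δ σ z hδ hσ
  obtain ⟨Cb, κ, hCb, -, hbump⟩ := exists_bump d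
  obtain ⟨ν, hν⟩ := exists_norm_eq_one hd
  set V := (volume (Metric.ball (0 : Rd d) 1)).toReal with hV
  have hVpos : 0 < V := volume_unitBall_toReal_pos d
  set L := 2 * Λ * Cb * Cf + 1 with hL
  have hLpos : 0 < L := by positivity
  set D := 2 ^ d * L * (V⁻¹ + 1) with hDdef
  have hDpos : 0 < D := by positivity
  obtain ⟨C', hC', hconj⟩ := exists_fenchelConj_le pm pp hσ.one_lt_pm D hDpos
  refine ⟨C' * (2 ^ d * Λ ^ d * V), by positivity, ?_⟩
  intro Ω ΓD p f u G hD T x₀ a r h q M c hT hTΩ hr hball hTh hΛr hh hq hq' hp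
  have hq1 : 1 < q := hσ.one_lt_pm.trans_le hq
  set X1 := ∫⁻ x in T, ENNReal.ofReal (‖opF δ q a - opF δ q (G x)‖ ^ 2)
  set X2 := ∫⁻ x in T, ENNReal.ofReal (M ^ 2 * (1 + ‖G x‖ ^ (p x * z ^ 2)))
  set X3 := ∫⁻ x in T, ENNReal.ofReal (fenchelConj (phiShift δ q ‖a‖) |h * (f x - c)|)
  -- No finiteness of the error quantities is assumed; the infinite case is trivial because the
  -- constant is positive.
  by_cases hX : X1 + X2 + X3 = ∞
  · rw [hX, ENNReal.mul_top (by simpa using by positivity)]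
    exact le_top
  set X := (X1 + X2 + X3).toReal with hXdef
  have hX0 : 0 ≤ X := ENNReal.toReal_nonneg
  have hXe : X1 + X2 + X3 = ENNReal.ofReal X := (ENNReal.ofReal_toReal hX).symm
  set R := r / 2 with hR
  have hRpos : 0 < R := by positivity
  set K := Metric.closedBall x₀ R with hK
  have hKb : K ⊆ Metric.ball x₀ r := Metric.closedBall_subset_ball (by linarith)
  have hKT : K ⊆ T := hKb.trans hball
  have hKΩ : K ⊆ Ω := hD.subset_of_subset_closure hKb Metric.isOpen_ball (hball.trans hTΩ)
  have hKm : MeasurableSet K := Metric.isClosed_closedBall.measurableSet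
  have hKvol : volume K = ENNReal.ofReal (R ^ d * V) := volume_closedBall_eq x₀ hRpos.le
  -- With m = 0 the cut-off disappears and the bump equals 1 on the ball of half the radius, so its
  -- integral is bounded below.
  obtain ⟨w, hw, hwc, hws, hw01, hwg, -, -, hw1, -, -⟩ := hbump x₀ ν R 0 hν hRpos le_rfl
  have hwg : ∀ x, ‖gradient w x‖ ≤ Cb / R := fun x => by simpa using hwg x
  have hgz : ∀ x ∉ K, gradient w x = 0 := fun x hx =>
    gradient_eq_zero_of_notMem_tsupport fun h => hx (hws h)
  have hgi : Integrable (gradient w) := (continuous_gradient hw).integrable_of_hasCompactSupport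
    (HasCompactSupport.of_support_subset_isCompact (isCompact_closedBall x₀ R) fun x hx => by
      by_contra hx'
      exact hx (hgz x hx'))
  have hwi : Integrable w := hw.continuous.integrable_of_hasCompactSupport hwc
  have hg0 : ∫ x in K, gradient w x = 0 := by
    rw [setIntegral_eq_integral_of_forall_compl_eq_zero hgz, integral_gradient_eq_zero hw hwc]
  have hAi : IntegrableOn (fun x => inner ℝ (opA δ (p x) (G x)) (gradient w x)) K := by
    refine Integrable.mono' ((hD.integrableOn_flux.mono_set hKΩ).norm.mul_const (Cb / R)) ?_ ?_
    · exact (hD.integrableOn_flux.mono_set hKΩ).1.inner hgi.1.restrict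
    · refine ae_of_all _ fun x => (norm_inner_le_norm _ _).trans ?_
      exact mul_le_mul_of_nonneg_left (hwg x) (norm_nonneg _)
  have hfi : IntegrableOn (fun x => f x * w x) K := by
    refine Integrable.mono' (hD.integrableOn_rhs.mono_set hKΩ).norm ?_ ?_
    · exact (hD.integrableOn_rhs.mono_set hKΩ).1.mul hwi.1.restrict
    · refine ae_of_all _ fun x => ?_
      rw [norm_mul, Real.norm_of_nonneg (hw01 x).1]
      exact mul_le_of_le_one_right (norm_nonneg _) (hw01 x).2
  have hweak := hD.integral_eq hw hwc hws hKΩ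
  -- The weak equation, with the constant discrete flux inserted for free and f split into its mean
  -- c and the oscillation f-c.
  have hid : c * ∫ x in K, w x =
      -(∫ x in K, inner ℝ (opA δ q a - opA δ (p x) (G x)) (gradient w x))
        - ∫ x in K, (f x - c) * w x := by
    have e1 : ∫ x in K, inner ℝ (opA δ q a - opA δ (p x) (G x)) (gradient w x) =
        -∫ x in K, inner ℝ (opA δ (p x) (G x)) (gradient w x) := by
      simp only [inner_sub_left]
      rw [integral_sub (hgi.integrableOn.const_inner _) hAi,
        integral_inner hgi.integrableOn, hg0, inner_zero_right, zero_sub]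
    have e2 : ∫ x in K, (f x - c) * w x = (∫ x in K, f x * w x) - c * ∫ x in K, w x := by
      simp only [sub_mul]
      rw [integral_sub hfi (hwi.integrableOn.const_mul c), integral_const_mul]
    rw [e1, e2, hweak]; ring
  have hwlow : (R / 2) ^ d * V ≤ ∫ x in K, w x := by
    have hsub : Metric.closedBall x₀ (R / 2) ⊆ K := Metric.closedBall_subset_closedBall (by linarith)
    have e1 : ∫ x in Metric.closedBall x₀ (R / 2), w x = (R / 2) ^ d * V := by
      rw [setIntegral_congr_fun (g := fun _ => 1) Metric.isClosed_closedBall.measurableSet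
        (fun x hx => hw1 rfl x hx), setIntegral_const, Measure.real,
        volume_closedBall_eq x₀ (by positivity), ENNReal.toReal_ofReal (by positivity)]
      simp [hV]
    rw [← e1]
    exact setIntegral_mono_set hwi.integrableOn (ae_of_all _ fun x => (hw01 x).1)
      hsub.eventuallyLE
  -- The parameter ρ stays free: an inequality of this form for every ρ is equivalent, up to
  -- constants, to a bound for the conjugate of the shifted N-function at h c.
  have hmain : ∀ ρ : ℝ, 0 ≤ ρ →
      |h * c| * ρ ≤ D * (X / R ^ d + shiftPow (δ + ‖a‖) q ρ) := by
    intro ρ hρ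
    have hΦ := shiftPow_nonneg q (add_nonneg hδ (norm_nonneg a)) hρ
    set Φ := shiftPow (δ + ‖a‖) q ρ with hΦdef
    have hI1 : ENNReal.ofReal |h * ρ * ∫ x in K,
        inner ℝ (opA δ q a - opA δ (p x) (G x)) (gradient w x)| ≤
        ENNReal.ofReal (2 * Λ * Cb * Cf) *
          (ENNReal.ofReal (Φ * (R ^ d * V)) + (X1 + X2)) := by
      rw [← integral_const_mul]
      calc _ ≤ ∫⁻ x in K, ENNReal.ofReal
            (2 * Λ * Cb * (‖opA δ q a - opA δ (p x) (G x)‖ * ρ)) := by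
            refine (ofReal_abs_setIntegral_le K _).trans (lintegral_mono fun x => ?_)
            refine ENNReal.ofReal_le_ofReal ?_
            rw [abs_mul, abs_of_nonneg (mul_nonneg hh hρ)]
            have h1 := (abs_real_inner_le_norm (opA δ q a - opA δ (p x) (G x)) (gradient w x)).trans
              (mul_le_mul_of_nonneg_left (hwg x) (norm_nonneg _))
            have h2 : h * (Cb / R) ≤ 2 * Λ * Cb := by
              rw [mul_div_assoc', div_le_iff₀ hRpos]
              have := mul_le_mul_of_nonneg_right hΛr hCb.le
              rw [hR]; linarith
            calc h * ρ * |inner ℝ (opA δ q a - opA δ (p x) (G x)) (gradient w x)|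
                ≤ h * ρ * (‖opA δ q a - opA δ (p x) (G x)‖ * (Cb / R)) :=
                  mul_le_mul_of_nonneg_left h1 (mul_nonneg hh hρ)
              _ = h * (Cb / R) * (‖opA δ q a - opA δ (p x) (G x)‖ * ρ) := by ring
              _ ≤ _ := mul_le_mul_of_nonneg_right h2 (by positivity)
        _ ≤ ENNReal.ofReal (2 * Λ * Cb) * (ENNReal.ofReal Cf *
            (ENNReal.ofReal Φ * volume K + X1 + X2)) := by
            rw [setLIntegral_ofReal_const_mul K (by positivity)]
            gcongr
            refine (hflux Ω ΓD p f u G hD K q M ρ a hKm hKΩ hq hq'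
              (fun x hx => hp x (hKT hx)) hρ).trans ?_
            gcongr <;> exact lintegral_mono_set hKT
        _ = _ := by
            rw [hKvol, ← ENNReal.ofReal_mul hΦ, ← mul_assoc, ← ENNReal.ofReal_mul (by positivity),
              add_assoc]
    have hI2 : ENNReal.ofReal |h * ρ * ∫ x in K, (f x - c) * w x| ≤
        ENNReal.ofReal (Φ * (R ^ d * V)) + X3 := by
      rw [← integral_const_mul]
      calc _ ≤ ∫⁻ x in K, (ENNReal.ofReal Φ +
            ENNReal.ofReal (fenchelConj (phiShift δ q ‖a‖) |h * (f x - c)|)) := by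
            refine (ofReal_abs_setIntegral_le K _).trans (lintegral_mono fun x => ?_)
            rw [← ENNReal.ofReal_add hΦ (fenchelConj_nonneg hq1 hδ (norm_nonneg a) _)]
            refine ENNReal.ofReal_le_ofReal ?_
            have h1 := mul_le_fenchelConj_add hq1 hδ (norm_nonneg a) hρ |h * (f x - c)|
            have h2 : |h * ρ * ((f x - c) * w x)| ≤ |h * (f x - c)| * ρ := by
              rw [show h * ρ * ((f x - c) * w x) = h * (f x - c) * ρ * w x by ring, abs_mul,
                abs_mul, abs_of_nonneg hρ, abs_of_nonneg (hw01 x).1]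
              exact mul_le_of_le_one_right (by positivity) (hw01 x).2
            linarith
        _ = ENNReal.ofReal Φ * volume K +
            ∫⁻ x in K, ENNReal.ofReal (fenchelConj (phiShift δ q ‖a‖) |h * (f x - c)|) := by
            rw [lintegral_add_left measurable_const, setLIntegral_const]
        _ ≤ _ := by
            rw [hKvol, ← ENNReal.ofReal_mul hΦ]
            exact add_le_add le_rfl (lintegral_mono_set hKT)
    have hΦV : 0 ≤ Φ * (R ^ d * V) := by positivity
    have hreal : |h * c| * ρ * ((R / 2) ^ d * V) ≤ L * (Φ * (R ^ d * V) + X) := by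
      have e0 : h * ρ * (c * ∫ x in K, w x) =
          -(h * ρ * ∫ x in K, inner ℝ (opA δ q a - opA δ (p x) (G x)) (gradient w x)) -
            h * ρ * ∫ x in K, (f x - c) * w x := by
        rw [hid]; ring
      have e1 : |h * c| * ρ * ((R / 2) ^ d * V) ≤ |h * ρ * (c * ∫ x in K, w x)| := by
        have hw0 : 0 ≤ ∫ x in K, w x := le_trans (by positivity) hwlow
        rw [show h * ρ * (c * ∫ x in K, w x) = h * c * ρ * ∫ x in K, w x by ring,
          abs_mul (h * c * ρ),
          abs_mul (h * c) ρ, abs_of_nonneg hρ, abs_of_nonneg hw0]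
        exact mul_le_mul_of_nonneg_left hwlow (by positivity)
      refine e1.trans ?_
      rw [← ENNReal.ofReal_le_ofReal_iff (by positivity), e0]
      refine (ENNReal.ofReal_le_ofReal (abs_sub _ _)).trans ?_
      rw [abs_neg, ENNReal.ofReal_add (abs_nonneg _) (abs_nonneg _)]
      refine (add_le_add hI1 hI2).trans ?_
      have h1 : X1 + X2 ≤ ENNReal.ofReal X := hXe ▸ le_self_add
      have h2 : X3 ≤ ENNReal.ofReal X := hXe ▸ le_add_self
      calc _ ≤ ENNReal.ofReal (2 * Λ * Cb * Cf) *
            (ENNReal.ofReal (Φ * (R ^ d * V)) + ENNReal.ofReal X) +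
            (ENNReal.ofReal (Φ * (R ^ d * V)) + ENNReal.ofReal X) := by gcongr
        _ = _ := by
            rw [← ENNReal.ofReal_add hΦV hX0, ← ENNReal.ofReal_mul (by positivity),
              ← ENNReal.ofReal_add (by positivity) (by positivity)]
            congr 1
            rw [hL]; ring
    have hRd : 0 < R ^ d := by positivity
    have h3 : |h * c| * ρ = 2 ^ d * V⁻¹ * (R ^ d)⁻¹ * (|h * c| * ρ * ((R / 2) ^ d * V)) := by
      have h4 : (R / 2) ^ d = R ^ d / 2 ^ d := div_pow _ _ _
      rw [h4]; field_simp
    rw [h3]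
    calc _ ≤ 2 ^ d * V⁻¹ * (R ^ d)⁻¹ * (L * (Φ * (R ^ d * V) + X)) :=
          mul_le_mul_of_nonneg_left hreal (by positivity)
      _ = 2 ^ d * L * (Φ + V⁻¹ * (X / R ^ d)) := by field_simp
      _ ≤ D * (X / R ^ d + Φ) := by
          rw [hDdef]
          have h5 : 0 ≤ X / R ^ d := by positivity
          have h6 : 0 < V⁻¹ := by positivity
          have h4 : Φ + V⁻¹ * (X / R ^ d) ≤ (V⁻¹ + 1) * (X / R ^ d + Φ) := by
            have := mul_nonneg h6.le hΦ
            linarith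
          calc _ ≤ 2 ^ d * L * ((V⁻¹ + 1) * (X / R ^ d + Φ)) :=
                mul_le_mul_of_nonneg_left h4 (by positivity)
            _ = _ := by ring
  have hconj0 := fenchelConj_nonneg hq1 hδ (norm_nonneg a) |h * c|
  have hfen : fenchelConj (phiShift δ q ‖a‖) |h * c| ≤ C' * (X / R ^ d) :=
    hconj δ q ‖a‖ |h * c| (X / R ^ d) hq hq' hδ (norm_nonneg a) (by positivity) hmain
  have hTsub : T ⊆ Metric.closedBall x₀ h := fun x hx => hTh x hx
  have hTvol : volume T ≤ ENNReal.ofReal ((Λ * r) ^ d * V) := by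
    refine (measure_mono hTsub).trans ?_
    rw [volume_closedBall_eq x₀ hh]
    refine ENNReal.ofReal_le_ofReal ?_
    exact mul_le_mul_of_nonneg_right (pow_le_pow_left₀ hh hΛr d) hVpos.le
  rw [setLIntegral_const, hXe, ← ENNReal.ofReal_mul (by positivity)]
  calc _ ≤ ENNReal.ofReal (C' * (X / R ^ d)) * ENNReal.ofReal ((Λ * r) ^ d * V) := by
        gcongr
    _ = _ := by
        rw [← ENNReal.ofReal_mul (by positivity)]
        congr 1
        rw [hR, div_pow, mul_pow]
        field_simp

end

/-! ### Testing across an interface. -/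

noncomputable section

variable {d : ℕ} {Ω ΓD : Set (Rd d)} {δ pm pp σ z : ℝ} {p f u : Rd d → ℝ} {G : Rd d → Rd d}

/-- Two sets that contain the two halves of a ball in a domain, with an exponent that oscillates
by at most `σ` on each of them. -/
structure IsPatch (Ω : Set (Rd d)) (p : Rd d → ℝ) (σ pm pp : ℝ) (T₁ T₂ : Set (Rd d))
    (y₀ ν : Rd d) (R h₁ h₂ q₁ q₂ M₁ M₂ : ℝ) : Prop where
  norm_eq : ‖ν‖ = 1
  pos : 0 < R
  subset₁ : ∀ x ∈ Metric.closedBall y₀ (2 * R), 0 ≤ inner ℝ ν (x - y₀) → x ∈ T₁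
  subset₂ : ∀ x ∈ Metric.closedBall y₀ (2 * R), inner ℝ ν (x - y₀) ≤ 0 → x ∈ T₂
  subset_closure₁ : T₁ ⊆ closure Ω
  subset_closure₂ : T₂ ⊆ closure Ω
  le₁ : R ≤ h₁
  le₂ : R ≤ h₂
  mem₁ : q₁ ∈ Icc pm pp
  mem₂ : q₂ ∈ Icc pm pp
  close₁ : ∀ x ∈ T₁, |p x - q₁| ≤ σ ∧ |p x - q₁| ≤ M₁ ∧ |p x - p y₀| ≤ σ
  close₂ : ∀ x ∈ T₂, |p x - q₂| ≤ σ ∧ |p x - q₂| ≤ M₂ ∧ |p x - p y₀| ≤ σ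

namespace IsPatch

variable {T₁ T₂ : Set (Rd d)} {y₀ ν : Rd d} {R h₁ h₂ q₁ q₂ M₁ M₂ : ℝ}

/-- Exchanging the elements reverses the normal, so that estimates on a patch have to be proved only
for the first element. -/
theorem symm (h : IsPatch Ω p σ pm pp T₁ T₂ y₀ ν R h₁ h₂ q₁ q₂ M₁ M₂) :
    IsPatch Ω p σ pm pp T₂ T₁ y₀ (-ν) R h₂ h₁ q₂ q₁ M₂ M₁ :=
  ⟨by rw [norm_neg, h.norm_eq], h.pos,
    fun x hx hn => h.subset₂ x hx (by rw [inner_neg_left] at hn; linarith),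
    fun x hx hn => h.subset₁ x hx (by rw [inner_neg_left] at hn; linarith),
    h.subset_closure₂, h.subset_closure₁, h.le₂, h.le₁, h.mem₂, h.mem₁, h.close₂, h.close₁⟩

theorem centre_mem₁ (h : IsPatch Ω p σ pm pp T₁ T₂ y₀ ν R h₁ h₂ q₁ q₂ M₁ M₂) : y₀ ∈ T₁ :=
  h.subset₁ y₀ (Metric.mem_closedBall_self (by linarith [h.pos])) (by simp)

theorem ball_subset (h : IsPatch Ω p σ pm pp T₁ T₂ y₀ ν R h₁ h₂ q₁ q₂ M₁ M₂)
    (hD : IsDirichletData Ω ΓD δ pm pp p f u G) : Metric.closedBall y₀ R ⊆ Ω := by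
  -- The patch is given on the doubled radius because an open ball inside the closure of Ω is
  -- required.
  refine hD.subset_of_subset_closure (U := Metric.ball y₀ (2 * R))
    (Metric.closedBall_subset_ball (by linarith [h.pos])) Metric.isOpen_ball fun x hx => ?_
  have hx' := Metric.ball_subset_closedBall hx
  rcases le_total 0 (inner ℝ ν (x - y₀)) with h0 | h0
  · exact h.subset_closure₁ (h.subset₁ x hx' h0)
  · exact h.subset_closure₂ (h.subset₂ x hx' h0)

/-- The ball of radius R/2 around y₀+(R/2)ν lies in the half ball. The lower bound turns the
integral of a constant over T₁ into a pointwise estimate. -/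
theorem volume_ge (h : IsPatch Ω p σ pm pp T₁ T₂ y₀ ν R h₁ h₂ q₁ q₂ M₁ M₂) :
    ENNReal.ofReal ((R / 2) ^ d * (volume (Metric.ball (0 : Rd d) 1)).toReal) ≤ volume T₁ := by
  have hR := h.pos
  rw [← volume_closedBall_eq (y₀ + (R / 2) • ν) (by positivity)]
  refine measure_mono fun x hx => ?_
  rw [Metric.mem_closedBall, dist_eq_norm] at hx
  have hνν : inner ℝ ν ν = (1 : ℝ) := by rw [real_inner_self_eq_norm_sq, h.norm_eq]; norm_num
  have e1 : x - y₀ = (x - (y₀ + (R / 2) • ν)) + (R / 2) • ν := by abel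
  refine h.subset₁ x ?_ ?_
  · rw [Metric.mem_closedBall, dist_eq_norm, e1]
    refine (norm_add_le _ _).trans ?_
    rw [norm_smul, h.norm_eq, Real.norm_eq_abs, abs_of_pos (by positivity)]
    linarith
  · rw [e1, inner_add_right, inner_smul_right, hνν]
    have h1 := (abs_real_inner_le_norm ν (x - (y₀ + (R / 2) • ν))).trans_eq
      (by rw [h.norm_eq, one_mul])
    have h2 := neg_abs_le (inner ℝ ν (x - (y₀ + (R / 2) • ν)))
    linarith

end IsPatch

/-- The sum of the error quantities on one element. -/
def localError (δ z : ℝ) (p f : Rd d → ℝ) (G : Rd d → Rd d) (T : Set (Rd d)) (a : Rd d)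
    (h q M c : ℝ) : ℝ≥0∞ :=
  (∫⁻ x in T, ENNReal.ofReal (‖opF δ q a - opF δ q (G x)‖ ^ 2)) +
  (∫⁻ x in T, ENNReal.ofReal (M ^ 2 * (1 + ‖G x‖ ^ (p x * z ^ 2)))) +
  (∫⁻ _ in T, ENNReal.ofReal (M ^ 2 * (1 + ‖a‖ ^ (q * z ^ 2)))) +
  (∫⁻ _ in T, ENNReal.ofReal (fenchelConj (phiShift δ q ‖a‖) |h * c|)) +
  (∫⁻ x in T, ENNReal.ofReal (fenchelConj (phiShift δ q ‖a‖) |h * (f x - c)|))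

/-- The Fenchel–Young inequality is applied separately to h c and h(f-c). The first is the element
residual, and through it the first estimate of the theorem enters the second. -/
theorem lintegral_rhs_le {T K : Set (Rd d)} {a : Rd d} {h q M c R ρ : ℝ} (hq : 1 < q)
    (hδ : 0 ≤ δ) (hR : 0 ≤ R) (hRh : R ≤ h) (hρ : 0 ≤ ρ) (hKT : K ⊆ T) :
    ∫⁻ x in K, ENNReal.ofReal (R * ρ * |f x|) ≤
      localError δ z p f G T a h q M c +
        ENNReal.ofReal (2 * shiftPow (δ + ‖a‖) q ρ) * volume K := by
  have hΦ := shiftPow_nonneg q (add_nonneg hδ (norm_nonneg a)) hρ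
  calc ∫⁻ x in K, ENNReal.ofReal (R * ρ * |f x|)
      ≤ ∫⁻ x in K, ((ENNReal.ofReal (2 * shiftPow (δ + ‖a‖) q ρ) +
          ENNReal.ofReal (fenchelConj (phiShift δ q ‖a‖) |h * c|)) +
          ENNReal.ofReal (fenchelConj (phiShift δ q ‖a‖) |h * (f x - c)|)) := by
        refine lintegral_mono fun x => ?_
        have c1 := fenchelConj_nonneg hq hδ (norm_nonneg a) |h * c|
        have c2 := fenchelConj_nonneg hq hδ (norm_nonneg a) |h * (f x - c)|
        rw [← ENNReal.ofReal_add (by positivity) c1, ← ENNReal.ofReal_add (by positivity) c2]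
        refine ENNReal.ofReal_le_ofReal ?_
        have h1 := mul_le_fenchelConj_add hq hδ (norm_nonneg a) hρ |h * c|
        have h2 := mul_le_fenchelConj_add hq hδ (norm_nonneg a) hρ |h * (f x - c)|
        have h3 : R * |f x| ≤ |h * c| + |h * (f x - c)| := by
          calc R * |f x| ≤ h * |f x| := mul_le_mul_of_nonneg_right hRh (abs_nonneg _)
            _ = |h * c + h * (f x - c)| := by
              rw [← mul_add, add_sub_cancel, abs_mul, abs_of_nonneg (hR.trans hRh)]
            _ ≤ _ := abs_add_le _ _
        have h4 := mul_le_mul_of_nonneg_right h3 hρ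
        calc R * ρ * |f x| = R * |f x| * ρ := by ring
          _ ≤ _ := h4
          _ ≤ _ := by rw [add_mul]; linarith
    _ = ENNReal.ofReal (2 * shiftPow (δ + ‖a‖) q ρ) * volume K +
          (∫⁻ _ in K, ENNReal.ofReal (fenchelConj (phiShift δ q ‖a‖) |h * c|)) +
          ∫⁻ x in K, ENNReal.ofReal (fenchelConj (phiShift δ q ‖a‖) |h * (f x - c)|) := by
        rw [lintegral_add_left (f := fun _ => ENNReal.ofReal (2 * shiftPow (δ + ‖a‖) q ρ) +
            ENNReal.ofReal (fenchelConj (phiShift δ q ‖a‖) |h * c|)) measurable_const,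
          lintegral_add_left measurable_const, setLIntegral_const]
    _ ≤ ENNReal.ofReal (2 * shiftPow (δ + ‖a‖) q ρ) * volume K +
          (∫⁻ _ in T, ENNReal.ofReal (fenchelConj (phiShift δ q ‖a‖) |h * c|)) +
          ∫⁻ x in T, ENNReal.ofReal (fenchelConj (phiShift δ q ‖a‖) |h * (f x - c)|) :=
        add_le_add (add_le_add le_rfl (lintegral_mono_set hKT)) (lintegral_mono_set hKT)
    _ ≤ _ := by
        have key : ∀ a b c d e g : ℝ≥0∞, g + d + e ≤ a + b + c + d + e + g := fun a b c d e g =>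
          calc g + d + e = 0 + (d + e + g) := by ring
            _ ≤ a + b + c + (d + e + g) := add_le_add zero_le le_rfl
            _ = _ := by ring
        exact key _ _ _ _ _ _

/-- The test of the equation with a bump across the interface of a patch. -/
theorem exists_lintegral_jump_le (d : ℕ) : ∃ Cb κ : ℝ, 0 < Cb ∧ 0 < κ ∧
    ∀ (Ω ΓD : Set (Rd d)) (δ pm pp σ : ℝ) (p f u : Rd d → ℝ) (G : Rd d → Rd d),
      IsDirichletData Ω ΓD δ pm pp p f u G →
    ∀ (T₁ T₂ : Set (Rd d)) (y₀ ν : Rd d) (R h₁ h₂ q₁ q₂ M₁ M₂ : ℝ),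
      IsPatch Ω p σ pm pp T₁ T₂ y₀ ν R h₁ h₂ q₁ q₂ M₁ M₂ →
    ∀ (m ρ : ℝ) (A B : Rd d), 0 ≤ m → 0 ≤ ρ →
      ENNReal.ofReal (|inner ℝ (A - B) ν| * ρ * (κ * R ^ d)) ≤
        ENNReal.ofReal Cb * (∫⁻ x in Metric.closedBall y₀ R ∩ {x | inner ℝ ν (x - y₀) ≤ 0},
          ENNReal.ofReal (‖A - opA δ (p x) (G x)‖ * ρ)) +
        ENNReal.ofReal (Cb * (1 + m)) *
          (∫⁻ x in Metric.closedBall y₀ R ∩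
            {x | 0 < inner ℝ ν (x - y₀) ∧ m * inner ℝ ν (x - y₀) ≤ 2 * R},
          ENNReal.ofReal (‖B - opA δ (p x) (G x)‖ * ρ)) +
        (∫⁻ x in Metric.closedBall y₀ R ∩ {x | inner ℝ ν (x - y₀) ≤ 0},
          ENNReal.ofReal (R * ρ * |f x|)) +
        (∫⁻ x in Metric.closedBall y₀ R ∩
            {x | 0 < inner ℝ ν (x - y₀) ∧ m * inner ℝ ν (x - y₀) ≤ 2 * R},
          ENNReal.ofReal (R * ρ * |f x|)) := by
  obtain ⟨Cb, κ, hCb, hκ, hbump⟩ := exists_bump d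
  refine ⟨Cb, κ, hCb, hκ, ?_⟩
  intro Ω ΓD δ pm pp σ p f u G hD T₁ T₂ y₀ ν R h₁ h₂ q₁ q₂ M₁ M₂ hP m ρ A B hm hρ
  have hR := hP.pos
  obtain ⟨w, hw, hwc, hws, hw01, hwg, hwg0, hwz, -, hneg, hposi⟩ := hbump y₀ ν R m hP.norm_eq hR hm
  set K := Metric.closedBall y₀ R with hK
  set K2 := K ∩ {x | inner ℝ ν (x - y₀) ≤ 0} with hK2
  set K1 := K ∩ {x | 0 < inner ℝ ν (x - y₀)} with hK1
  set K1s := K ∩ {x | 0 < inner ℝ ν (x - y₀) ∧ m * inner ℝ ν (x - y₀) ≤ 2 * R} with hK1s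
  have hKΩ : K ⊆ Ω := hP.ball_subset hD
  have hKm : MeasurableSet K := Metric.isClosed_closedBall.measurableSet
  have hSm : MeasurableSet {x : Rd d | inner ℝ ν (x - y₀) ≤ 0} :=
    measurableSet_le (by fun_prop) measurable_const
  have hSm' : MeasurableSet {x : Rd d | 0 < inner ℝ ν (x - y₀)} :=
    measurableSet_lt measurable_const (by fun_prop)
  have hK2m : MeasurableSet K2 := hKm.inter hSm
  have hK1m : MeasurableSet K1 := hKm.inter hSm'
  have hKu : K2 ∪ K1 = K := by
    ext x
    constructor
    · rintro (hx | hx) <;> exact hx.1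
    · intro hx
      rcases le_or_gt (inner ℝ ν (x - y₀)) 0 with h | h
      · exact Or.inl ⟨hx, h⟩
      · exact Or.inr ⟨hx, h⟩
  have hKd : Disjoint K2 K1 := by
    rw [Set.disjoint_left]
    rintro x ⟨-, hx⟩ ⟨-, hx'⟩
    exact absurd (show inner ℝ ν (x - y₀) ≤ 0 from hx) (not_le.2 hx')
  have hgz : ∀ x ∉ K, gradient w x = 0 := fun x hx =>
    gradient_eq_zero_of_notMem_tsupport fun h => hx (hws h)
  have hgi : Integrable (gradient w) := (continuous_gradient hw).integrable_of_hasCompactSupport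
    (HasCompactSupport.of_support_subset_isCompact (isCompact_closedBall y₀ R) fun x hx => by
      by_contra hx'
      exact hx (hgz x hx'))
  have hwi : Integrable w := hw.continuous.integrable_of_hasCompactSupport hwc
  have hAi : IntegrableOn (fun x => inner ℝ (opA δ (p x) (G x)) (gradient w x)) K := by
    refine Integrable.mono' ((hD.integrableOn_flux.mono_set hKΩ).norm.mul_const
      (Cb * (1 + m) / R)) ?_ ?_
    · exact (hD.integrableOn_flux.mono_set hKΩ).1.inner hgi.1.restrict
    · refine ae_of_all _ fun x => (norm_inner_le_norm _ _).trans ?_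
      exact mul_le_mul_of_nonneg_left (hwg x) (norm_nonneg _)
  have hfi : IntegrableOn (fun x => f x * w x) K := by
    refine Integrable.mono' (hD.integrableOn_rhs.mono_set hKΩ).norm ?_ ?_
    · exact (hD.integrableOn_rhs.mono_set hKΩ).1.mul hwi.1.restrict
    · refine ae_of_all _ fun x => ?_
      rw [norm_mul, Real.norm_of_nonneg (hw01 x).1]
      exact mul_le_of_le_one_right (norm_nonneg _) (hw01 x).2
  have hK2K : K2 ⊆ K := inter_subset_left
  have hK1K : K1 ⊆ K := inter_subset_left
  have hg2 : ∫ x in K2, gradient w x = (κ * R ^ d / R) • ν := by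
    rw [← hneg]
    refine (setIntegral_eq_of_subset_of_forall_sdiff_eq_zero hSm inter_subset_right
      fun x hx => hgz x fun hxK => hx.2 ⟨hxK, hx.1⟩).symm
  have hg1 : ∫ x in K1, gradient w x = -((κ * R ^ d / R) • ν) := by
    rw [← hposi]
    refine (setIntegral_eq_of_subset_of_forall_sdiff_eq_zero hSm' inter_subset_right
      fun x hx => hgz x fun hxK => hx.2 ⟨hxK, hx.1⟩).symm
  have hsplit : ∀ (E : Set (Rd d)) (D : Rd d), E ⊆ K →
      ∫ x in E, inner ℝ (D - opA δ (p x) (G x)) (gradient w x) =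
        inner ℝ D (∫ x in E, gradient w x) -
          ∫ x in E, inner ℝ (opA δ (p x) (G x)) (gradient w x) := by
    intro E D hE
    simp only [inner_sub_left]
    rw [integral_sub (hgi.integrableOn.const_inner _) (hAi.mono_set hE),
      integral_inner hgi.integrableOn]
  have hweak := hD.integral_eq hw hwc hws hKΩ
  rw [← hKu, setIntegral_union hKd hK1m (hAi.mono_set hK2K) (hAi.mono_set hK1K),
    setIntegral_union hKd hK1m (hfi.mono_set hK2K) (hfi.mono_set hK1K)] at hweak
  -- Beyond the strip both the bump and its gradient vanish, so integrals over the positive half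
  -- ball reduce to the strip.
  have hcut : ∀ g : Rd d → ℝ, (∀ x, 2 * R < m * inner ℝ ν (x - y₀) → g x = 0) →
      ∫ x in K1, g x = ∫ x in K1s, g x := by
    intro g hg
    refine setIntegral_eq_of_subset_of_forall_sdiff_eq_zero hK1m
      (fun x hx => ⟨hx.1, hx.2.1⟩) fun x hx => hg x ?_
    by_contra! hlt
    exact hx.2 ⟨hx.1.1, hx.1.2, hlt⟩
  -- Any two constant vectors A and B may be inserted on the two half balls, because the integrals
  -- of ∇w there are the multiples ±κR^{d-1} of ν. The freedom in B is what the strip argument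
  -- exploits.
  have hid : inner ℝ (A - B) ν * ρ * (κ * R ^ d) =
      (∫ x in K2, R * ρ * inner ℝ (A - opA δ (p x) (G x)) (gradient w x)) +
      (∫ x in K1s, R * ρ * inner ℝ (B - opA δ (p x) (G x)) (gradient w x)) +
      (∫ x in K2, R * ρ * (f x * w x)) + ∫ x in K1s, R * ρ * (f x * w x) := by
    rw [← hcut (fun x => R * ρ * inner ℝ (B - opA δ (p x) (G x)) (gradient w x))
      (fun x hx => by rw [(hwz x hx).2, inner_zero_right, mul_zero]),
      ← hcut (fun x => R * ρ * (f x * w x)) (fun x hx => by rw [(hwz x hx).1]; ring)]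
    simp only [integral_const_mul]
    rw [hsplit K2 A hK2K, hsplit K1 B hK1K, hg2, hg1, inner_smul_right, inner_neg_right,
      inner_smul_right, inner_sub_left]
    have h1 : R * (κ * R ^ d / R) = κ * R ^ d := by field_simp
    linear_combination (-(inner ℝ A ν - inner ℝ B ν) * ρ) * h1 + R * ρ * hweak
  have hflux : ∀ (E : Set (Rd d)) (D : Rd d) (L : ℝ), 0 ≤ L → MeasurableSet E →
      (∀ x ∈ E, ‖gradient w x‖ ≤ L / R) →
      ENNReal.ofReal |∫ x in E, R * ρ * inner ℝ (D - opA δ (p x) (G x)) (gradient w x)| ≤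
        ENNReal.ofReal L * ∫⁻ x in E, ENNReal.ofReal (‖D - opA δ (p x) (G x)‖ * ρ) := by
    intro E D L hL hE hEg
    rw [← setLIntegral_ofReal_const_mul E hL]
    refine (ofReal_abs_setIntegral_le E _).trans (setLIntegral_mono' hE fun x hx => ?_)
    refine ENNReal.ofReal_le_ofReal ?_
    rw [abs_mul, abs_of_nonneg (mul_nonneg hR.le hρ)]
    have h1 := (abs_real_inner_le_norm (D - opA δ (p x) (G x)) (gradient w x)).trans
      (mul_le_mul_of_nonneg_left (hEg x hx) (norm_nonneg _))
    refine (mul_le_mul_of_nonneg_left h1 (mul_nonneg hR.le hρ)).trans (le_of_eq ?_)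
    field_simp
  have hrhs : ∀ E : Set (Rd d), ENNReal.ofReal |∫ x in E, R * ρ * (f x * w x)| ≤
      ∫⁻ x in E, ENNReal.ofReal (R * ρ * |f x|) := by
    intro E
    refine (ofReal_abs_setIntegral_le E _).trans (lintegral_mono fun x => ?_)
    refine ENNReal.ofReal_le_ofReal ?_
    rw [abs_mul, abs_of_nonneg (mul_nonneg hR.le hρ), abs_mul, abs_of_nonneg (hw01 x).1]
    exact mul_le_mul_of_nonneg_left (mul_le_of_le_one_right (abs_nonneg _) (hw01 x).2)
      (mul_nonneg hR.le hρ)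
  have hK1sm : MeasurableSet K1s := by
    have : MeasurableSet (K ∩ ({x : Rd d | 0 < inner ℝ ν (x - y₀)} ∩
        {x | m * inner ℝ ν (x - y₀) ≤ 2 * R})) :=
      hKm.inter (hSm'.inter (measurableSet_le (by fun_prop) measurable_const))
    exact this
  have habs : |inner ℝ (A - B) ν| * ρ * (κ * R ^ d) = |inner ℝ (A - B) ν * ρ * (κ * R ^ d)| := by
    rw [abs_mul, abs_mul, abs_of_nonneg hρ, abs_of_nonneg (a := κ * R ^ d) (by positivity)]
  rw [habs, hid]
  refine (ENNReal.ofReal_le_ofReal ((abs_add_le _ _).trans (add_le_add_left ((abs_add_le _ _).trans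
    (add_le_add_left (abs_add_le _ _) _)) _))).trans ?_
  rw [ENNReal.ofReal_add (by positivity) (by positivity),
    ENNReal.ofReal_add (by positivity) (by positivity),
    ENNReal.ofReal_add (by positivity) (by positivity)]
  refine add_le_add (add_le_add (add_le_add ?_ ?_) (hrhs K2)) (hrhs K1s)
  · exact hflux K2 A Cb hCb.le hK2m fun x hx => hwg0 x hx.2
  · exact hflux K1s B (Cb * (1 + m)) (by positivity) hK1sm fun x _ => hwg x

end

/-! ### Local estimate of the jump on a patch. -/

noncomputable section

variable {d : ℕ} {Ω ΓD : Set (Rd d)} {δ pm pp σ z : ℝ} {p f u : Rd d → ℝ} {G : Rd d → Rd d}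

theorem lintegral_flux_le_localError {T : Set (Rd d)} {a : Rd d} {h q M c : ℝ} :
    (∫⁻ x in T, ENNReal.ofReal (‖opF δ q a - opF δ q (G x)‖ ^ 2)) +
      (∫⁻ x in T, ENNReal.ofReal (M ^ 2 * (1 + ‖G x‖ ^ (p x * z ^ 2)))) ≤
      localError δ z p f G T a h q M c := by
  rw [localError, add_assoc, add_assoc (_ + _)]
  exact le_self_add

/-- For m ≤ 3 the right side already exceeds the volume of the ball; for m > 3 the strip lies in a
slab of relative width 3/m, where 3 instead of 2 makes the inequality strict. -/
theorem volume_strip_le (hd : 1 ≤ d) {y₀ ν : Rd d} {R m : ℝ} (hν : ‖ν‖ = 1) (hR : 0 < R)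
    (hm : 1 ≤ m) :
    volume (Metric.closedBall y₀ R ∩
      {x | 0 < inner ℝ ν (x - y₀) ∧ m * inner ℝ ν (x - y₀) ≤ 2 * R}) ≤
      ENNReal.ofReal (3 * d / m * (R ^ d * (volume (Metric.ball (0 : Rd d) 1)).toReal)) := by
  have hd' : (1 : ℝ) ≤ d := by exact_mod_cast hd
  have hm0 : 0 < m := by linarith
  rw [ENNReal.ofReal_mul (by positivity), ← volume_closedBall_eq y₀ hR.le]
  rcases le_or_gt m 3 with h3 | h3
  · refine (measure_mono inter_subset_left).trans (le_mul_of_one_le_left zero_le ?_)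
    rw [ENNReal.one_le_ofReal, le_div_iff₀ hm0]
    linarith
  · rw [show 3 * (d : ℝ) / m = d * (3 / m) by ring]
    refine le_trans (measure_mono ?_) (volume_slab_le hν hR (by positivity)
      (by rw [div_le_one hm0]; exact h3.le))
    rintro x ⟨hx, h1, h2⟩
    refine ⟨hx, h1, ?_⟩
    rw [div_mul_eq_mul_div, lt_div_iff₀ hm0]
    linarith

/-- The flux of the solution on a thin strip. -/
theorem lintegral_strip_le (hD : IsDirichletData Ω ΓD δ pm pp p f u G)
    {T K : Set (Rd d)} {a : Rd d} {h q M c q₀ q₂ m ρ κ η : ℝ} (hK : MeasurableSet K) (hKT : K ⊆ T)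
    (hKΩ : K ⊆ Ω) (hM : (q - q₀) ^ 2 ≤ M ^ 2) (hq₂ : ∀ x ∈ K, |p x - q₂| ≤ 2 * σ)
    (hm : 1 ≤ m) (hρ : 0 ≤ ρ) (hκ : 0 ≤ κ) (hη : 0 ≤ η)
    (hcond : ∀ P g : ℝ, P ∈ Icc pm pp → |P - q₂| ≤ 2 * σ → 0 ≤ g →
      m * ρ * (δ + g) ^ (P - 1) ≤ m * ρ * κ + η * ((q - q₀) ^ 2 * (1 + g ^ (P * z ^ 2)))) :
    ENNReal.ofReal m * ∫⁻ x in K, ENNReal.ofReal (‖0 - opA δ (p x) (G x)‖ * ρ) ≤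
      ENNReal.ofReal (m * ρ * κ) * volume K +
        ENNReal.ofReal η * localError δ z p f G T a h q M c := by
  have hm0 : 0 ≤ m := by linarith
  rw [← setLIntegral_ofReal_const_mul K hm0]
  calc ∫⁻ x in K, ENNReal.ofReal (m * (‖0 - opA δ (p x) (G x)‖ * ρ))
      ≤ ∫⁻ x in K, (ENNReal.ofReal (m * ρ * κ) +
          ENNReal.ofReal (η * (M ^ 2 * (1 + ‖G x‖ ^ (p x * z ^ 2))))) := by
        refine setLIntegral_mono' hK fun x hx => ?_
        rw [← ENNReal.ofReal_add (by positivity) (by positivity)]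
        refine ENNReal.ofReal_le_ofReal ?_
        rw [zero_sub, norm_neg]
        have h1 := mul_le_mul_of_nonneg_left (norm_opA_le_rpow (q := p x) hD.nonneg (G x))
          (mul_nonneg hm0 hρ)
        have h2 := hcond (p x) ‖G x‖ (hD.mem_Icc x (subset_closure (hKΩ hx))) (hq₂ x hx)
          (norm_nonneg _)
        have h3 : η * ((q - q₀) ^ 2 * (1 + ‖G x‖ ^ (p x * z ^ 2))) ≤
            η * (M ^ 2 * (1 + ‖G x‖ ^ (p x * z ^ 2))) :=
          mul_le_mul_of_nonneg_left (mul_le_mul_of_nonneg_right hM (by positivity)) hη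
        calc m * (‖opA δ (p x) (G x)‖ * ρ) = m * ρ * ‖opA δ (p x) (G x)‖ := by ring
          _ ≤ _ := h1
          _ ≤ _ := h2
          _ ≤ _ := add_le_add le_rfl h3
    _ = ENNReal.ofReal (m * ρ * κ) * volume K + ENNReal.ofReal η *
          ∫⁻ x in K, ENNReal.ofReal (M ^ 2 * (1 + ‖G x‖ ^ (p x * z ^ 2))) := by
        rw [lintegral_add_left measurable_const, setLIntegral_const,
          setLIntegral_ofReal_const_mul K hη]
    _ ≤ _ := by
        gcongr
        exact (lintegral_mono_set hKT).trans (le_add_self.trans lintegral_flux_le_localError)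

/-- The bounds for the normal components of the fluxes on a patch. -/
theorem exists_patch_bounds (d : ℕ) (hd : 1 ≤ d) (pm pp δ σ z : ℝ) (hδ : 0 ≤ δ)
    (hσ : IsSmallOscillation pm σ z) : ∃ C₀ : ℝ, 0 < C₀ ∧
    ∀ (Ω ΓD : Set (Rd d)) (p f u : Rd d → ℝ) (G : Rd d → Rd d),
      IsDirichletData Ω ΓD δ pm pp p f u G →
    ∀ (T₁ T₂ : Set (Rd d)) (y₀ ν : Rd d) (R h₁ h₂ q₁ q₂ M₁ M₂ c₁ c₂ X : ℝ) (a₁ a₂ : Rd d),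
      IsPatch Ω p σ pm pp T₁ T₂ y₀ ν R h₁ h₂ q₁ q₂ M₁ M₂ → 0 ≤ X →
      localError δ z p f G T₁ a₁ h₁ q₁ M₁ c₁ + localError δ z p f G T₂ a₂ h₂ q₂ M₂ c₂ ≤
        ENNReal.ofReal X →
      (q₁ - p y₀) ^ 2 * (1 + ‖a₁‖ ^ (q₁ * z ^ 2)) ≤ C₀ * (X / R ^ d) ∧
      (∀ r, 0 ≤ r → |inner ℝ (opA δ q₁ a₁ - opA δ q₂ a₂) ν| * r ≤
        C₀ * (X / R ^ d + shiftPow (δ + ‖a₁‖) q₁ r + shiftPow (δ + ‖a₂‖) q₂ r)) ∧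
      StripBound pm pp δ σ z C₀ (p y₀) q₁ q₂ a₁ a₂ ν (X / R ^ d) := by
  obtain ⟨Cf, hCf, hflux⟩ := exists_lintegral_flux_le d pm pp δ σ z hδ hσ
  obtain ⟨Cb, κ, hCb, hκ, hjump⟩ := exists_lintegral_jump_le d
  set V := (volume (Metric.ball (0 : Rd d) 1)).toReal with hV
  have hVpos : 0 < V := volume_unitBall_toReal_pos d
  set L := 2 * (Cb * Cf) + 2 + 6 * d * Cb + 2 * Cb + 6 * d with hL
  have hLpos : 0 < L := by positivity
  refine ⟨L * (1 + V) / κ + 2 ^ d / V, by positivity, ?_⟩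
  intro Ω ΓD p f u G hD T₁ T₂ y₀ ν R h₁ h₂ q₁ q₂ M₁ M₂ c₁ c₂ X a₁ a₂ hP hX0 hX
  have hR := hP.pos
  have hRd : 0 < R ^ d := by positivity
  have hY0 : 0 ≤ X / R ^ d := by positivity
  set X₁ := localError δ z p f G T₁ a₁ h₁ q₁ M₁ c₁
  set X₂ := localError δ z p f G T₂ a₂ h₂ q₂ M₂ c₂
  have hX₁ : X₁ ≤ ENNReal.ofReal X := le_self_add.trans hX
  have hX₂ : X₂ ≤ ENNReal.ofReal X := le_add_self.trans hX
  have hq₁ : 1 < q₁ := hσ.one_lt_pm.trans_le hP.mem₁.1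
  have hq₂ : 1 < q₂ := hσ.one_lt_pm.trans_le hP.mem₂.1
  have hM₁ : (q₁ - p y₀) ^ 2 ≤ M₁ ^ 2 := by
    rw [← sq_abs, abs_sub_comm]
    exact pow_le_pow_left₀ (abs_nonneg _) (hP.close₁ _ hP.centre_mem₁).2.1 2
  have hKΩ := hP.ball_subset hD
  set K := Metric.closedBall y₀ R with hK
  set K2 := K ∩ {x | inner ℝ ν (x - y₀) ≤ 0} with hK2
  have hKm : MeasurableSet K := Metric.isClosed_closedBall.measurableSet
  have hKK : K ⊆ Metric.closedBall y₀ (2 * R) := Metric.closedBall_subset_closedBall (by linarith)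
  have hK2m : MeasurableSet K2 := hKm.inter (measurableSet_le (by fun_prop) measurable_const)
  have hK2T : K2 ⊆ T₂ := fun x hx => hP.subset₂ x (hKK hx.1) hx.2
  have hKvol : volume K = ENNReal.ofReal (R ^ d * V) := volume_closedBall_eq y₀ hR.le
  have hK2vol : volume K2 ≤ ENNReal.ofReal (R ^ d * V) := hKvol ▸ measure_mono inter_subset_left
  have hstripm : ∀ m : ℝ, MeasurableSet (K ∩ {x | 0 < inner ℝ ν (x - y₀) ∧
      m * inner ℝ ν (x - y₀) ≤ 2 * R}) := fun m => by
    have : MeasurableSet (K ∩ ({x : Rd d | 0 < inner ℝ ν (x - y₀)} ∩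
        {x | m * inner ℝ ν (x - y₀) ≤ 2 * R})) :=
      hKm.inter ((measurableSet_lt measurable_const (by fun_prop)).inter
        (measurableSet_le (by fun_prop) measurable_const))
    exact this
  have hstripT : ∀ m : ℝ, (K ∩ {x | 0 < inner ℝ ν (x - y₀) ∧
      m * inner ℝ ν (x - y₀) ≤ 2 * R}) ⊆ T₁ := fun m x hx =>
    hP.subset₁ x (hKK hx.1) hx.2.1.le
  have hside2 : ∀ ρ : ℝ, 0 ≤ ρ →
      ENNReal.ofReal Cb * (∫⁻ x in K2, ENNReal.ofReal (‖opA δ q₂ a₂ - opA δ (p x) (G x)‖ * ρ)) ≤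
        ENNReal.ofReal (Cb * Cf * (shiftPow (δ + ‖a₂‖) q₂ ρ * (R ^ d * V) + X)) := by
    intro ρ hρ
    have hΦ := shiftPow_nonneg q₂ (add_nonneg hδ (norm_nonneg a₂)) hρ
    rw [mul_assoc Cb, ENNReal.ofReal_mul hCb.le, ENNReal.ofReal_mul hCf.le,
      ENNReal.ofReal_add (by positivity) hX0, ENNReal.ofReal_mul hΦ]
    gcongr
    refine (hflux Ω ΓD p f u G hD K2 q₂ M₂ ρ a₂ hK2m (inter_subset_left.trans hKΩ) hP.mem₂.1
      hP.mem₂.2 (fun x hx => ⟨?_, (hP.close₂ x (hK2T hx)).2.1⟩) hρ).trans ?_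
    · linarith [(hP.close₂ x (hK2T hx)).1, hσ.nonneg]
    · rw [add_assoc]
      gcongr
      refine le_trans (add_le_add (lintegral_mono_set hK2T) (lintegral_mono_set hK2T)) ?_
      exact lintegral_flux_le_localError.trans hX₂
  have hrhs2 : ∀ ρ : ℝ, 0 ≤ ρ → (∫⁻ x in K2, ENNReal.ofReal (R * ρ * |f x|)) ≤
      ENNReal.ofReal (X + 2 * shiftPow (δ + ‖a₂‖) q₂ ρ * (R ^ d * V)) := by
    intro ρ hρ
    have hΦ := shiftPow_nonneg q₂ (add_nonneg hδ (norm_nonneg a₂)) hρ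
    rw [ENNReal.ofReal_add hX0 (by positivity), ENNReal.ofReal_mul (by positivity)]
    refine (lintegral_rhs_le (z := z) (p := p) (G := G) (M := M₂) (c := c₂) (a := a₂) hq₂ hδ hR.le
      hP.le₂ hρ hK2T).trans ?_
    gcongr
  have hrhs1 : ∀ m ρ B : ℝ, 0 ≤ ρ → 0 ≤ B → volume (K ∩ {x | 0 < inner ℝ ν (x - y₀) ∧
      m * inner ℝ ν (x - y₀) ≤ 2 * R}) ≤ ENNReal.ofReal B →
      (∫⁻ x in K ∩ {x | 0 < inner ℝ ν (x - y₀) ∧ m * inner ℝ ν (x - y₀) ≤ 2 * R},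
        ENNReal.ofReal (R * ρ * |f x|)) ≤
      ENNReal.ofReal (X + 2 * shiftPow (δ + ‖a₁‖) q₁ ρ * B) := by
    intro m ρ B hρ hB hvol
    have hΦ := shiftPow_nonneg q₁ (add_nonneg hδ (norm_nonneg a₁)) hρ
    rw [ENNReal.ofReal_add hX0 (by positivity), ENNReal.ofReal_mul (by positivity)]
    refine (lintegral_rhs_le (z := z) (p := p) (G := G) (M := M₁) (c := c₁) (a := a₁) hq₁ hδ hR.le
      hP.le₁ hρ (hstripT m)).trans ?_
    gcongr
  have hfin : ∀ J S : ℝ, 0 ≤ S → J * (κ * R ^ d) ≤ L * (1 + V) * (R ^ d * S) →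
      J ≤ (L * (1 + V) / κ + 2 ^ d / V) * S := by
    intro J S hS hJ
    have h1 : J ≤ L * (1 + V) / κ * S := by
      have h2 : L * (1 + V) / κ * S = L * (1 + V) * (R ^ d * S) / (κ * R ^ d) := by field_simp
      rw [h2, le_div_iff₀ (by positivity)]
      exact hJ
    have h3 : 0 ≤ 2 ^ d / V * S := by positivity
    linarith
  have hXR : X = R ^ d * (X / R ^ d) := by field_simp
  have hcoef : ∀ a S : ℝ, 0 ≤ a → a ≤ L → 0 ≤ S →
      a * (R ^ d * S) ≤ L * (1 + V) * (R ^ d * S) ∧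
      a * V * (R ^ d * S) ≤ L * (1 + V) * (R ^ d * S) := by
    intro a S ha haL hS
    have h1 := mul_nonneg hLpos.le hVpos.le
    constructor <;> refine mul_le_mul_of_nonneg_right ?_ (by positivity)
    · linarith
    · calc a * V ≤ L * V := mul_le_mul_of_nonneg_right haL hVpos.le
        _ ≤ _ := by linarith
  have hCC : 0 < Cb * Cf := by positivity
  have hdC : 0 ≤ 6 * d * Cb := by positivity
  have hd0 : (0 : ℝ) ≤ d := Nat.cast_nonneg d
  clear_value L
  refine ⟨?_, ?_, ?_⟩
  · have h1 : ENNReal.ofReal (M₁ ^ 2 * (1 + ‖a₁‖ ^ (q₁ * z ^ 2))) *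
        ENNReal.ofReal ((R / 2) ^ d * V) ≤ ENNReal.ofReal X := by
      refine le_trans ?_ hX₁
      refine (mul_le_mul_right hP.volume_ge _).trans ?_
      rw [← setLIntegral_const]
      show _ ≤ localError δ z p f G T₁ a₁ h₁ q₁ M₁ c₁
      rw [localError, add_assoc, add_comm (_ + _) (∫⁻ _ in T₁, _), add_assoc]
      exact le_self_add
    rw [← ENNReal.ofReal_mul (by positivity), ENNReal.ofReal_le_ofReal_iff hX0, div_pow] at h1
    have h2 : M₁ ^ 2 * (1 + ‖a₁‖ ^ (q₁ * z ^ 2)) ≤ 2 ^ d / V * (X / R ^ d) := by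
      rw [div_mul_div_comm, le_div_iff₀ (by positivity)]
      calc _ = 2 ^ d * (M₁ ^ 2 * (1 + ‖a₁‖ ^ (q₁ * z ^ 2)) * (R ^ d / 2 ^ d * V)) := by
            field_simp
        _ ≤ _ := mul_le_mul_of_nonneg_left h1 (by positivity)
    have h3 : (q₁ - p y₀) ^ 2 * (1 + ‖a₁‖ ^ (q₁ * z ^ 2)) ≤
        M₁ ^ 2 * (1 + ‖a₁‖ ^ (q₁ * z ^ 2)) := mul_le_mul_of_nonneg_right hM₁ (by positivity)
    have h4 : 0 ≤ L * (1 + V) / κ * (X / R ^ d) := by positivity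
    linarith
  · intro r hr
    have hΦ₁ := shiftPow_nonneg q₁ (add_nonneg hδ (norm_nonneg a₁)) hr
    have hΦ₂ := shiftPow_nonneg q₂ (add_nonneg hδ (norm_nonneg a₂)) hr
    set Φ₁ := shiftPow (δ + ‖a₁‖) q₁ r
    set Φ₂ := shiftPow (δ + ‖a₂‖) q₂ r
    -- Uncut bump (m = 0), with the discrete flux of each element inserted on its own half ball.
    have h := hjump Ω ΓD δ pm pp σ p f u G hD T₁ T₂ y₀ ν R h₁ h₂ q₁ q₂ M₁ M₂ hP 0 r
      (opA δ q₂ a₂) (opA δ q₁ a₁) le_rfl hr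
    have hvol0 : volume (K ∩ {x | 0 < inner ℝ ν (x - y₀) ∧
        0 * inner ℝ ν (x - y₀) ≤ 2 * R}) ≤ ENNReal.ofReal (R ^ d * V) :=
      hKvol ▸ measure_mono inter_subset_left
    have hs1 : ENNReal.ofReal (Cb * (1 + 0)) *
        (∫⁻ x in K ∩ {x | 0 < inner ℝ ν (x - y₀) ∧ 0 * inner ℝ ν (x - y₀) ≤ 2 * R},
          ENNReal.ofReal (‖opA δ q₁ a₁ - opA δ (p x) (G x)‖ * r)) ≤
        ENNReal.ofReal (Cb * Cf * (Φ₁ * (R ^ d * V) + X)) := by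
      rw [add_zero, mul_one, mul_assoc Cb, ENNReal.ofReal_mul hCb.le, ENNReal.ofReal_mul hCf.le,
        ENNReal.ofReal_add (by positivity) hX0, ENNReal.ofReal_mul hΦ₁]
      gcongr
      refine (hflux Ω ΓD p f u G hD _ q₁ M₁ r a₁ (hstripm 0) (inter_subset_left.trans hKΩ)
        hP.mem₁.1 hP.mem₁.2 (fun x hx => ⟨?_, (hP.close₁ x (hstripT 0 hx)).2.1⟩) hr).trans ?_
      · linarith [(hP.close₁ x (hstripT 0 hx)).1, hσ.nonneg]
      · rw [add_assoc]
        gcongr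
        refine le_trans (add_le_add (lintegral_mono_set (hstripT 0))
          (lintegral_mono_set (hstripT 0))) ?_
        exact lintegral_flux_le_localError.trans hX₁
    have h' := h.trans (add_le_add (add_le_add (add_le_add (hside2 r hr) hs1) (hrhs2 r hr))
      (hrhs1 0 r (R ^ d * V) hr (by positivity) hvol0))
    rw [← ENNReal.ofReal_add (by positivity) (by positivity),
      ← ENNReal.ofReal_add (by positivity) (by positivity),
      ← ENNReal.ofReal_add (by positivity) (by positivity),
      ENNReal.ofReal_le_ofReal_iff (by positivity)] at h'
    rw [inner_sub_left, abs_sub_comm, ← inner_sub_left]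
    refine hfin _ _ (by positivity) (h'.trans ?_)
    generalize X / R ^ d = Y at hXR hY0 ⊢
    rw [hXR]
    have t1 := (hcoef (2 * (Cb * Cf) + 2) Y (by positivity) (by linarith) hY0).1
    have t2 := (hcoef (Cb * Cf + 2) Φ₁ (by positivity) (by linarith) hΦ₁).2
    have t3 := (hcoef (Cb * Cf + 2) Φ₂ (by positivity) (by linarith) hΦ₂).2
    calc _ = (2 * (Cb * Cf) + 2) * (R ^ d * Y) + (Cb * Cf + 2) * V * (R ^ d * Φ₁) +
          (Cb * Cf + 2) * V * (R ^ d * Φ₂) := by ring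
      _ ≤ _ := add_le_add (add_le_add t1 t2) t3
      _ = _ := by ring
  · intro m r k η hm hr hk hη hcond
    have hm0 : 0 < m := by linarith
    have hΦ₁ := shiftPow_nonneg q₁ (add_nonneg hδ (norm_nonneg a₁)) hr
    have hΦ₂ := shiftPow_nonneg q₂ (add_nonneg hδ (norm_nonneg a₂)) hr
    set Φ₁ := shiftPow (δ + ‖a₁‖) q₁ r
    set Φ₂ := shiftPow (δ + ‖a₂‖) q₂ r
    -- Cut bump: on the strip in T₁ the comparison vector is 0, not the discrete flux, so only the
    -- flux of u itself has to be estimated there.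
    have h := hjump Ω ΓD δ pm pp σ p f u G hD T₁ T₂ y₀ ν R h₁ h₂ q₁ q₂ M₁ M₂ hP m r
      (opA δ q₂ a₂) 0 hm0.le hr
    have hvol := volume_strip_le hd (y₀ := y₀) hP.norm_eq hR hm
    have hs1 : ENNReal.ofReal (Cb * (1 + m)) *
        (∫⁻ x in K ∩ {x | 0 < inner ℝ ν (x - y₀) ∧ m * inner ℝ ν (x - y₀) ≤ 2 * R},
          ENNReal.ofReal (‖0 - opA δ (p x) (G x)‖ * r)) ≤
        ENNReal.ofReal (2 * Cb * (m * r * k * (3 * d / m * (R ^ d * V)) + η * X)) := by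
      have e1 : ENNReal.ofReal (Cb * (1 + m)) ≤ ENNReal.ofReal (2 * Cb) * ENNReal.ofReal m := by
        rw [← ENNReal.ofReal_mul (by positivity)]
        refine ENNReal.ofReal_le_ofReal ?_
        nlinarith
      refine (mul_le_mul_left e1 _).trans ?_
      rw [mul_assoc, ENNReal.ofReal_mul (by positivity : 0 ≤ 2 * Cb),
        ENNReal.ofReal_add (by positivity) (by positivity),
        ENNReal.ofReal_mul (p := m * r * k) (by positivity), ENNReal.ofReal_mul hη]
      gcongr
      refine (lintegral_strip_le (σ := σ) (z := z) (a := a₁) (h := h₁) (q := q₁) (M := M₁)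
        (c := c₁) (q₀ := p y₀) (q₂ := q₂) (κ := k) (η := η) hD (hstripm m) (hstripT m)
        (inter_subset_left.trans hKΩ) hM₁ (fun x hx => ?_) hm hr hk hη hcond).trans ?_
      -- On the strip the exponent of u is compared with q₂, the exponent of the other element, by
      -- way of the common point y₀.
      · have b1 := (hP.close₁ x (hstripT m hx)).2.2
        have b2 := (hP.close₂ y₀ hP.symm.centre_mem₁).1
        have b3 := abs_sub_le (p x) (p y₀) q₂
        linarith
      · gcongr
    have h' := h.trans (add_le_add (add_le_add (add_le_add (hside2 r hr) hs1) (hrhs2 r hr))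
      (hrhs1 m r (3 * d / m * (R ^ d * V)) hr (by positivity) hvol))
    rw [← ENNReal.ofReal_add (by positivity) (by positivity),
      ← ENNReal.ofReal_add (by positivity) (by positivity),
      ← ENNReal.ofReal_add (by positivity) (by positivity),
      ENNReal.ofReal_le_ofReal_iff (by positivity)] at h'
    rw [sub_zero] at h'
    refine hfin _ _ (by positivity) (h'.trans ?_)
    generalize X / R ^ d = Y at hXR hY0 ⊢
    rw [hXR]
    have t1 := (hcoef (Cb * Cf + 2) Y (by positivity) (by linarith) hY0).1
    have t2 := (hcoef (Cb * Cf + 2) Φ₂ (by positivity) (by linarith) hΦ₂).2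
    have t3 := (hcoef (6 * d) (Φ₁ / m) (by positivity) (by linarith) (by positivity)).2
    have t4 := (hcoef (6 * d * Cb) (r * k) (by positivity) (by linarith) (by positivity)).2
    have t5 := (hcoef (2 * Cb) (η * Y) (by positivity) (by linarith) (by positivity)).1
    calc _ = (Cb * Cf + 2) * (R ^ d * Y) + (Cb * Cf + 2) * V * (R ^ d * Φ₂) +
          6 * d * V * (R ^ d * (Φ₁ / m)) + 6 * d * Cb * V * (R ^ d * (r * k)) +
          2 * Cb * (R ^ d * (η * Y)) := by field_simp; ring
      _ ≤ _ := add_le_add (add_le_add (add_le_add (add_le_add t1 t2) t3) t4) t5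
      _ = _ := by ring

/-- The jump estimate on a patch. -/
theorem exists_patch_jump_le (d : ℕ) (hd : 1 ≤ d) (pm pp δ σ z : ℝ) (hδ : 0 ≤ δ)
    (hσ : IsSmallOscillation pm σ z) : ∃ C : ℝ, 0 < C ∧
    ∀ (Ω ΓD : Set (Rd d)) (p f u : Rd d → ℝ) (G : Rd d → Rd d),
      IsDirichletData Ω ΓD δ pm pp p f u G →
    ∀ (T₁ T₂ : Set (Rd d)) (y₀ ν : Rd d) (R h₁ h₂ q₁ q₂ M₁ M₂ c₁ c₂ τ : ℝ) (a₁ a₂ : Rd d),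
      IsPatch Ω p σ pm pp T₁ T₂ y₀ ν R h₁ h₂ q₁ q₂ M₁ M₂ → a₁ - a₂ = τ • ν →
      ENNReal.ofReal (R ^ d * ‖opF δ q₁ a₁ - opF δ q₂ a₂‖ ^ 2) ≤ ENNReal.ofReal C *
        (localError δ z p f G T₁ a₁ h₁ q₁ M₁ c₁ + localError δ z p f G T₂ a₂ h₂ q₂ M₂ c₂) := by
  obtain ⟨C₀, hC₀, hpatch⟩ := exists_patch_bounds d hd pm pp δ σ z hδ hσ
  obtain ⟨C, hC, hjump⟩ := exists_jump_le (d := d) pm pp δ σ z C₀ hδ hC₀ hσ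
  refine ⟨C, hC, ?_⟩
  intro Ω ΓD p f u G hD T₁ T₂ y₀ ν R h₁ h₂ q₁ q₂ M₁ M₂ c₁ c₂ τ a₁ a₂ hP haτ
  have hRd : 0 < R ^ d := pow_pos hP.pos d
  set E := localError δ z p f G T₁ a₁ h₁ q₁ M₁ c₁ + localError δ z p f G T₂ a₂ h₂ q₂ M₂ c₂ with hE
  by_cases hX : E = ∞
  · rw [hX, ENNReal.mul_top (by simpa using hC)]
    exact le_top
  have hXe : E = ENNReal.ofReal E.toReal := (ENNReal.ofReal_toReal hX).symm
  have hX0 : 0 ≤ E.toReal := ENNReal.toReal_nonneg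
  obtain ⟨b1, b2, b3⟩ := hpatch Ω ΓD p f u G hD T₁ T₂ y₀ ν R h₁ h₂ q₁ q₂ M₁ M₂ c₁ c₂ E.toReal
    a₁ a₂ hP hX0 hXe.le
  obtain ⟨b1', -, b3'⟩ := hpatch Ω ΓD p f u G hD T₂ T₁ y₀ (-ν) R h₂ h₁ q₂ q₁ M₂ M₁ c₂ c₁
    E.toReal a₂ a₁ hP.symm hX0 ((add_comm _ _).trans hXe).le
  -- The reversed patch has the normal -ν, but the strip bound contains only an absolute value.
  have b3'' : StripBound pm pp δ σ z C₀ (p y₀) q₂ q₁ a₂ a₁ ν (E.toReal / R ^ d) := by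
    intro m r κ η hm hr hκ hη hcond
    have := b3' m r κ η hm hr hκ hη hcond
    rwa [inner_neg_right, abs_neg] at this
  have c1 := (hP.close₁ y₀ hP.centre_mem₁).1
  have c2 := (hP.close₂ y₀ hP.symm.centre_mem₁).1
  rw [abs_sub_comm] at c1 c2
  have c3 := abs_sub_le q₁ (p y₀) q₂
  rw [abs_sub_comm (p y₀) q₂] at c3
  have hfinal := hjump (p y₀) q₁ q₂ a₁ a₂ ν τ (E.toReal / R ^ d)
    (hD.mem_Icc _ (hP.subset_closure₁ hP.centre_mem₁)) hP.mem₁ hP.mem₂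
    (by linarith [hσ.nonneg]) (by linarith [hσ.nonneg]) (by linarith) hP.norm_eq haτ
    (by positivity) b1 b1' b2 b3 b3''
  rw [hXe, ← ENNReal.ofReal_mul hC.le]
  refine ENNReal.ofReal_le_ofReal ?_
  calc _ ≤ R ^ d * (C * (E.toReal / R ^ d)) := mul_le_mul_of_nonneg_left hfinal hRd.le
    _ = _ := by field_simp

end

/-! ### Assembly on a triangulation and the admissible oscillation. -/

noncomputable section

variable {d : ℕ} {Ω ΓD : Set (Rd d)} {δ pm pp : ℝ} {p f u v : Rd d → ℝ} {G : Rd d → Rd d}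

/-! ### The modulus of continuity -/

theorem abs_sub_le_modulus {M : Set (Rd d)} {r : ℝ} (hp : ∀ x ∈ M, p x ∈ Icc pm pp) {x y : Rd d}
    (hx : x ∈ M) (hy : y ∈ M) (hxy : dist x y ≤ r) : |p x - p y| ≤ modulus p M r := by
  refine le_csSup ⟨pp - pm, ?_⟩ ⟨x, hx, y, hy, hxy, rfl⟩
  rintro _ ⟨x, hx, y, hy, -, rfl⟩
  rw [abs_le]
  constructor <;> linarith [(hp x hx).1, (hp x hx).2, (hp y hy).1, (hp y hy).2]

/-- On a convex set, the oscillation at distance `N r` is at most `N` times the one at `r`. -/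
theorem abs_sub_le_mul_modulus {M : Set (Rd d)} (hM : Convex ℝ M) {r : ℝ}
    (hp : ∀ x ∈ M, p x ∈ Icc pm pp) {N : ℕ} (hN : 0 < N) {x y : Rd d}
    (hx : x ∈ M) (hy : y ∈ M) (hxy : dist x y ≤ N * r) : |p x - p y| ≤ N * modulus p M r := by
  have hN' : (0 : ℝ) < N := by exact_mod_cast hN
  set g : ℕ → Rd d := fun k => x + ((k : ℝ) / N) • (y - x) with hg
  have hmem : ∀ k ≤ N, g k ∈ M := fun k hk => by
    have hk' : (k : ℝ) ≤ N := by exact_mod_cast hk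
    have : g k = (1 - (k : ℝ) / N) • x + ((k : ℝ) / N) • y := by rw [hg]; module
    rw [this]
    refine hM hx hy ?_ (by positivity) (by ring)
    rw [sub_nonneg, div_le_one hN']; exact hk'
  have hdist : ∀ k, dist (g k) (g (k + 1)) ≤ r := fun k => by
    have : g k - g (k + 1) = (-(N : ℝ)⁻¹) • (y - x) := by
      rw [hg]; push_cast; rw [add_div]; module
    rw [dist_eq_norm, this, norm_smul, norm_neg, norm_inv, Real.norm_natCast,
      ← dist_eq_norm, dist_comm, inv_mul_le_iff₀ hN']
    exact hxy
  have h0 : g 0 = x := by simp [hg]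
  have h1 : g N = y := by simp [hg, hN'.ne']
  calc |p x - p y| = dist (p (g 0)) (p (g N)) := by rw [h0, h1, Real.dist_eq]
    _ ≤ ∑ k ∈ Finset.range N, dist (p (g k)) (p (g (k + 1))) :=
        dist_le_range_sum_dist (fun k => p (g k)) N
    _ ≤ ∑ _k ∈ Finset.range N, modulus p M r := by
        refine Finset.sum_le_sum fun k hk => ?_
        rw [Finset.mem_range] at hk
        rw [Real.dist_eq]
        exact abs_sub_le_modulus hp (hmem k hk.le) (hmem (k + 1) hk) (hdist k)
    _ = _ := by rw [Finset.sum_const, Finset.card_range, nsmul_eq_mul]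

/-! ### The elements of a triangulation -/

namespace Triangulation

theorem simplex_subset_closure (𝒯 : Triangulation Ω) {t : Finset (Rd d)} (ht : t ∈ 𝒯.elements) :
    simplex t ⊆ closure Ω := by
  rw [← 𝒯.space_eq]
  exact 𝒯.complex.convexHull_subset_space ht.1

theorem affineIndependent (𝒯 : Triangulation Ω) {t : Finset (Rd d)} (ht : t ∈ 𝒯.elements) :
    AffineIndependent ℝ ((↑) : t → Rd d) := 𝒯.complex.indep ht.1

end Triangulation

/-- The element residual, weighted with an arbitrary bound for the oscillation of the exponent. -/
theorem exists_elementResidual_le (d : ℕ) (hd : 1 ≤ d) (pm pp δ σ z ω₀ : ℝ) (hδ : 0 ≤ δ)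
    (hω₀ : 0 < ω₀) (hσ : IsSmallOscillation pm σ z) : ∃ C : ℝ, 0 < C ∧
    ∀ (Ω ΓD : Set (Rd d)) (p f u : Rd d → ℝ) (G : Rd d → Rd d),
      IsDirichletData Ω ΓD δ pm pp p f u G →
    ∀ 𝒯 : Triangulation Ω, ChunkinessLE 𝒯 ω₀ →
    ∀ ξ : Finset (Rd d) → Rd d, (∀ t ∈ 𝒯.elements, ξ t ∈ simplex t) →
    ∀ v : Rd d → ℝ, ∀ t ∈ 𝒯.elements,
      (∀ x ∈ simplex t, ∀ y ∈ simplex t, |p x - p y| ≤ σ) →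
    ∀ M : ℝ, (∀ x ∈ simplex t, |p x - p (ξ t)| ≤ M) →
      elementResidual δ p ξ f v t ≤ ENNReal.ofReal C * (naturalDistance δ p ξ v G t +
        (∫⁻ x in simplex t, ENNReal.ofReal (M ^ 2 * (1 + ‖G x‖ ^ (p x * z ^ 2)))) +
        dataOscillation δ p ξ f v t) := by
  obtain ⟨C, hC, hres⟩ := exists_residual_le d hd pm pp δ σ z (2 * ω₀) hδ (by positivity) hσ
  refine ⟨C, hC, ?_⟩
  intro Ω ΓD p f u G hD 𝒯 h𝒯 ξ hξ v t ht hosc M hM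
  obtain ⟨x₀, r, hr, hball, hdiam, -⟩ :=
    inradius_spec hd (𝒯.affineIndependent ht) ht.2 (h𝒯 t ht)
  have hsub := 𝒯.simplex_subset_closure ht
  have hp := hD.mem_Icc _ (hsub (hξ t ht))
  exact hres Ω ΓD p f u G hD (simplex t) x₀ (gradOn v t) r _ (p (ξ t)) M _ (isCompact_simplex t)
    hsub hr hball (fun x hx => dist_le_diam_simplex hx (hball (Metric.mem_ball_self hr))) hdiam
    Metric.diam_nonneg hp.1 hp.2
    (fun x hx => ⟨by linarith [hosc x hx _ (hξ t ht), hσ.nonneg], hM x hx⟩)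

/-- All error quantities of an element adjacent to a side are bounded by the indicators. -/
theorem exists_localError_le (d : ℕ) (hd : 1 ≤ d) (pm pp δ σ z ω₀ : ℝ) (hδ : 0 ≤ δ)
    (hω₀ : 0 < ω₀) (hσ : IsSmallOscillation pm σ z) (N : ℕ) (hN : 0 < N) : ∃ C : ℝ, 0 < C ∧
    ∀ (Ω ΓD : Set (Rd d)) (p f u : Rd d → ℝ) (G : Rd d → Rd d),
      IsDirichletData Ω ΓD δ pm pp p f u G →
    ∀ 𝒯 : Triangulation Ω, ChunkinessLE 𝒯 ω₀ →
    ∀ ξ : Finset (Rd d) → Rd d, (∀ t ∈ 𝒯.elements, ξ t ∈ simplex t) →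
    ∀ v : Rd d → ℝ, ∀ S : Finset (Rd d), ∀ t ∈ 𝒯.elements,
      (∀ x ∈ simplex t, ∀ y ∈ simplex t, |p x - p y| ≤ σ) →
      (∀ x ∈ simplex t,
        |p x - p (ξ t)| ≤ N * modulus p (simplex t) (Metric.diam (simplex S))) →
      localError δ z p f G (simplex t) (gradOn v t) (Metric.diam (simplex t)) (p (ξ t))
          (N * modulus p (simplex t) (Metric.diam (simplex S))) (⨍ y in simplex t, f y) ≤
        ENNReal.ofReal C * (naturalDistance δ p ξ v G t + sideExponentTerm p ξ v G (z ^ 2) S t +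
          dataOscillation δ p ξ f v t) := by
  obtain ⟨C, hC, hres⟩ := exists_elementResidual_le d hd pm pp δ σ z ω₀ hδ hω₀ hσ
  refine ⟨(2 + C) * (N : ℝ) ^ 2, by positivity, ?_⟩
  intro Ω ΓD p f u G hD 𝒯 h𝒯 ξ hξ v S t ht hosc hM
  have hres' := hres Ω ΓD p f u G hD 𝒯 h𝒯 ξ hξ v t ht hosc _ hM
  set μ := modulus p (simplex t) (Metric.diam (simplex S)) with hμ
  have hN1 : (1 : ℝ) ≤ (N : ℝ) ^ 2 := by
    have : (1 : ℝ) ≤ N := by exact_mod_cast hN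
    nlinarith
  set n := naturalDistance δ p ξ v G t with hn
  set e := sideExponentTerm p ξ v G (z ^ 2) S t with he
  set o := dataOscillation δ p ξ f v t with ho
  have hE : (∫⁻ x in simplex t, ENNReal.ofReal ((N * μ) ^ 2 * (1 + ‖G x‖ ^ (p x * z ^ 2)))) ≤
      ENNReal.ofReal ((N : ℝ) ^ 2) * e := by
    rw [he, sideExponentTerm, ← setLIntegral_ofReal_const_mul _ (by positivity)]
    refine lintegral_mono fun x => ENNReal.ofReal_le_ofReal ?_
    rw [mul_pow, mul_assoc]
    have : 0 ≤ ‖gradOn v t‖ ^ (p (ξ t) * z ^ 2) := by positivity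
    refine mul_le_mul_of_nonneg_left (mul_le_mul_of_nonneg_left ?_ (by positivity)) (by positivity)
    linarith
  have hV : (∫⁻ _ in simplex t,
      ENNReal.ofReal ((N * μ) ^ 2 * (1 + ‖gradOn v t‖ ^ (p (ξ t) * z ^ 2)))) ≤
      ENNReal.ofReal ((N : ℝ) ^ 2) * e := by
    rw [he, sideExponentTerm, ← setLIntegral_ofReal_const_mul _ (by positivity)]
    refine lintegral_mono fun x => ENNReal.ofReal_le_ofReal ?_
    rw [mul_pow, mul_assoc]
    have : 0 ≤ ‖G x‖ ^ (p x * z ^ 2) := by positivity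
    refine mul_le_mul_of_nonneg_left (mul_le_mul_of_nonneg_left ?_ (by positivity)) (by positivity)
    linarith
  have hone : ∀ a : ℝ≥0∞, a ≤ ENNReal.ofReal ((N : ℝ) ^ 2) * a := fun a =>
    le_mul_of_one_le_left zero_le (by rwa [ENNReal.one_le_ofReal])
  calc localError δ z p f G (simplex t) (gradOn v t) (Metric.diam (simplex t)) (p (ξ t))
          (N * μ) (⨍ y in simplex t, f y)
      ≤ n + ENNReal.ofReal ((N : ℝ) ^ 2) * e + ENNReal.ofReal ((N : ℝ) ^ 2) * e +
          ENNReal.ofReal C * (n + ENNReal.ofReal ((N : ℝ) ^ 2) * e + o) + o := by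
        rw [localError]
        -- The element residual inside `localError` is removed by the local efficiency on the same
        -- element.
        refine add_le_add (add_le_add (add_le_add (add_le_add le_rfl hE) hV) ?_) le_rfl
        refine hres'.trans ?_
        gcongr
    _ ≤ ENNReal.ofReal ((N : ℝ) ^ 2) * n + ENNReal.ofReal ((N : ℝ) ^ 2) * e +
          ENNReal.ofReal ((N : ℝ) ^ 2) * e +
          ENNReal.ofReal C * (ENNReal.ofReal ((N : ℝ) ^ 2) * n + ENNReal.ofReal ((N : ℝ) ^ 2) * e +
            ENNReal.ofReal ((N : ℝ) ^ 2) * o) + ENNReal.ofReal ((N : ℝ) ^ 2) * o +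
          ENNReal.ofReal ((N : ℝ) ^ 2) * (n + o) := by
        refine le_trans ?_ le_self_add
        gcongr <;> exact hone _
    _ = _ := by
        rw [ENNReal.ofReal_mul (by positivity), ENNReal.ofReal_add (by norm_num) hC.le,
          ENNReal.ofReal_ofNat]
        ring

/-- The local efficiency of the jump residual. -/
theorem exists_sideJump_le (d : ℕ) (hd : 1 ≤ d) (pm pp δ σ z ω₀ : ℝ) (hδ : 0 ≤ δ)
    (hω₀ : 0 < ω₀) (hσ : IsSmallOscillation pm σ z) : ∃ C : ℝ, 0 < C ∧
    ∀ (Ω ΓD : Set (Rd d)) (p f u : Rd d → ℝ) (G : Rd d → Rd d),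
      IsDirichletData Ω ΓD δ pm pp p f u G →
    ∀ 𝒯 : Triangulation Ω, ChunkinessLE 𝒯 ω₀ →
    ∀ ξ : Finset (Rd d) → Rd d, (∀ t ∈ 𝒯.elements, ξ t ∈ simplex t) →
    ∀ v : Rd d → ℝ, IsP1 𝒯 v → ∀ S t₁ t₂ : Finset (Rd d), 𝒯.IsInteriorSide S t₁ t₂ →
      (∀ x ∈ simplex t₁, ∀ y ∈ simplex t₁, |p x - p y| ≤ σ) →
      (∀ x ∈ simplex t₂, ∀ y ∈ simplex t₂, |p x - p y| ≤ σ) →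
      sideJump δ p ξ v S t₁ t₂ ≤ ENNReal.ofReal C *
        ((naturalDistance δ p ξ v G t₁ + naturalDistance δ p ξ v G t₂)
          + (sideExponentTerm p ξ v G (z ^ 2) S t₁ + sideExponentTerm p ξ v G (z ^ 2) S t₂)
          + (dataOscillation δ p ξ f v t₁ + dataOscillation δ p ξ f v t₂)) := by
  -- The weight in the claim is the modulus at h_S, whereas p must be compared over all of T. As
  -- diam T ≤ 2ω₀h_S and T is convex, a chain of N steps of length at most h_S bridges the gap.
  set N := ⌈2 * ω₀⌉₊ with hNdef
  have hN : 0 < N := Nat.ceil_pos.2 (by positivity)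
  have hNle : 2 * ω₀ ≤ N := Nat.le_ceil _
  obtain ⟨C₁, hC₁, hloc⟩ := exists_localError_le d hd pm pp δ σ z ω₀ hδ hω₀ hσ N hN
  obtain ⟨C₂, hC₂, hjump⟩ := exists_patch_jump_le d hd pm pp δ σ z hδ hσ
  obtain ⟨Cμ, hCμ⟩ := exists_measure_facet_le d
  have hd0 : (0 : ℝ) < d := by exact_mod_cast hd
  refine ⟨(Cμ + 1) * (4 * d * ω₀) ^ d * C₂ * C₁, by positivity, ?_⟩
  intro Ω ΓD p f u G hD 𝒯 h𝒯 ξ hξ v hv S t₁ t₂ hS hosc₁ hosc₂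
  obtain ⟨ht₁, ht₂, hne, hSt₁, hSt₂, hScard⟩ := hS
  -- In one dimension a side is a point of diameter 0, so the factor h_S annihilates the left-hand
  -- side; for d ≥ 2 the diameter h_S is comparable with the element size.
  rcases hd.eq_or_lt with hd1 | hd2
  · have : S.card = 1 := hScard.trans hd1.symm
    obtain ⟨y, rfl⟩ := Finset.card_eq_one.1 this
    have h0 : Metric.diam (simplex ({y} : Finset (Rd d))) = 0 := by simp [simplex]
    rw [sideJump, h0, ENNReal.ofReal_zero, zero_mul]
    exact zero_le
  obtain ⟨x₁, r₁, hr₁, hb₁, hdiam₁, hrd₁⟩ :=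
    inradius_spec hd (𝒯.affineIndependent ht₁) ht₁.2 (h𝒯 t₁ ht₁)
  obtain ⟨x₂, r₂, hr₂, hb₂, hdiam₂, hrd₂⟩ :=
    inradius_spec hd (𝒯.affineIndependent ht₂) ht₂.2 (h𝒯 t₂ ht₂)
  have hrS₁ : r₁ ≤ Metric.diam (simplex S) := le_diam_facet hd2 hSt₁ hScard ht₁.2 hb₁
  have hrS₂ : r₂ ≤ Metric.diam (simplex S) := le_diam_facet hd2 hSt₂ hScard ht₂.2 hb₂
  obtain ⟨y₀, ν, hν, hy₁, hy₂, hsub₁, hsub₂, hpar⟩ :=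
    exists_halfBalls hd (𝒯.affineIndependent ht₁) (𝒯.affineIndependent ht₂) ht₁.2 ht₂.2 hne hSt₁
      hSt₂ hScard (𝒯.complex.inter_subset_convexHull ht₁.1 ht₂.1) hr₁ hr₂ hb₁ hb₂
  set hS := Metric.diam (simplex S) with hhS
  have hS0 : 0 ≤ hS := Metric.diam_nonneg
  have hclosed : ∀ t ∈ 𝒯.elements, Metric.diam (simplex t) ≤ 2 * ω₀ * hS → ∀ x ∈ simplex t,
      |p x - p (ξ t)| ≤ N * modulus p (simplex t) hS := by
    intro t ht hdiam x hx
    refine abs_sub_le_mul_modulus (convex_simplex t)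
      (fun x hx => hD.mem_Icc x (𝒯.simplex_subset_closure ht hx)) hN hx (hξ t ht) ?_
    calc dist x (ξ t) ≤ Metric.diam (simplex t) := dist_le_diam_simplex hx (hξ t ht)
      _ ≤ 2 * ω₀ * hS := hdiam
      _ ≤ N * hS := mul_le_mul_of_nonneg_right hNle hS0
  have hM₁ := hclosed t₁ ht₁ (hdiam₁.trans (mul_le_mul_of_nonneg_left hrS₁ (by positivity)))
  have hM₂ := hclosed t₂ ht₂ (hdiam₂.trans (mul_le_mul_of_nonneg_left hrS₂ (by positivity)))
  set R := min r₁ r₂ / d / 2 with hR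
  have hmin : 0 < min r₁ r₂ := lt_min hr₁ hr₂
  have hRpos : 0 < R := by positivity
  have hRmin : R ≤ min r₁ r₂ := by
    have hd1 : (1 : ℝ) ≤ d := by exact_mod_cast hd
    rw [hR, div_div, div_le_iff₀ (by positivity)]
    nlinarith
  have h2R : 2 * R = min r₁ r₂ / d := by rw [hR]; ring
  have hP : IsPatch Ω p σ pm pp (simplex t₁) (simplex t₂) y₀ ν R (Metric.diam (simplex t₁))
      (Metric.diam (simplex t₂)) (p (ξ t₁)) (p (ξ t₂)) (N * modulus p (simplex t₁) hS)
      (N * modulus p (simplex t₂) hS) :=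
    ⟨hν, hRpos, fun x hx h => hsub₁ x (h2R ▸ hx) h, fun x hx h => hsub₂ x (h2R ▸ hx) h,
      𝒯.simplex_subset_closure ht₁, 𝒯.simplex_subset_closure ht₂,
      hRmin.trans ((min_le_left _ _).trans hrd₁), hRmin.trans ((min_le_right _ _).trans hrd₂),
      hD.mem_Icc _ (𝒯.simplex_subset_closure ht₁ (hξ t₁ ht₁)),
      hD.mem_Icc _ (𝒯.simplex_subset_closure ht₂ (hξ t₂ ht₂)),
      fun x hx => ⟨hosc₁ x hx _ (hξ t₁ ht₁), hM₁ x hx, hosc₁ x hx _ hy₁⟩,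
      fun x hx => ⟨hosc₂ x hx _ (hξ t₂ ht₂), hM₂ x hx, hosc₂ x hx _ hy₂⟩⟩
  obtain ⟨g₁, b₁, hg₁⟩ := hv.2 t₁ ht₁
  obtain ⟨g₂, b₂, hg₂⟩ := hv.2 t₂ ht₂
  obtain ⟨l₁, n₁, hl₁⟩ := exists_isBaryCoords (𝒯.affineIndependent ht₁) ht₁.2
  obtain ⟨l₂, n₂, hl₂⟩ := exists_isBaryCoords (𝒯.affineIndependent ht₂) ht₂.2
  have ha₁ := gradOn_eq hl₁ ht₁.2 hg₁
  have ha₂ := gradOn_eq hl₂ ht₂.2 hg₂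
  -- The two affine pieces of v agree at the vertices of S and at y₀, so the gradient jump is
  -- orthogonal to the side.
  obtain ⟨τ, hτ⟩ := hpar (gradOn v t₁ - gradOn v t₂) fun w hw => by
    have e1 := hg₁ w (mem_simplex_of_mem (hSt₁ hw))
    have e2 := hg₂ w (mem_simplex_of_mem (hSt₂ hw))
    have e3 := hg₁ y₀ hy₁
    have e4 := hg₂ y₀ hy₂
    rw [ha₁, ha₂, inner_sub_left, inner_sub_right, inner_sub_right]
    linarith
  have hj := hjump Ω ΓD p f u G hD _ _ y₀ ν R _ _ _ _ _ _ (⨍ y in simplex t₁, f y)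
    (⨍ y in simplex t₂, f y) τ (gradOn v t₁) (gradOn v t₂) hP hτ
  have hL₁ := hloc Ω ΓD p f u G hD 𝒯 h𝒯 ξ hξ v S t₁ ht₁ hosc₁ hM₁
  have hL₂ := hloc Ω ΓD p f u G hD 𝒯 h𝒯 ξ hξ v S t₂ ht₂ hosc₂ hM₂
  set J := ‖opF δ (p (ξ t₁)) (gradOn v t₁) - opF δ (p (ξ t₂)) (gradOn v t₂)‖ ^ 2 with hJ
  have hJ0 : 0 ≤ J := by positivity
  have hSR : hS ≤ 4 * d * ω₀ * R := by
    have h1 : hS ≤ 2 * ω₀ * min r₁ r₂ := by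
      rcases min_choice r₁ r₂ with h | h <;> rw [h]
      · exact (diam_facet_le hSt₁).trans hdiam₁
      · exact (diam_facet_le hSt₂).trans hdiam₂
    refine h1.trans (le_of_eq ?_)
    rw [hR]; field_simp; ring
  -- The jump is constant on S and the surface measure is at most a multiple of h_S^{d-1}; together
  -- with the factor h_S this is comparable with R^d.
  have hside : sideJump δ p ξ v S t₁ t₂ ≤
      ENNReal.ofReal ((Cμ + 1) * (4 * d * ω₀) ^ d) * ENNReal.ofReal (R ^ d * J) := by
    rw [sideJump, setLIntegral_const, ← hJ]
    calc ENNReal.ofReal hS * (ENNReal.ofReal J * (μHE[d - 1] : Measure (Rd d)) (simplex S))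
        ≤ ENNReal.ofReal hS * (ENNReal.ofReal J * (Cμ * ENNReal.ofReal hS ^ (d - 1))) := by
          gcongr
          exact hCμ S hScard hd
      _ = Cμ * (ENNReal.ofReal hS ^ d * ENNReal.ofReal J) := by
          obtain ⟨k, rfl⟩ : ∃ k, d = k + 1 := ⟨d - 1, by omega⟩
          rw [Nat.add_sub_cancel, pow_succ]; ring
      _ ≤ ENNReal.ofReal (Cμ + 1) * (ENNReal.ofReal (4 * d * ω₀ * R) ^ d * ENNReal.ofReal J) := by
          have h1 : (Cμ : ℝ≥0∞) ≤ ENNReal.ofReal (Cμ + 1) := by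
            rw [← ENNReal.ofReal_coe_nnreal]
            exact ENNReal.ofReal_le_ofReal (by linarith)
          gcongr
      _ = _ := by
          rw [← ENNReal.ofReal_pow (by positivity), ← ENNReal.ofReal_mul (by positivity),
            ← ENNReal.ofReal_mul (by positivity), ← ENNReal.ofReal_mul (by positivity)]
          congr 1
          rw [mul_pow (4 * d * ω₀)]; ring
  refine hside.trans ?_
  calc _ ≤ ENNReal.ofReal ((Cμ + 1) * (4 * d * ω₀) ^ d) * (ENNReal.ofReal C₂ *
        (ENNReal.ofReal C₁ * (naturalDistance δ p ξ v G t₁ + sideExponentTerm p ξ v G (z ^ 2) S t₁ +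
          dataOscillation δ p ξ f v t₁) + ENNReal.ofReal C₁ * (naturalDistance δ p ξ v G t₂ +
          sideExponentTerm p ξ v G (z ^ 2) S t₂ + dataOscillation δ p ξ f v t₂))) := by
        gcongr
        exact hj.trans (mul_le_mul_right (add_le_add hL₁ hL₂) _)
    _ = _ := by
        rw [ENNReal.ofReal_mul (p := (Cμ + 1) * (4 * d * ω₀) ^ d * C₂) (by positivity),
          ENNReal.ofReal_mul (p := (Cμ + 1) * (4 * d * ω₀) ^ d) (by positivity)]
        ring

/-! ### The admissible oscillation -/

/-- The oscillation of the exponent that is admissible for the integrability gain `s`. -/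
def admissibleOscillation (pm s : ℝ) : ℝ := (√√s - 1) / (4 * (1 + 1 / (pm - 1)))

theorem admissibleOscillation_pos {pm s : ℝ} (hpm : 1 < pm) (hs : 1 < s) :
    0 < admissibleOscillation pm s := by
  have h1 : 0 < pm - 1 := by linarith
  have h2 : 1 < √√s := by
    rw [Real.lt_sqrt (by norm_num), one_pow, Real.lt_sqrt (by norm_num), one_pow]; exact hs
  have h3 : 0 < √√s - 1 := by linarith
  unfold admissibleOscillation
  positivity

/-- The definition makes 1+4σ(1+1/(p⁻-1)) equal to the fourth root of s, so each of the two factors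
is at most this root and their product is at most z = √s. As z² = s, the integrability exponent
matches the claim. -/
theorem isSmallOscillation_admissible {pm s : ℝ} (hpm : 1 < pm) (hs : 1 < s) :
    IsSmallOscillation pm (admissibleOscillation pm s) √s := by
  have hσ := admissibleOscillation_pos hpm hs
  have h1 : 0 < pm - 1 := by linarith
  refine ⟨hpm, hσ.le, by rw [Real.lt_sqrt (by norm_num), one_pow]; exact hs, ?_⟩
  set σ := admissibleOscillation pm s with hσdef
  have h2 : 1 + 4 * σ * (1 + 1 / (pm - 1)) = √√s := by
    rw [hσdef, admissibleOscillation]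
    have : 1 + 1 / (pm - 1) ≠ 0 := by positivity
    field_simp
    ring
  have h3 : 0 < σ / (pm - 1) := by positivity
  have h4 : σ * (1 + 1 / (pm - 1)) = σ + σ / (pm - 1) := by ring
  calc (1 + 4 * σ) * (1 + 4 * σ / (pm - 1)) ≤ √√s * √√s := by
        refine mul_le_mul ?_ ?_ (by positivity) (Real.sqrt_nonneg _)
        · rw [← h2]; linarith
        · rw [← h2, mul_div_assoc]; linarith
    _ = √s := Real.mul_self_sqrt (Real.sqrt_nonneg _)

/-- The admissible oscillation grows like the fourth root of s, so a large s tolerates the full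
range p⁺-p⁻ and removes any restriction on the mesh. The witness is a fourth power so that both
square roots evaluate exactly. -/
theorem exists_le_admissibleOscillation {pm : ℝ} (hpm : 1 < pm) (B : ℝ) (hB : 0 ≤ B) :
    ∃ s, 1 < s ∧ B ≤ admissibleOscillation pm s := by
  have h1 : 0 < pm - 1 := by linarith
  set A := 4 * (1 + 1 / (pm - 1)) with hA
  have hApos : 0 < A := by positivity
  have hbase : 1 < 1 + A * (B + 1) := by
    have : 0 < A * (B + 1) := by positivity
    linarith
  refine ⟨((1 + A * (B + 1)) ^ 2) ^ 2, ?_, ?_⟩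
  · exact one_lt_pow₀ (one_lt_pow₀ hbase two_ne_zero) two_ne_zero
  · rw [admissibleOscillation, Real.sqrt_sq (by positivity), Real.sqrt_sq (by positivity), ← hA,
      le_div_iff₀ hApos]
    linarith

/-- The mesh-size below which the oscillation of the exponent is at most `σ`. -/
theorem exists_meshSize {Ω : Set (Rd d)} (hΩ : Bornology.IsBounded Ω) {p : Rd d → ℝ} {pm pp σ : ℝ}
    (hp : ContinuousOn p (closure Ω)) (hpI : ∀ x ∈ closure Ω, p x ∈ Icc pm pp) (hσ : 0 < σ) :
    ∃ e : ℝ≥0∞, 0 < e ∧ (pp - pm ≤ σ → e = ∞) ∧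
      ∀ x ∈ closure Ω, ∀ y ∈ closure Ω, ENNReal.ofReal (dist x y) ≤ e → |p x - p y| ≤ σ := by
  by_cases h : pp - pm ≤ σ
  · refine ⟨∞, ENNReal.zero_lt_top, fun _ => rfl, fun x hx y hy _ => ?_⟩
    rw [abs_le]
    constructor <;> linarith [(hpI x hx).1, (hpI x hx).2, (hpI y hy).1, (hpI y hy).2]
  · have huc := hΩ.isCompact_closure.uniformContinuousOn_of_continuous hp
    obtain ⟨e, he, hpe⟩ := Metric.uniformContinuousOn_iff_le.1 huc σ hσ
    refine ⟨ENNReal.ofReal e, ENNReal.ofReal_pos.2 he, fun h' => absurd h' h,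
      fun x hx y hy hxy => ?_⟩
    rw [← Real.dist_eq]
    exact hpe x hx y hy ((ENNReal.ofReal_le_ofReal_iff he.le).1 hxy)

end

/-! ### Choice of the constants and of the mesh thresholds. -/

theorem mainTheorem7 (d : ℕ) (hd : 1 ≤ d) (pm pp δ ω₀ : ℝ) (hpm : 1 < pm) (hδ : 0 ≤ δ)
    (hω₀ : 0 < ω₀) :
    -- the constant, which depends only on `d`, `p⁻`, `p⁺`, `δ`, `ω₀` and `s`
    ∃ c : ℝ → ℝ, (∀ s, 0 < c s) ∧
      ∀ (Ω ΓD : Set (Rd d)), IsBoundedLipschitzDomain Ω →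
        IsClosed ΓD → ΓD ⊆ frontier Ω → 0 < (μHE[d - 1] : Measure (Rd d)) ΓD →
      ∀ p : Rd d → ℝ, ContinuousOn p (closure Ω) →
        IsLeast (p '' closure Ω) pm → IsGreatest (p '' closure Ω) pp →
      -- the mesh-size below which `s` is admissible; there is no restriction for some `s > 1`
      ∃ η : ℝ → ℝ≥0∞, (∀ s, 1 < s → 0 < η s) ∧ (∃ s, 1 < s ∧ η s = ∞) ∧
        ∀ 𝒯 : Triangulation Ω, ChunkinessLE 𝒯 ω₀ →
        ∀ ξ : Finset (Rd d) → Rd d, (∀ t ∈ 𝒯.elements, ξ t ∈ simplex t) →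
        ∀ f : Rd d → ℝ, MemLpVar Ω (fun x => p x / (p x - 1)) f →
          (∀ t ∈ 𝒯.elements, MemLpVar (simplex t) (fun _ => p (ξ t) / (p (ξ t) - 1)) f) →
        ∀ (u : Rd d → ℝ) (G : Rd d → Rd d), IsWeakSolution Ω ΓD δ p f u G →
        ∀ s, 1 < s → MemW1D Ω ΓD (fun x => p x * s) u G →
        ∀ v : Rd d → ℝ, IsP1D 𝒯 ΓD p v →
          (∀ t ∈ 𝒯.elements, ENNReal.ofReal (Metric.diam (simplex t)) ≤ η s →
            elementResidual δ p ξ f v t ≤ ENNReal.ofReal (c s) *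
              (naturalDistance δ p ξ v G t + elementExponentTerm p G s t
                + dataOscillation δ p ξ f v t)) ∧
          (∀ S t₁ t₂ : Finset (Rd d), 𝒯.IsInteriorSide S t₁ t₂ →
            ENNReal.ofReal (Metric.diam (simplex t₁)) ≤ η s →
            ENNReal.ofReal (Metric.diam (simplex t₂)) ≤ η s →
            sideJump δ p ξ v S t₁ t₂ ≤ ENNReal.ofReal (c s) *
              ((naturalDistance δ p ξ v G t₁ + naturalDistance δ p ξ v G t₂)
                + (sideExponentTerm p ξ v G s S t₁ + sideExponentTerm p ξ v G s S t₂)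
                + (dataOscillation δ p ξ f v t₁ + dataOscillation δ p ξ f v t₂))) := by
  -- The constants are fixed before the domain and the exponent appear. This is possible because
  -- smallness is required of the oscillation on single elements, and the mesh-size enters only
  -- later, through the uniform continuity of p.
  have hc : ∀ s : ℝ, ∃ c : ℝ, 0 < c ∧ (1 < s →
      (∀ (Ω ΓD : Set (Rd d)) (p f u : Rd d → ℝ) (G : Rd d → Rd d),
        IsDirichletData Ω ΓD δ pm pp p f u G →
        ∀ 𝒯 : Triangulation Ω, ChunkinessLE 𝒯 ω₀ →
        ∀ ξ : Finset (Rd d) → Rd d, (∀ t ∈ 𝒯.elements, ξ t ∈ simplex t) →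
        ∀ v : Rd d → ℝ, IsP1 𝒯 v →
          (∀ t ∈ 𝒯.elements,
            (∀ x ∈ simplex t, ∀ y ∈ simplex t, |p x - p y| ≤ admissibleOscillation pm s) →
            elementResidual δ p ξ f v t ≤ ENNReal.ofReal c *
              (naturalDistance δ p ξ v G t + elementExponentTerm p G s t
                + dataOscillation δ p ξ f v t)) ∧
          (∀ S t₁ t₂ : Finset (Rd d), 𝒯.IsInteriorSide S t₁ t₂ →
            (∀ x ∈ simplex t₁, ∀ y ∈ simplex t₁, |p x - p y| ≤ admissibleOscillation pm s) →
            (∀ x ∈ simplex t₂, ∀ y ∈ simplex t₂, |p x - p y| ≤ admissibleOscillation pm s) →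
            sideJump δ p ξ v S t₁ t₂ ≤ ENNReal.ofReal c *
              ((naturalDistance δ p ξ v G t₁ + naturalDistance δ p ξ v G t₂)
                + (sideExponentTerm p ξ v G s S t₁ + sideExponentTerm p ξ v G s S t₂)
                + (dataOscillation δ p ξ f v t₁ + dataOscillation δ p ξ f v t₂))))) := by
    intro s
    by_cases hs : 1 < s
    · have hσ := isSmallOscillation_admissible hpm hs
      have hz : √s ^ 2 = s := Real.sq_sqrt (by linarith)
      obtain ⟨C₁, hC₁, h1⟩ := exists_elementResidual_le d hd pm pp δ _ _ ω₀ hδ hω₀ hσ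
      obtain ⟨C₂, hC₂, h2⟩ := exists_sideJump_le d hd pm pp δ _ _ ω₀ hδ hω₀ hσ
      rw [hz] at h1 h2
      refine ⟨C₁ + C₂, by positivity, fun _ => ?_⟩
      intro Ω ΓD p f u G hD 𝒯 h𝒯 ξ hξ v hv
      refine ⟨fun t ht hosc => ?_, fun S t₁ t₂ hS hosc₁ hosc₂ => ?_⟩
      · refine (h1 Ω ΓD p f u G hD 𝒯 h𝒯 ξ hξ v t ht hosc _ fun x hx =>
          abs_sub_le_modulus (fun x hx => hD.mem_Icc x (𝒯.simplex_subset_closure ht hx)) hx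
            (hξ t ht) (dist_le_diam_simplex hx (hξ t ht))).trans ?_
        exact mul_le_mul_left (ENNReal.ofReal_le_ofReal (by linarith)) _
      · refine (h2 Ω ΓD p f u G hD 𝒯 h𝒯 ξ hξ v hv S t₁ t₂ hS hosc₁ hosc₂).trans ?_
        exact mul_le_mul_left (ENNReal.ofReal_le_ofReal (by linarith)) _
    -- For s ≤ 1 only positivity of the constant is claimed.
    · exact ⟨1, one_pos, fun h => absurd h hs⟩
  choose c hc0 hc using hc
  refine ⟨c, hc0, ?_⟩
  intro Ω ΓD hΩ _ _ _ p hp hmin hmax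
  have hpI : ∀ x ∈ closure Ω, p x ∈ Icc pm pp := fun x hx =>
    ⟨hmin.2 ⟨x, hx, rfl⟩, hmax.2 ⟨x, hx, rfl⟩⟩
  have hpp : pm ≤ pp := hmin.2 hmax.1
  have hη : ∀ s : ℝ, ∃ e : ℝ≥0∞, 1 < s → 0 < e ∧ (pp - pm ≤ admissibleOscillation pm s → e = ∞) ∧
      ∀ x ∈ closure Ω, ∀ y ∈ closure Ω, ENNReal.ofReal (dist x y) ≤ e →
        |p x - p y| ≤ admissibleOscillation pm s := by
    intro s
    by_cases hs : 1 < s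
    · obtain ⟨e, he⟩ := exists_meshSize hΩ.isBounded hp hpI (admissibleOscillation_pos hpm hs)
      exact ⟨e, fun _ => he⟩
    · exact ⟨1, fun h => absurd h hs⟩
  choose η hη using hη
  refine ⟨η, fun s hs => (hη s hs).1, ?_, ?_⟩
  · obtain ⟨s, hs, hB⟩ := exists_le_admissibleOscillation hpm (pp - pm) (by linarith)
    exact ⟨s, hs, (hη s hs).2.1 hB⟩
  · intro 𝒯 h𝒯 ξ hξ f hf _ u G hu s hs _ v hv
    have hD : IsDirichletData Ω ΓD δ pm pp p f u G := ⟨hΩ, hpm, hδ, hp, hpI, hf, hu⟩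
    have hosc : ∀ t ∈ 𝒯.elements, ENNReal.ofReal (Metric.diam (simplex t)) ≤ η s →
        ∀ x ∈ simplex t, ∀ y ∈ simplex t, |p x - p y| ≤ admissibleOscillation pm s :=
      fun t ht hdiam x hx y hy => (hη s hs).2.2 x (𝒯.simplex_subset_closure ht hx) y
        (𝒯.simplex_subset_closure ht hy)
        ((ENNReal.ofReal_le_ofReal (dist_le_diam_simplex hx hy)).trans hdiam)
    obtain ⟨h1, h2⟩ := hc s hs Ω ΓD p f u G hD 𝒯 h𝒯 ξ hξ v hv.1
    exact ⟨fun t ht hdiam => h1 t ht (hosc t ht hdiam), fun S t₁ t₂ hS hd₁ hd₂ =>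
      h2 S t₁ t₂ hS (hosc t₁ hS.1 hd₁) (hosc t₂ hS.2.1 hd₂)⟩
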